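/- Let $(M^{2n},g,J)$ be a connected strict nearly Kähler manifold: $g$ is a smooth Riemannian metric, $J$ a smooth $g$-orthogonal almost complex structure, and, with $\nabla$ the Levi-Civita connection of $g$, $(\nabla_XJ)X=0$ for all $X$ and $\nabla_XJ\neq0$ for every tangent vector $X\neq 0$. Let $\overline\nabla_XY=\nabla_XY+\tfrac12(\nabla_XJ)JY$ be the canonical Hermitian connection. Suppose that $TM=L\oplus E$ is a $g$-orthogonal, $J$-stable, $\overline\nabla$-parallel decomposition into smooth subbundles with $L$ of real rank two (this is what a reduction of the holonomy of $\overline\nabla$ to $U(1)\times U(n-1)$ provides). Let $F$ be the endomorphism of $TM$ defined by $g(FX,Y)=-\tfrac12\operatorname{Tr}_L\big((\nabla_XJ)(\nabla_YJ)\big)$, and suppose that $F|_E$ is injective at every point. Then there is a constant $k>0$ with $F|_E=\tfrac k4\,\mathrm{Id}_E$, and for this $k$ the following holds. Let $\overline g$ be the Riemannian metric with $\overline g=g$ on $E$, $\overline g=2g$ on $L$ and $L\perp_{\overline g}E$, and let $\overline J$ be the reversed almost complex structure, $\overline J|_E=J$ and $\overline J|_L=-J$. Then $\overline g$ and $\overline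 J$ are smooth, $\overline g$ is Einstein with $\mathrm{Ric}_{\overline g}=\tfrac{(n+1)k}{4}\,\overline g$, the almost complex structure $\overline J$ is integrable (its Nijenhuis tensor vanishes), and $(M,\overline g,\overline J)$ is Hermitian with closed Kähler form $\overline g(\overline J\cdot,\cdot)$. Hence $(M,\overline g,\overline J)$ is Kähler–Einstein. -/

import Mathlib

open Bundle FiberBundle VectorField
open scoped Manifold ContDiff

noncomputable section

namespace NearlyKahler

variable {E : Type*} [NormedAddCommGroup E] [NormedSpace ℝ E]
  {M : Type*} [TopologicalSpace M] [ChartedSpace E M]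

/-! ### Vector fields and Riemannian metrics -/

variable [IsManifold 𝓘(ℝ, E) ∞ M]

/-- A (global) smooth vector field on `M`. -/
def IsSmoothField (X : Π x : M, TangentSpace 𝓘(ℝ, E) x) : Prop :=
  ContMDiff 𝓘(ℝ, E) (𝓘(ℝ, E).prod 𝓘(ℝ, E)) ∞
    (fun x ↦ (⟨x, X x⟩ : TangentBundle 𝓘(ℝ, E) M))

variable (E M) in
/-- A smooth Riemannian metric on `M`. -/
abbrev Metric : Type _ :=
  ContMDiffRiemannianMetric 𝓘(ℝ, E) ∞ E (fun x : M ↦ TangentSpace 𝓘(ℝ, E) x)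

/-- The inner product of a Riemannian metric on the tangent space at `x`, as a bilinear form. -/
def Metric.form (g : Metric E M) (x : M) : LinearMap.BilinForm ℝ (TangentSpace 𝓘(ℝ, E) x) :=
  LinearMap.mk₂ ℝ (fun v w ↦ g.inner x v w) (by simp) (by simp) (by simp) (by simp)

@[simp]
theorem Metric.form_apply (g : Metric E M) (x : M) (v w : TangentSpace 𝓘(ℝ, E) x) :
    g.form x v w = g.inner x v w := rfl

theorem Metric.form_isRefl (g : Metric E M) (x : M) : (g.form x).IsRefl := by
  intro v w h
  rw [Metric.form_apply] at h ⊢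
  rw [g.symm, h]

theorem Metric.eq_zero_of_self (g : Metric E M) {x : M} {v : TangentSpace 𝓘(ℝ, E) x}
    (h : g.inner x v v = 0) : v = 0 := by
  by_contra hv
  exact (g.pos x v hv).ne' h

theorem Metric.form_nondegenerate (g : Metric E M) (x : M) : (g.form x).Nondegenerate :=
  ⟨fun v h ↦ g.eq_zero_of_self (h v), fun v h ↦ g.eq_zero_of_self (h v)⟩

theorem Metric.ext_inner (g : Metric E M) {x : M} {v w : TangentSpace 𝓘(ℝ, E) x}
    (h : ∀ u, g.inner x v u = g.inner x w u) : v = w := by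
  rw [← sub_eq_zero]
  apply g.eq_zero_of_self
  have e := h (v - w)
  rw [← sub_eq_zero, ← sub_apply, ← map_sub] at e
  exact e

theorem Metric.mdifferentiableAt_inner (g : Metric E M) {X Y : Π x : M, TangentSpace 𝓘(ℝ, E) x}
    {x : M} (hX : MDiffAt (T% X) x) (hY : MDiffAt (T% Y) x) :
    MDiffAt (fun y ↦ g.inner y (X y) (Y y)) x := by
  have h : MDifferentiableAt 𝓘(ℝ, E) (𝓘(ℝ, E).prod 𝓘(ℝ))
      (fun y ↦ TotalSpace.mk' ℝ (E := Bundle.Trivial M ℝ) y (g.inner y (X y) (Y y))) x :=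
    MDifferentiableAt.clm_bundle_apply₂ (F₁ := E) (F₂ := E)
      (g.contMDiff.mdifferentiableAt (by simp)) hX hY
  simp only [mdifferentiableAt_totalSpace] at h
  exact h.2

variable [FiniteDimensional ℝ E]

instance tangentFiniteDimensional (x : M) : FiniteDimensional ℝ (TangentSpace 𝓘(ℝ, E) x) :=
  inferInstanceAs (FiniteDimensional ℝ E)

instance tangentT2Space (x : M) : T2Space (TangentSpace 𝓘(ℝ, E) x) :=
  inferInstanceAs (T2Space E)

/-- The vector representing a linear functional on the tangent space at `x`:
`⟨sharp φ, w⟩ = φ w`. -/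
def Metric.sharp (g : Metric E M) (x : M) :
    Module.Dual ℝ (TangentSpace 𝓘(ℝ, E) x) →ₗ[ℝ] TangentSpace 𝓘(ℝ, E) x :=
  ((g.form x).toDual (g.form_nondegenerate x)).symm.toLinearMap

theorem Metric.inner_sharp (g : Metric E M) (x : M)
    (φ : Module.Dual ℝ (TangentSpace 𝓘(ℝ, E) x)) (w : TangentSpace 𝓘(ℝ, E) x) :
    g.inner x (g.sharp x φ) w = φ w :=
  LinearMap.BilinForm.apply_toDual_symm_apply (hB := g.form_nondegenerate x) φ w

/-! ### The Levi-Civita connection -/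

/-- The right-hand side of the Koszul formula,
`X⟨Y, Z⟩ + Y⟨X, Z⟩ - Z⟨X, Y⟩ + ⟨[X, Y], Z⟩ - ⟨[X, Z], Y⟩ - ⟨[Y, Z], X⟩`. -/
def koszul (g : Metric E M) (X Y Z : Π x : M, TangentSpace 𝓘(ℝ, E) x) (x : M) : ℝ :=
  mvfderiv 𝓘(ℝ, E) (fun y ↦ g.inner y (Y y) (Z y)) x (X x)
    + mvfderiv 𝓘(ℝ, E) (fun y ↦ g.inner y (X y) (Z y)) x (Y x)
    - mvfderiv 𝓘(ℝ, E) (fun y ↦ g.inner y (X y) (Y y)) x (Z x)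
    + g.inner x (mlieBracket 𝓘(ℝ, E) X Y x) (Z x)
    - g.inner x (mlieBracket 𝓘(ℝ, E) X Z x) (Y x)
    - g.inner x (mlieBracket 𝓘(ℝ, E) Y Z x) (X x)

theorem tensorial_koszul_left (g : Metric E M) {Y Z : Π x : M, TangentSpace 𝓘(ℝ, E) x} {x : M}
    (hY : MDiffAt (T% Y) x) (hZ : MDiffAt (T% Z) x) :
    TensorialAt 𝓘(ℝ, E) E (fun X ↦ koszul g X Y Z x) x where
  smul := by
    intro f X hf hX
    have : CompleteSpace E := FiniteDimensional.complete ℝ E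
    have h1 := mvfderiv_mul hf (g.mdifferentiableAt_inner hX hZ)
    have h2 := mvfderiv_mul hf (g.mdifferentiableAt_inner hX hY)
    have e1 : (fun y ↦ g.inner y ((f • X) y) (Z y)) = f * fun y ↦ g.inner y (X y) (Z y) := by
      ext y; simp
    have e2 : (fun y ↦ g.inner y ((f • X) y) (Y y)) = f * fun y ↦ g.inner y (X y) (Y y) := by
      ext y; simp
    simp only [koszul]
    rw [e1, e2, h1, h2, mlieBracket_smul_left hf hX, mlieBracket_smul_left hf hX]
    simp
    ring
  add := by
    intro X X' hX hX'
    have : CompleteSpace E := FiniteDimensional.complete ℝ E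
    have h1 := mvfderiv_add (g.mdifferentiableAt_inner hX hZ) (g.mdifferentiableAt_inner hX' hZ)
    have h2 := mvfderiv_add (g.mdifferentiableAt_inner hX hY) (g.mdifferentiableAt_inner hX' hY)
    have e1 : (fun y ↦ g.inner y ((X + X') y) (Z y))
        = (fun y ↦ g.inner y (X y) (Z y)) + fun y ↦ g.inner y (X' y) (Z y) := by
      ext y; simp
    have e2 : (fun y ↦ g.inner y ((X + X') y) (Y y))
        = (fun y ↦ g.inner y (X y) (Y y)) + fun y ↦ g.inner y (X' y) (Y y) := by
      ext y; simp
    simp only [koszul]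
    rw [e1, e2, h1, h2, mlieBracket_add_left hX hX', mlieBracket_add_left hX hX']
    simp
    ring

theorem tensorial_koszul_right (g : Metric E M) {X Y : Π x : M, TangentSpace 𝓘(ℝ, E) x} {x : M}
    (hX : MDiffAt (T% X) x) (hY : MDiffAt (T% Y) x) :
    TensorialAt 𝓘(ℝ, E) E (fun Z ↦ koszul g X Y Z x) x where
  smul := by
    intro f Z hf hZ
    have : CompleteSpace E := FiniteDimensional.complete ℝ E
    have h1 := mvfderiv_mul hf (g.mdifferentiableAt_inner hX hZ)
    have h2 := mvfderiv_mul hf (g.mdifferentiableAt_inner hY hZ)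
    have e1 : (fun y ↦ g.inner y (X y) ((f • Z) y)) = f * fun y ↦ g.inner y (X y) (Z y) := by
      ext y; simp
    have e2 : (fun y ↦ g.inner y (Y y) ((f • Z) y)) = f * fun y ↦ g.inner y (Y y) (Z y) := by
      ext y; simp
    simp only [koszul]
    rw [e1, e2, h1, h2, mlieBracket_smul_right hf hZ, mlieBracket_smul_right hf hZ]
    simp
    rw [g.symm x (Z x) (Y x), g.symm x (Z x) (X x)]
    ring
  add := by
    intro Z Z' hZ hZ'
    have : CompleteSpace E := FiniteDimensional.complete ℝ E
    have h1 := mvfderiv_add (g.mdifferentiableAt_inner hX hZ) (g.mdifferentiableAt_inner hX hZ')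
    have h2 := mvfderiv_add (g.mdifferentiableAt_inner hY hZ) (g.mdifferentiableAt_inner hY hZ')
    have e1 : (fun y ↦ g.inner y (X y) ((Z + Z') y))
        = (fun y ↦ g.inner y (X y) (Z y)) + fun y ↦ g.inner y (X y) (Z' y) := by
      ext y; simp
    have e2 : (fun y ↦ g.inner y (Y y) ((Z + Z') y))
        = (fun y ↦ g.inner y (Y y) (Z y)) + fun y ↦ g.inner y (Y y) (Z' y) := by
      ext y; simp
    simp only [koszul]
    rw [e1, e2, h1, h2, mlieBracket_add_right hZ hZ', mlieBracket_add_right hZ hZ']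
    simp
    ring

open Classical in
/-- The bilinear form `(v, w) ↦ 2 ⟨∇_v Y, w⟩` on the tangent space at `x` given by the Koszul
formula; it is `0` by convention where `Y` is not differentiable. -/
def koszulForm (g : Metric E M) (Y : Π x : M, TangentSpace 𝓘(ℝ, E) x) (x : M) :
    TangentSpace 𝓘(ℝ, E) x →L[ℝ] TangentSpace 𝓘(ℝ, E) x →L[ℝ] ℝ :=
  if hY : MDiffAt (T% Y) x then
    TensorialAt.mkHom₂ (F := E) (F' := E) (fun X Z ↦ koszul g X Y Z x) x
      (fun _ hZ ↦ tensorial_koszul_left g hY hZ) (fun _ hX ↦ tensorial_koszul_right g hX hY)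
  else 0

theorem koszulForm_apply (g : Metric E M) {X Y Z : Π x : M, TangentSpace 𝓘(ℝ, E) x} {x : M}
    (hX : MDiffAt (T% X) x) (hY : MDiffAt (T% Y) x) (hZ : MDiffAt (T% Z) x) :
    koszulForm g Y x (X x) (Z x) = koszul g X Y Z x := by
  rw [koszulForm, dif_pos hY, TensorialAt.mkHom₂_apply _ _ hX hZ]

/-- The function underlying the Levi-Civita connection: `leviCivitaFun g Y x v = ∇_v Y`. -/
def leviCivitaFun (g : Metric E M) (Y : Π x : M, TangentSpace 𝓘(ℝ, E) x) (x : M) :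
    TangentSpace 𝓘(ℝ, E) x →L[ℝ] TangentSpace 𝓘(ℝ, E) x :=
  LinearMap.toContinuousLinearMap
    ((1 / 2 : ℝ) • g.sharp x ∘ₗ ContinuousLinearMap.coeLM ℝ ∘ₗ (koszulForm g Y x).toLinearMap)

theorem inner_leviCivitaFun (g : Metric E M) {X Y Z : Π x : M, TangentSpace 𝓘(ℝ, E) x} {x : M}
    (hX : MDiffAt (T% X) x) (hY : MDiffAt (T% Y) x) (hZ : MDiffAt (T% Z) x) :
    g.inner x (leviCivitaFun g Y x (X x)) (Z x) = (1 / 2) * koszul g X Y Z x := by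
  rw [← koszulForm_apply g hX hY hZ]
  simp [leviCivitaFun, Metric.inner_sharp]

theorem leviCivitaFun_isCovariantDerivativeOn (g : Metric E M) :
    IsCovariantDerivativeOn E (leviCivitaFun g) Set.univ where
  add := by
    intro Y Y' x hY hY' _
    have : CompleteSpace E := FiniteDimensional.complete ℝ E
    ext v
    apply g.ext_inner
    intro u
    have hX := mdifferentiableAt_extend 𝓘(ℝ, E) E v
    have hZ := mdifferentiableAt_extend 𝓘(ℝ, E) E u
    have a := inner_leviCivitaFun g hX (mdifferentiableAt_add_section hY hY') hZ
    have b := inner_leviCivitaFun g hX hY hZ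
    have c := inner_leviCivitaFun g hX hY' hZ
    have h1 := mvfderiv_add (g.mdifferentiableAt_inner hX hY) (g.mdifferentiableAt_inner hX hY')
    have h2 := mvfderiv_add (g.mdifferentiableAt_inner hY hZ) (g.mdifferentiableAt_inner hY' hZ)
    have e1 : (fun y ↦ g.inner y (extend E v y) ((Y + Y') y))
        = (fun y ↦ g.inner y (extend E v y) (Y y)) + fun y ↦ g.inner y (extend E v y) (Y' y) := by
      ext y; simp
    have e2 : (fun y ↦ g.inner y ((Y + Y') y) (extend E u y))
        = (fun y ↦ g.inner y (Y y) (extend E u y)) + fun y ↦ g.inner y (Y' y) (extend E u y) := by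
      ext y; simp
    simp only [koszul] at a b c
    rw [e1, e2, h1, h2, mlieBracket_add_left hY hY', mlieBracket_add_right hY hY'] at a
    simp only [extend_apply_self, Pi.add_apply, map_add, add_apply] at a b c ⊢
    rw [a, b, c]
    ring
  leibniz := by
    intro Y f x hY hf _
    have : CompleteSpace E := FiniteDimensional.complete ℝ E
    ext v
    apply g.ext_inner
    intro u
    have hX := mdifferentiableAt_extend 𝓘(ℝ, E) E v
    have hZ := mdifferentiableAt_extend 𝓘(ℝ, E) E u
    have a := inner_leviCivitaFun g hX (hf.smul_section hY) hZ
    have b := inner_leviCivitaFun g hX hY hZ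
    have h1 := mvfderiv_mul hf (g.mdifferentiableAt_inner hX hY)
    have h2 := mvfderiv_mul hf (g.mdifferentiableAt_inner hY hZ)
    have e1 : (fun y ↦ g.inner y (extend E v y) ((f • Y) y))
        = f * fun y ↦ g.inner y (extend E v y) (Y y) := by
      ext y; simp
    have e2 : (fun y ↦ g.inner y ((f • Y) y) (extend E u y))
        = f * fun y ↦ g.inner y (Y y) (extend E u y) := by
      ext y; simp
    simp only [koszul] at a b
    rw [e1, e2, h1, h2, mlieBracket_smul_left hf hY, mlieBracket_smul_right hf hY] at a
    simp at a b ⊢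
    rw [a, b, g.symm x (Y x) v]
    ring

/-- The Levi-Civita connection of a Riemannian metric. `leviCivita g Y x v` is `∇_v Y`. -/
def leviCivita (g : Metric E M) :
    CovariantDerivative 𝓘(ℝ, E) E (fun x : M ↦ TangentSpace 𝓘(ℝ, E) x) :=
  ⟨leviCivitaFun g, leviCivitaFun_isCovariantDerivativeOn g⟩

/-- The Levi-Civita connection is torsion-free: `∇_X Y - ∇_Y X = [X, Y]`. -/
theorem leviCivita_torsion_free (g : Metric E M) {X Y : Π x : M, TangentSpace 𝓘(ℝ, E) x} {x : M}
    (hX : MDiffAt (T% X) x) (hY : MDiffAt (T% Y) x) :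
    leviCivita g Y x (X x) - leviCivita g X x (Y x) = mlieBracket 𝓘(ℝ, E) X Y x := by
  apply g.ext_inner
  intro u
  have hZ := mdifferentiableAt_extend 𝓘(ℝ, E) E u
  have a := inner_leviCivitaFun g hX hY hZ
  have b := inner_leviCivitaFun g hY hX hZ
  have e : (fun y ↦ g.inner y (X y) (Y y)) = fun y ↦ g.inner y (Y y) (X y) := by
    ext y; exact g.symm y _ _
  simp only [koszul] at a b
  rw [mlieBracket_swap_apply (V := Y) (W := X)] at b
  rw [e] at a
  simp only [extend_apply_self, map_neg, neg_apply] at a b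
  rw [map_sub, sub_apply]
  change g.inner x (leviCivitaFun g Y x (X x)) u - g.inner x (leviCivitaFun g X x (Y x)) u = _
  rw [a, b]
  ring

/-- The Levi-Civita connection is metric: `X⟨Y, Z⟩ = ⟨∇_X Y, Z⟩ + ⟨Y, ∇_X Z⟩`. -/
theorem leviCivita_metric (g : Metric E M) {X Y Z : Π x : M, TangentSpace 𝓘(ℝ, E) x} {x : M}
    (hX : MDiffAt (T% X) x) (hY : MDiffAt (T% Y) x) (hZ : MDiffAt (T% Z) x) :
    mvfderiv 𝓘(ℝ, E) (fun y ↦ g.inner y (Y y) (Z y)) x (X x)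
      = g.inner x (leviCivita g Y x (X x)) (Z x) + g.inner x (Y x) (leviCivita g Z x (X x)) := by
  have a := inner_leviCivitaFun g hX hY hZ
  have b := inner_leviCivitaFun g hX hZ hY
  have e : (fun y ↦ g.inner y (Z y) (Y y)) = fun y ↦ g.inner y (Y y) (Z y) := by
    ext y; exact g.symm y _ _
  simp only [koszul] at a b
  rw [mlieBracket_swap_apply (V := Z) (W := Y), e] at b
  simp only [map_neg, neg_apply] at b
  rw [g.symm x (Y x)]
  change _ = g.inner x (leviCivitaFun g Y x (X x)) (Z x)
    + g.inner x (leviCivitaFun g Z x (X x)) (Y x)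
  rw [a, b]
  ring

/-! ### Curvature -/

/-- The curvature `R(X, Y)Z = ∇_X ∇_Y Z - ∇_Y ∇_X Z - ∇_[X, Y] Z` of the Levi-Civita connection. -/
def curvature (g : Metric E M) (X Y Z : Π x : M, TangentSpace 𝓘(ℝ, E) x) (x : M) :
    TangentSpace 𝓘(ℝ, E) x :=
  leviCivita g (fun y ↦ leviCivita g Z y (Y y)) x (X x)
    - leviCivita g (fun y ↦ leviCivita g Z y (X y)) x (Y x)
    - leviCivita g Z x (mlieBracket 𝓘(ℝ, E) X Y x)

/-- The Ricci tensor: `ricci g x u v` is the trace of `w ↦ R(w, u)v`, computed in a basis of the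
tangent space at `x`. Tangent vectors are extended to vector fields that are smooth near `x`;
the value does not depend on the extensions. -/
def ricci (g : Metric E M) (x : M) (u v : TangentSpace 𝓘(ℝ, E) x) : ℝ :=
  let b := Module.finBasis ℝ (TangentSpace 𝓘(ℝ, E) x)
  ∑ i, b.repr (curvature g (extend E (b i)) (extend E u) (extend E v) x) i

/-- `g` is an Einstein metric with Einstein constant `c`, that is, `Ric = c g`. -/
def IsEinstein (g : Metric E M) (c : ℝ) : Prop :=
  ∀ (x : M) (u v : TangentSpace 𝓘(ℝ, E) x), ricci g x u v = c * g.inner x u v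

/-! ### Almost Hermitian, nearly Kähler and Kähler structures -/

variable (E M) in
/-- A smooth almost complex structure on `M`. -/
structure AlmostComplex where
  /-- The endomorphism of each tangent space. -/
  toFun (x : M) : TangentSpace 𝓘(ℝ, E) x →L[ℝ] TangentSpace 𝓘(ℝ, E) x
  smooth : ContMDiff 𝓘(ℝ, E) (𝓘(ℝ, E).prod 𝓘(ℝ, E →L[ℝ] E)) ∞
    (fun x ↦ TotalSpace.mk' (E →L[ℝ] E)
      (E := fun x : M ↦ TangentSpace 𝓘(ℝ, E) x →L[ℝ] TangentSpace 𝓘(ℝ, E) x) x (toFun x))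
  sq (x : M) (v : TangentSpace 𝓘(ℝ, E) x) : toFun x (toFun x v) = -v

instance : CoeFun (AlmostComplex E M)
    (fun _ ↦ (x : M) → TangentSpace 𝓘(ℝ, E) x →L[ℝ] TangentSpace 𝓘(ℝ, E) x) :=
  ⟨AlmostComplex.toFun⟩

theorem AlmostComplex.mdifferentiableAt_apply (J : AlmostComplex E M)
    {Y : Π x : M, TangentSpace 𝓘(ℝ, E) x} {x : M} (hY : MDiffAt (T% Y) x) :
    MDiffAt (T% fun y ↦ J y (Y y)) x :=
  MDifferentiableAt.clm_bundle_apply (F₁ := E) (F₂ := E)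
    (J.smooth.mdifferentiableAt (by simp)) hY

theorem tensorial_nablaJ (g : Metric E M) (J : AlmostComplex E M) (x : M) :
    TensorialAt 𝓘(ℝ, E) E
      (fun Y ↦ leviCivita g (fun y ↦ J y (Y y)) x - J x ∘L leviCivita g Y x) x where
  smul := by
    intro f Y hf hY
    have h1 := (leviCivita g).isCovariantDerivativeOnUniv.leibniz (x := x)
      (J.mdifferentiableAt_apply hY) hf
    have h2 := (leviCivita g).isCovariantDerivativeOnUniv.leibniz (x := x) hY hf
    have e : (fun y ↦ J y ((f • Y) y)) = f • fun y ↦ J y (Y y) := by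
      ext y; simp
    rw [e, h1, h2]
    ext v
    simp
    module
  add := by
    intro Y Y' hY hY'
    have h1 := (leviCivita g).isCovariantDerivativeOnUniv.add (x := x)
      (J.mdifferentiableAt_apply hY) (J.mdifferentiableAt_apply hY')
    have h2 := (leviCivita g).isCovariantDerivativeOnUniv.add (x := x) hY hY'
    have e : (fun y ↦ J y ((Y + Y') y)) = (fun y ↦ J y (Y y)) + fun y ↦ J y (Y' y) := by
      ext y; simp
    rw [e, h1, h2]
    ext v
    simp
    module

/-- The bilinear map `(w, v) ↦ (∇_v J)w = ∇_v (J W) - J (∇_v W)`, for any vector field `W`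
extending `w`, where `∇` is the Levi-Civita connection. -/
def nablaJFlip (g : Metric E M) (J : AlmostComplex E M) (x : M) :
    TangentSpace 𝓘(ℝ, E) x →L[ℝ] TangentSpace 𝓘(ℝ, E) x →L[ℝ] TangentSpace 𝓘(ℝ, E) x :=
  TensorialAt.mkHom (F := E) _ x (tensorial_nablaJ g J x)

/-- The covariant derivative of the almost complex structure with respect to the Levi-Civita
connection: `nablaJ g J x v w = (∇_v J)w`. -/
def nablaJ (g : Metric E M) (J : AlmostComplex E M) (x : M) :
    TangentSpace 𝓘(ℝ, E) x →ₗ[ℝ] TangentSpace 𝓘(ℝ, E) x →ₗ[ℝ] TangentSpace 𝓘(ℝ, E) x :=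
  LinearMap.mk₂ ℝ (fun v w ↦ nablaJFlip g J x w v) (by simp) (by simp) (by simp) (by simp)

/-- `(∇_X J)Y = ∇_X (J Y) - J (∇_X Y)`. -/
theorem nablaJ_apply (g : Metric E M) (J : AlmostComplex E M)
    {Y : Π x : M, TangentSpace 𝓘(ℝ, E) x} {x : M} (hY : MDiffAt (T% Y) x)
    (v : TangentSpace 𝓘(ℝ, E) x) :
    nablaJ g J x v (Y x) = leviCivita g (fun y ↦ J y (Y y)) x v - J x (leviCivita g Y x v) := by
  have h := congrArg (fun A ↦ A v) (TensorialAt.mkHom_apply (tensorial_nablaJ g J x) hY)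
  exact h

/-- `(g, J)` is an almost Hermitian structure. -/
def IsAlmostHermitian (g : Metric E M) (J : AlmostComplex E M) : Prop :=
  ∀ (x : M) (v w : TangentSpace 𝓘(ℝ, E) x), g.inner x (J x v) (J x w) = g.inner x v w

/-- `(g, J)` is a nearly Kähler structure: almost Hermitian with `(∇_X J)X = 0`. -/
def IsNearlyKahler (g : Metric E M) (J : AlmostComplex E M) : Prop :=
  IsAlmostHermitian g J ∧ ∀ (x : M) (v : TangentSpace 𝓘(ℝ, E) x), nablaJ g J x v v = 0

/-- Strictness: `∇_X J ≠ 0` for every nonzero tangent vector `X`. -/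
def IsStrict (g : Metric E M) (J : AlmostComplex E M) : Prop :=
  ∀ (x : M) (v : TangentSpace 𝓘(ℝ, E) x), v ≠ 0 → nablaJ g J x v ≠ 0

/-- Integrability of an almost complex structure: the Nijenhuis tensor
`[X, Y] + J[JX, Y] + J[X, JY] - [JX, JY]` vanishes. -/
def IsIntegrable (J : AlmostComplex E M) : Prop :=
  ∀ X Y : Π x : M, TangentSpace 𝓘(ℝ, E) x, IsSmoothField X → IsSmoothField Y → ∀ x : M,
    mlieBracket 𝓘(ℝ, E) X Y x
      + J x (mlieBracket 𝓘(ℝ, E) (fun y ↦ J y (X y)) Y x)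
      + J x (mlieBracket 𝓘(ℝ, E) X (fun y ↦ J y (Y y)) x)
      - mlieBracket 𝓘(ℝ, E) (fun y ↦ J y (X y)) (fun y ↦ J y (Y y)) x = 0

/-- The fundamental (Kähler) form `ω(X, Y) = ⟨JX, Y⟩`. -/
def kahlerForm (g : Metric E M) (J : AlmostComplex E M) (x : M)
    (v w : TangentSpace 𝓘(ℝ, E) x) : ℝ :=
  g.inner x (J x v) w

/-- The exterior derivative of a 2-form `β`, evaluated on three vector fields. -/
def extDeriv₂ (β : (x : M) → TangentSpace 𝓘(ℝ, E) x → TangentSpace 𝓘(ℝ, E) x → ℝ)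
    (X Y Z : Π x : M, TangentSpace 𝓘(ℝ, E) x) (x : M) : ℝ :=
  mvfderiv 𝓘(ℝ, E) (fun y ↦ β y (Y y) (Z y)) x (X x)
    - mvfderiv 𝓘(ℝ, E) (fun y ↦ β y (X y) (Z y)) x (Y x)
    + mvfderiv 𝓘(ℝ, E) (fun y ↦ β y (X y) (Y y)) x (Z x)
    - β x (mlieBracket 𝓘(ℝ, E) X Y x) (Z x)
    + β x (mlieBracket 𝓘(ℝ, E) X Z x) (Y x)
    - β x (mlieBracket 𝓘(ℝ, E) Y Z x) (X x)

/-- `(g, J)` is a Kähler structure: Hermitian, with `J` integrable and closed Kähler form. -/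
def IsKahler (g : Metric E M) (J : AlmostComplex E M) : Prop :=
  IsAlmostHermitian g J ∧ IsIntegrable J ∧
    ∀ X Y Z : Π x : M, TangentSpace 𝓘(ℝ, E) x,
      IsSmoothField X → IsSmoothField Y → IsSmoothField Z →
        ∀ x : M, extDeriv₂ (kahlerForm g J) X Y Z x = 0

/-! ### The canonical Hermitian connection and parallel distributions -/

/-- The canonical Hermitian connection `∇̄_X Y = ∇_X Y + (1/2) (∇_X J)(J Y)`. -/
def canonicalConnection (g : Metric E M) (J : AlmostComplex E M) :
    CovariantDerivative 𝓘(ℝ, E) E (fun x : M ↦ TangentSpace 𝓘(ℝ, E) x) :=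
  (leviCivita g).addOneForm (fun x ↦ ((1 / 2 : ℝ) • nablaJFlip g J x) ∘L J x)

theorem canonicalConnection_apply (g : Metric E M) (J : AlmostComplex E M)
    (Y : Π x : M, TangentSpace 𝓘(ℝ, E) x) (x : M) (v : TangentSpace 𝓘(ℝ, E) x) :
    canonicalConnection g J Y x v
      = leviCivita g Y x v + (1 / 2 : ℝ) • nablaJ g J x v (J x (Y x)) := rfl

variable (E M) in
/-- A choice of a linear subspace of each tangent space of `M`. -/
abbrev Distribution : Type _ := (x : M) → Submodule ℝ (TangentSpace 𝓘(ℝ, E) x)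

/-- `Y` is a smooth vector field which is a section of the distribution `D`. -/
def IsSectionOf (D : Distribution E M) (Y : Π x : M, TangentSpace 𝓘(ℝ, E) x) : Prop :=
  IsSmoothField Y ∧ ∀ x, Y x ∈ D x

/-- A distribution of constant rank `k` is smooth (a subbundle of the tangent bundle) when each of
its vectors is the value of a smooth section. -/
def IsSubbundle (D : Distribution E M) (k : ℕ) : Prop :=
  (∀ x, Module.finrank ℝ (D x) = k) ∧ ∀ (x : M), ∀ v ∈ D x, ∃ Y, IsSectionOf D Y ∧ Y x = v

/-- The distribution is stable by `J`. -/
def IsStable (J : AlmostComplex E M) (D : Distribution E M) : Prop :=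
  ∀ (x : M), ∀ v ∈ D x, J x v ∈ D x

/-- The distribution is parallel for the canonical Hermitian connection: `∇̄_v Y` is in `D` for
all sections `Y` of `D` and all tangent vectors `v`. -/
def IsParallel (g : Metric E M) (J : AlmostComplex E M) (D : Distribution E M) : Prop :=
  ∀ Y, IsSectionOf D Y → ∀ (x : M) (v : TangentSpace 𝓘(ℝ, E) x),
    canonicalConnection g J Y x v ∈ D x

/-- The orthogonal complement of a distribution. -/
def orthCompl (g : Metric E M) (D : Distribution E M) : Distribution E M :=
  fun x ↦ (g.form x).orthogonal (D x)

theorem isCompl_orthCompl (g : Metric E M) (D : Distribution E M) (x : M) :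
    IsCompl (D x) (orthCompl g D x) := by
  rw [orthCompl, LinearMap.BilinForm.isCompl_orthogonal_iff_disjoint (g.form_isRefl x),
    Submodule.disjoint_def]
  exact fun v hv hv' ↦ g.eq_zero_of_self (hv' v hv)

/-- The orthogonal projection of the tangent space at `x` onto `D x`. -/
def orthProj (g : Metric E M) (D : Distribution E M) (x : M) :
    TangentSpace 𝓘(ℝ, E) x →ₗ[ℝ] D x :=
  (D x).projectionOnto (orthCompl g D x) (isCompl_orthCompl g D x)

/-- The trace `Tr_D A` over `D x` of an endomorphism `A` of the tangent space at `x`, i.e.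
`∑ ⟨A e_i, e_i⟩` over an orthonormal basis of `D x`. -/
def traceOn (g : Metric E M) (D : Distribution E M) (x : M)
    (A : TangentSpace 𝓘(ℝ, E) x →ₗ[ℝ] TangentSpace 𝓘(ℝ, E) x) : ℝ :=
  LinearMap.trace ℝ (D x) (orthProj g D x ∘ₗ A ∘ₗ (D x).subtype)

/-- The bilinear form `(u, v) ↦ -(1/2) Tr_L (∇_u J)(∇_v J)`. -/
def torsionForm (g : Metric E M) (J : AlmostComplex E M) (L : Distribution E M) (x : M) :
    TangentSpace 𝓘(ℝ, E) x →ₗ[ℝ] TangentSpace 𝓘(ℝ, E) x →ₗ[ℝ] ℝ :=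
  LinearMap.mk₂ ℝ
    (fun u v ↦ -(1 / 2) * traceOn g L x
      (nablaJ g J x u ∘ₗ nablaJ g J x v))
    (by
      intro u u' v
      simp only [traceOn, map_add, LinearMap.add_comp,
        LinearMap.comp_add, mul_add])
    (by
      intro c u v
      simp only [traceOn, map_smul, LinearMap.smul_comp,
        LinearMap.comp_smul, smul_eq_mul]
      ring)
    (by
      intro u v v'
      simp only [traceOn, map_add, LinearMap.add_comp,
        LinearMap.comp_add, mul_add])
    (by
      intro c u v
      simp only [traceOn, map_smul, LinearMap.smul_comp,
        LinearMap.comp_smul, smul_eq_mul]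
      ring)

/-- The endomorphism `F` of the tangent bundle with `⟨F u, v⟩ = -(1/2) Tr_L (∇_u J)(∇_v J)`. -/
def torsionEndo (g : Metric E M) (J : AlmostComplex E M) (L : Distribution E M) (x : M) :
    TangentSpace 𝓘(ℝ, E) x →ₗ[ℝ] TangentSpace 𝓘(ℝ, E) x :=
  g.sharp x ∘ₗ torsionForm g J L x

theorem inner_torsionEndo (g : Metric E M) (J : AlmostComplex E M) (L : Distribution E M) (x : M)
    (u v : TangentSpace 𝓘(ℝ, E) x) :
    g.inner x (torsionEndo g J L x u) v = -(1 / 2) * traceOn g L x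
      (nablaJ g J x u ∘ₗ nablaJ g J x v) :=
  g.inner_sharp x _ v

/-! ### The modified metric and the reversed almost complex structure -/

/-- `g'` equals `g` on the orthogonal complement of `L` and `2g` on `L`, and keeps the two
orthogonal. -/
def IsModifiedMetric (g g' : Metric E M) (L : Distribution E M) : Prop :=
  ∀ x : M,
    (∀ v ∈ orthCompl g L x, ∀ w ∈ orthCompl g L x, g'.inner x v w = g.inner x v w) ∧
    (∀ v ∈ L x, ∀ w ∈ L x, g'.inner x v w = 2 * g.inner x v w) ∧
    (∀ v ∈ orthCompl g L x, ∀ w ∈ L x, g'.inner x v w = 0)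

/-- `J'` equals `J` on the orthogonal complement of `L` and `-J` on `L`. -/
def IsReversed (g : Metric E M) (J J' : AlmostComplex E M) (L : Distribution E M) : Prop :=
  ∀ x : M, (∀ v ∈ orthCompl g L x, J' x v = J x v) ∧ (∀ v ∈ L x, J' x v = -J x v)

end NearlyKahler

end

set_option linter.unusedSectionVars false

noncomputable section

/-! Write `T` for the torsion of the canonical connection `∇̄`, `T_v = T(v, ·)`, `R̄` for its
curvature, `P` for the projection onto `L`, and `ω̄ = ḡ(J̄·, ·)`. Since `T(X, Y) = (∇_X J)JY`, the
nearly Kähler condition makes `T` totally skew and `J`-antilinear, while `∇̄` preserves `g` and `J`.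
The first Bianchi identity with torsion and a type argument (`eq_zero_of_bianchi`) then force `∇̄T =
0` (`canon_nabTor`). Hence `R̄` acts on `T` as a derivation, is pair symmetric and preserves `L`,
and much of the proof is algebra on one tangent space (`HolonomyModel`).

Pair symmetry gives `R̄(v, x) = 0` for `v ∈ L` and `x ⊥ L`. With this, Bianchi shows that `T` maps
two vectors of `L^⊥` into `L` (`P_T`) and that `R̄(v, Jv) = -2 J T_v²` on `L^⊥` (`R_J_self`). The
derivation property turns this into `T_v³` proportional to `T_v`. Injectivity of `F` on `L^⊥` means
injectivity of `T_v` there, because `g(Fu, w) = g(T_v u, T_v w) / |v|²`; so `T_v² = -l |v|²` on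
`L^⊥` (`exists_T_T`), and `F = l` there. The number `l` is positive, and locally constant because
`g`, `T` and `L` are `∇̄`-parallel. The constant of the theorem is `k = 4l`.

The Levi-Civita connection of `ḡ` is `∇̄ + C` with `C_u z = -½ T(u - Pu, z + Pz)`. Each `C_u`
exchanges `L` and `L^⊥` and commutes with `J̄`, so `J̄` is parallel for `ḡ` and the structure is
Kähler.

For a Kähler metric `2 Ric(v, J̄u)` is the trace of `J̄` composed with the curvature at `(u, v)`.
The terms in `C` do not contribute to it (`trace_Jrev_curvature`), and `tr(J̄ R̄(u, v))` remains. On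
`L` the operator `R̄(u, v)` is `2l ω̄(u, v) J` (`R_mem`). Commuting `R̄(u, v)` past `T_v`, `0 ≠ v ∈
L`, transports this to a trace over `L^⊥`. The total is `2(n + 1) l ω̄(u, v)` (`trace_Jrev_R`), that
is `Ric = (n + 1) l ḡ`. -/

namespace NearlyKahler

section Manifold

variable {E : Type*} [NormedAddCommGroup E] [NormedSpace ℝ E]
  {M : Type*} [TopologicalSpace M] [ChartedSpace E M] [IsManifold 𝓘(ℝ, E) ∞ M]
  [FiniteDimensional ℝ E]

/-! ### Smooth functions and smooth vector fields -/

variable (E M) in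
/-- Smooth real functions on `M`. -/
abbrev SmoothFn : Type _ := C^∞⟮𝓘(ℝ, E), M; 𝓘(ℝ, ℝ), ℝ⟯

variable (E M) in
/-- Smooth vector fields on `M`. -/
abbrev VF : Type _ := Cₛ^∞⟮𝓘(ℝ, E); E, (fun x : M ↦ TangentSpace 𝓘(ℝ, E) x)⟯

theorem VF.mdiff (X : VF E M) (x : M) : MDiffAt (T% (fun y ↦ X y)) x :=
  X.mdifferentiableAt

theorem SmoothFn.mdiff (f : SmoothFn E M) (x : M) : MDiffAt (fun y ↦ f y) x :=
  f.contMDiff.mdifferentiableAt (by simp)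

/-- The product of a smooth function and a smooth vector field. -/
def fmul (f : SmoothFn E M) (X : VF E M) : VF E M :=
  ⟨(fun y ↦ f y) • fun y ↦ X y, f.contMDiff.smul_section X.contMDiff⟩

@[simp]
theorem fmul_apply (f : SmoothFn E M) (X : VF E M) (x : M) : fmul f X x = f x • X x := rfl

theorem natCast_le_infty (n : ℕ) : (n : ℕ∞ω) ≤ ∞ := by
  exact_mod_cast (le_top : (n : ℕ∞) ≤ ⊤)

theorem isManifold_of_le {n : ℕ} : IsManifold 𝓘(ℝ, E) (n : ℕ∞ω) M :=
  IsManifold.of_le (n := ∞) (natCast_le_infty n)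

/-- The Lie bracket of smooth vector fields. -/
def lie (X Y : VF E M) : VF E M :=
  have : CompleteSpace E := FiniteDimensional.complete ℝ E
  have : IsManifold 𝓘(ℝ, E) (minSmoothness ℝ 2) M := by
    rw [minSmoothness_of_isRCLikeNormedField]
    exact isManifold_of_le (n := 2)
  have : IsManifold 𝓘(ℝ, E) (((⊤ : ℕ∞) : ℕ∞ω) + 1) M := inferInstanceAs (IsManifold 𝓘(ℝ, E) ∞ M)
  ⟨mlieBracket 𝓘(ℝ, E) (fun y ↦ X y) (fun y ↦ Y y),
    fun _ ↦ ContMDiffAt.mlieBracket_vectorField (n := (⊤ : ℕ∞)) (m := (⊤ : ℕ∞))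
      X.contMDiff.contMDiffAt Y.contMDiff.contMDiffAt (by simp)⟩

theorem lie_apply (X Y : VF E M) (x : M) :
    lie X Y x = mlieBracket 𝓘(ℝ, E) (fun y ↦ X y) (fun y ↦ Y y) x := rfl

theorem lie_swap (X Y : VF E M) : lie Y X = -lie X Y := by
  ext x
  exact mlieBracket_swap_apply

theorem lie_add_left (X X' Y : VF E M) : lie (X + X') Y = lie X Y + lie X' Y := by
  have : CompleteSpace E := FiniteDimensional.complete ℝ E
  ext x
  exact mlieBracket_add_left (X.mdiff x) (X'.mdiff x)

theorem lie_add_right (X Y Y' : VF E M) : lie X (Y + Y') = lie X Y + lie X Y' := by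
  have : CompleteSpace E := FiniteDimensional.complete ℝ E
  ext x
  exact mlieBracket_add_right (Y.mdiff x) (Y'.mdiff x)

theorem lie_jacobi (X Y Z : VF E M) :
    lie X (lie Y Z) = lie (lie X Y) Z + lie Y (lie X Z) := by
  have : CompleteSpace E := FiniteDimensional.complete ℝ E
  have : IsManifold 𝓘(ℝ, E) (minSmoothness ℝ 3) M := by
    rw [minSmoothness_of_isRCLikeNormedField]
    exact isManifold_of_le (n := 3)
  ext x
  have h (W : VF E M) : CMDiffAt (minSmoothness ℝ 2) (T% (fun y ↦ W y)) x := by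
    rw [minSmoothness_of_isRCLikeNormedField]
    exact (W.contMDiff x).of_le (natCast_le_infty 2)
  exact leibniz_identity_mlieBracket_apply (h X) (h Y) (h Z)

/-- The derivative of a smooth function along a smooth vector field. -/
def dir (X : VF E M) (f : SmoothFn E M) : SmoothFn E M :=
  ⟨fun x ↦ mvfderiv 𝓘(ℝ, E) (fun y ↦ f y) x (X x), by
    -- Smooth as the fibre coordinate of the tangent map of `f` composed with `X`.
    have h : ContMDiff 𝓘(ℝ, E) 𝓘(ℝ, ℝ).tangent ∞
        (fun x ↦ tangentMap 𝓘(ℝ, E) 𝓘(ℝ, ℝ) f ⟨x, X x⟩) :=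
      (f.contMDiff.contMDiff_tangentMap (m := ∞) (by simp)).comp X.contMDiff
    exact (contMDiff_snd_tangentBundle_modelSpace ℝ 𝓘(ℝ, ℝ)).comp h⟩

theorem dir_apply (X : VF E M) (f : SmoothFn E M) (x : M) :
    dir X f x = mvfderiv 𝓘(ℝ, E) (fun y ↦ f y) x (X x) := rfl

theorem dir_add (X : VF E M) (f f' : SmoothFn E M) : dir X (f + f') = dir X f + dir X f' := by
  ext x
  exact congrArg (fun A ↦ A (X x)) (mvfderiv_add (f.mdiff x) (f'.mdiff x))

theorem dir_mul (X : VF E M) (f f' : SmoothFn E M) :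
    dir X (f * f') = f * dir X f' + f' * dir X f := by
  ext x
  have h := congrArg (fun A ↦ A (X x)) (mvfderiv_mul (f.mdiff x) (f'.mdiff x))
  exact h

theorem lie_fmul_right (f : SmoothFn E M) (X Y : VF E M) :
    lie X (fmul f Y) = fmul (dir X f) Y + fmul f (lie X Y) := by
  have : CompleteSpace E := FiniteDimensional.complete ℝ E
  ext x
  have h := mlieBracket_smul_right (V := fun y ↦ X y) (f.mdiff x) (Y.mdiff x)
  exact h

theorem lie_fmul_left (f : SmoothFn E M) (X Y : VF E M) :
    lie (fmul f X) Y = fmul f (lie X Y) - fmul (dir Y f) X := by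
  rw [lie_swap, lie_fmul_right, lie_swap X Y]
  ext x
  simp
  abel

/-! ### Cut-offs and extensions -/

section Extension

variable [T2Space M]

theorem exists_bump {x : M} {U : Set M} (hU : U ∈ nhds x) :
    ∃ χ : SmoothFn E M, (∀ᶠ y in nhds x, χ y = 1) ∧ tsupport χ ⊆ U := by
  obtain ⟨f, -, hf⟩ := (SmoothBumpFunction.nhds_basis_tsupport (I := 𝓘(ℝ, E)) x).mem_iff.1 hU
  exact ⟨⟨f, f.contMDiff⟩, f.eventuallyEq_one, hf⟩

/-- A cut-off replaces a local field by a global one with the same germ, so that the calculus can be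
carried out on globally defined fields. -/
theorem exists_VF_eventuallyEq {x : M} {s : Π x : M, TangentSpace 𝓘(ℝ, E) x}
    (hs : ∀ᶠ y in nhds x, CMDiffAt ∞ (T% s) y) :
    ∃ X : VF E M, ∀ᶠ y in nhds x, X y = s y := by
  obtain ⟨U, hU, hUo, hxU⟩ := eventually_nhds_iff.1 hs
  obtain ⟨χ, hχ, hsupp⟩ := exists_bump (E := E) (hUo.mem_nhds hxU)
  refine ⟨⟨(fun y ↦ χ y) • s, ContMDiffOn.smul_section_of_tsupport (u := U)
    χ.contMDiff.contMDiffOn hUo hsupp fun y hy ↦ (hU y hy).contMDiffWithinAt⟩, ?_⟩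
  filter_upwards [hχ] with y hy
  change χ y • s y = s y
  rw [hy, one_smul]

theorem exists_fn_eventuallyEq {x : M} {f : M → ℝ}
    (hf : ∀ᶠ y in nhds x, ContMDiffAt 𝓘(ℝ, E) 𝓘(ℝ, ℝ) ∞ f y) :
    ∃ F : SmoothFn E M, ∀ᶠ y in nhds x, F y = f y := by
  obtain ⟨U, hU, hUo, hxU⟩ := eventually_nhds_iff.1 hf
  obtain ⟨χ, hχ, hsupp⟩ := exists_bump (E := E) (hUo.mem_nhds hxU)
  refine ⟨⟨fun y ↦ χ y • f y, contMDiff_of_tsupport fun y hy ↦ ?_⟩, ?_⟩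
  · have hy' : y ∈ U := hsupp (closure_mono (Function.support_smul_subset_left _ _) hy)
    exact χ.contMDiff.contMDiffAt.smul (hU y hy')
  · filter_upwards [hχ] with y hy
    change χ y • f y = f y
    rw [hy, one_smul]

theorem exists_VF_extend {x : M} (v : TangentSpace 𝓘(ℝ, E) x) :
    ∃ X : VF E M, ∀ᶠ y in nhds x, X y = extend E v y := by
  obtain ⟨U, hU, h⟩ := exists_contMDiffOn_extend (k := ∞) 𝓘(ℝ, E) E v
  refine exists_VF_eventuallyEq ?_
  filter_upwards [eventually_mem_nhds_iff.2 hU] with y hy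
  exact (h y (mem_of_mem_nhds hy)).contMDiffAt hy

/-- A smooth vector field with a given value at `x`, equal to `extend E v` near `x`. -/
def extVF {x : M} (v : TangentSpace 𝓘(ℝ, E) x) : VF E M := (exists_VF_extend v).choose

theorem extVF_eventuallyEq {x : M} (v : TangentSpace 𝓘(ℝ, E) x) :
    ∀ᶠ y in nhds x, extVF v y = extend E v y := (exists_VF_extend v).choose_spec

@[simp]
theorem extVF_self {x : M} (v : TangentSpace 𝓘(ℝ, E) x) : extVF v x = v := by
  rw [(extVF_eventuallyEq v).self_of_nhds, extend_apply_self]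

/-- A linear choice of extensions of tangent vectors at `x` to smooth vector fields. -/
def linExt (x : M) : TangentSpace 𝓘(ℝ, E) x →ₗ[ℝ] VF E M :=
  (Module.finBasis ℝ (TangentSpace 𝓘(ℝ, E) x)).constr ℝ fun i ↦ extVF (Module.finBasis ℝ _ i)

/-- Evaluation of vector fields at `x`. -/
def evalVF (x : M) : VF E M →ₗ[ℝ] TangentSpace 𝓘(ℝ, E) x where
  toFun X := X x
  map_add' _ _ := rfl
  map_smul' _ _ := rfl

@[simp]
theorem linExt_self (x : M) (v : TangentSpace 𝓘(ℝ, E) x) : linExt x v x = v := by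
  have : evalVF x ∘ₗ linExt x = (LinearMap.id : TangentSpace 𝓘(ℝ, E) x →ₗ[ℝ] _) := by
    refine (Module.finBasis ℝ (TangentSpace 𝓘(ℝ, E) x)).ext fun i ↦ ?_
    simp [linExt, evalVF]
  exact congrArg (fun A ↦ A v) this

/-- A smooth frame on a neighbourhood of `x`, made of global fields; every field is a combination
of its members near `x`, with smooth coefficients. -/
theorem exists_frame (x : M) : ∃ (ι : Type) (_ : Fintype ι) (_ : DecidableEq ι) (e : ι → VF E M),
    (∀ᶠ y in nhds x, ∃ b : Module.Basis ι ℝ (TangentSpace 𝓘(ℝ, E) y), ∀ i, b i = e i y) ∧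
    ∀ X : VF E M, ∃ c : ι → SmoothFn E M, ∀ᶠ y in nhds x, X y = ∑ i, c i y • e i y := by
  classical
  let t := trivializationAt E (fun x : M ↦ TangentSpace 𝓘(ℝ, E) x) x
  have hx : x ∈ t.baseSet := FiberBundle.mem_baseSet_trivializationAt E _ x
  let b := Module.finBasis ℝ E
  have hb : ∀ᶠ y in nhds x, y ∈ t.baseSet := t.open_baseSet.mem_nhds hx
  have h1 (i) : ∃ X : VF E M, ∀ᶠ y in nhds x, X y = t.localFrame b i y := by
    refine exists_VF_eventuallyEq ?_
    filter_upwards [hb] with y hy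
    exact contMDiffAt_localFrame_of_mem ∞ _ b i hy
  choose e he using h1
  refine ⟨Fin (Module.finrank ℝ E), inferInstance, inferInstance, e, ?_, fun X ↦ ?_⟩
  · filter_upwards [hb, Filter.eventually_all.2 he] with y hy he
    refine ⟨(t.isLocalFrameOn_localFrame_baseSet 𝓘(ℝ, E) ∞ b).toBasisAt hy, fun i ↦ ?_⟩
    rw [IsLocalFrameOn.toBasisAt_coe, he]
  · have h2 (i) : ∃ c : SmoothFn E M, ∀ᶠ y in nhds x,
        c y = t.localFrameCoeff 𝓘(ℝ, E) b i y (X y) := by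
      refine exists_fn_eventuallyEq ?_
      filter_upwards [hb] with y hy
      exact contMDiffAt_localFrameCoeff b hy X.contMDiff.contMDiffAt i
    choose c hc using h2
    refine ⟨c, ?_⟩
    have h3 := t.eventually_eq_localFrame_sum_coeff_smul (I := 𝓘(ℝ, E)) (s := fun y ↦ X y) b hx
    filter_upwards [h3, Filter.eventually_all.2 hc, Filter.eventually_all.2 he] with y h3 h4 h5
    rw [h3]
    simp [h4, h5]

/-- An additive, function-linear operation on smooth vector fields depends only on the value of the
field at the point. -/
theorem tensorial_congr {A : Type*} [AddCommGroup A] [Module ℝ A] {x : M} (Φ : VF E M → A)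
    (hadd : ∀ X Y, Φ (X + Y) = Φ X + Φ Y) (hmul : ∀ f X, Φ (fmul f X) = f x • Φ X)
    {X Y : VF E M} (h : X x = Y x) : Φ X = Φ Y := by
  classical
  have hz : Φ 0 = 0 := by simpa using hadd 0 0
  -- Locality: a cut-off equal to 1 at `x` and supported where the two fields agree gives them the
  -- same product.
  have hloc : ∀ X Y : VF E M, (∀ᶠ y in nhds x, X y = Y y) → Φ X = Φ Y := by
    intro X Y hXY
    obtain ⟨χ, hχ, hs⟩ := exists_bump (E := E) (hXY)
    have : fmul χ X = fmul χ Y := by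
      ext y
      by_cases hy : y ∈ tsupport χ
      · have : X y = Y y := hs hy
        simp [this]
      · simp [image_eq_zero_of_notMem_tsupport hy]
    have h1 := hmul χ X
    rw [this, hmul, hχ.self_of_nhds, one_smul, one_smul] at h1
    exact h1.symm
  obtain ⟨ι, _, _, e, he, hc⟩ := exists_frame (E := E) x
  obtain ⟨b, hb⟩ := he.self_of_nhds
  have hsum (s : Finset ι) (Z : ι → VF E M) : Φ (∑ i ∈ s, Z i) = ∑ i ∈ s, Φ (Z i) := by
    induction s using Finset.induction_on with
    | empty => simpa using hz
    | insert a s ha ih => rw [Finset.sum_insert ha, hadd, ih, Finset.sum_insert ha]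
  have heval (s : Finset ι) (Z : ι → VF E M) (y : M) : (∑ i ∈ s, Z i) y = ∑ i ∈ s, Z i y :=
    map_sum (evalVF y) Z s
  obtain ⟨c, hc1⟩ := hc X
  obtain ⟨d, hd1⟩ := hc Y
  rw [hloc X (∑ i, fmul (c i) (e i)) (hc1.mono fun y hy ↦ by rw [heval]; simpa using hy),
    hloc Y (∑ i, fmul (d i) (e i)) (hd1.mono fun y hy ↦ by rw [heval]; simpa using hy), hsum, hsum]
  refine Finset.sum_congr rfl fun i _ ↦ ?_
  -- The frame is a basis at `x`, so equal values there force equal coefficients at `x`.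
  have h2 : ∑ i, (c i x - d i x) • e i x = 0 := by
    simp only [sub_smul, Finset.sum_sub_distrib]
    rw [← hc1.self_of_nhds, ← hd1.self_of_nhds, h, sub_self]
  have h3 := Fintype.linearIndependent_iff.1 b.linearIndependent _ (by simpa only [hb] using h2) i
  rw [hmul, hmul, sub_eq_zero.1 h3]

/-- `[X, Y] f = X Y f - Y X f`. -/
theorem dir_lie (X Y : VF E M) (f : SmoothFn E M) :
    dir (lie X Y) f = dir X (dir Y f) - dir Y (dir X f) := by
  ext x
  -- The formula is read off from the Jacobi identity for `X`, `Y` and `fV` with `V x ≠ 0`. If there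
  -- is no nonzero tangent vector at `x`, every directional derivative there is zero.
  by_cases hZ : ∀ v : TangentSpace 𝓘(ℝ, E) x, v = 0
  · have h (W : VF E M) (f : SmoothFn E M) : dir W f x = 0 := by
      rw [dir_apply, hZ (W x), map_zero]
    simp [h]
  · push Not at hZ
    obtain ⟨v, hv⟩ := hZ
    have h1 := lie_jacobi X Y (fmul f (extVF v))
    simp only [lie_fmul_right, lie_add_right] at h1
    rw [lie_jacobi] at h1
    have h2 := congrArg (fun W : VF E M ↦ W x) h1
    simp only [ContMDiffSection.coe_add, Pi.add_apply, fmul_apply, extVF_self] at h2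
    have h3 : (dir (lie X Y) f x - (dir X (dir Y f) x - dir Y (dir X f) x)) • v = 0 := by
      rw [← sub_eq_zero] at h2
      rw [← neg_eq_zero, ← h2]
      module
    exact sub_eq_zero.1 ((smul_eq_zero.1 h3).resolve_right hv)

end Extension

/-! ### Smoothness criteria -/

/-- The inner product of two smooth vector fields. -/
def Metric.ip (g : Metric E M) (X Y : VF E M) : SmoothFn E M :=
  ⟨fun y ↦ g.inner y (X y) (Y y), by
    have h : ContMDiff 𝓘(ℝ, E) (𝓘(ℝ, E).prod 𝓘(ℝ)) ∞
        (fun y ↦ TotalSpace.mk' ℝ (E := Bundle.Trivial M ℝ) y (g.inner y (X y) (Y y))) :=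
      ContMDiff.clm_bundle_apply₂ (F₁ := E) (F₂ := E) g.contMDiff X.contMDiff Y.contMDiff
    intro x
    exact (contMDiffAt_totalSpace.1 (h x)).2⟩

@[simp]
theorem Metric.ip_apply (g : Metric E M) (X Y : VF E M) (x : M) :
    g.ip X Y x = g.inner x (X x) (Y x) := rfl

theorem contMDiffAt_matrix_det {ι : Type*} [Fintype ι] [DecidableEq ι] {A : M → Matrix ι ι ℝ}
    {x : M}
    (hA : ∀ i j, ContMDiffAt 𝓘(ℝ, E) 𝓘(ℝ, ℝ) ∞ (fun y ↦ A y i j) x) :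
    ContMDiffAt 𝓘(ℝ, E) 𝓘(ℝ, ℝ) ∞ (fun y ↦ (A y).det) x := by
  simp only [Matrix.det_apply]
  refine ContMDiffAt.sum fun σ _ ↦ ?_
  simp only [Units.smul_def, zsmul_eq_mul]
  exact contMDiffAt_const.mul (ContMDiffAt.prod fun i _ ↦ hA _ _)

theorem contMDiffAt_matrix_inv {ι : Type*} [Fintype ι] [DecidableEq ι] {A : M → Matrix ι ι ℝ}
    {x : M}
    (hA : ∀ i j, ContMDiffAt 𝓘(ℝ, E) 𝓘(ℝ, ℝ) ∞ (fun y ↦ A y i j) x) (hx : (A x).det ≠ 0) (i j : ι) :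
    ContMDiffAt 𝓘(ℝ, E) 𝓘(ℝ, ℝ) ∞ (fun y ↦ (A y)⁻¹ i j) x := by
  simp only [Matrix.inv_def, Ring.inverse_eq_inv', Matrix.smul_apply, smul_eq_mul]
  refine ((contMDiffAt_matrix_det hA).inv₀ hx).mul ?_
  simp only [Matrix.adjugate_apply]
  refine contMDiffAt_matrix_det fun k l ↦ ?_
  by_cases h : k = j
  · subst h
    simpa using contMDiffAt_const
  · simpa [Matrix.updateRow_ne h] using hA k l

section Criteria

variable [T2Space M]

/-- A vector field is smooth if its inner products with all smooth fields are. -/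
theorem Metric.contMDiff_of_inner (g : Metric E M) {s : Π x : M, TangentSpace 𝓘(ℝ, E) x}
    (h : ∀ Z : VF E M, ContMDiff 𝓘(ℝ, E) 𝓘(ℝ, ℝ) ∞ (fun y ↦ g.inner y (s y) (Z y))) :
    IsSmoothField s := by
  intro x
  obtain ⟨ι, _, _, e, he, -⟩ := exists_frame (E := E) x
  -- The Gram matrix of the frame. The coefficients of `s` are `G⁻¹` applied to the inner products
  -- of `s` with the frame, and `G⁻¹` is smooth by Cramer's rule.
  let G : M → Matrix ι ι ℝ := fun y ↦ Matrix.of fun i j ↦ g.inner y (e i y) (e j y)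
  have hG : ∀ y, (∃ b : Module.Basis ι ℝ (TangentSpace 𝓘(ℝ, E) y), ∀ i, b i = e i y) →
      (G y).det ≠ 0 := by
    rintro y ⟨b, hb⟩
    have h1 : G y = LinearMap.BilinForm.toMatrix b (g.form y) := by
      ext i j
      rw [LinearMap.BilinForm.toMatrix_apply, hb, hb]
      rfl
    rw [h1]
    exact (LinearMap.BilinForm.nondegenerate_iff_det_ne_zero b).1 (g.form_nondegenerate y)
  have hsum : ∀ᶠ y in nhds x, s y = ∑ i, (∑ j, (G y)⁻¹ i j * g.inner y (s y) (e j y)) • e i y := by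
    filter_upwards [he] with y hy
    obtain ⟨b, hb⟩ := hy
    have h2 (j) : g.inner y (s y) (e j y) = ∑ i, G y i j * b.repr (s y) i := by
      conv_lhs => rw [← b.sum_repr (s y)]
      simp [hb, G, mul_comm]
    have h3 : (fun i ↦ ∑ j, (G y)⁻¹ i j * g.inner y (s y) (e j y)) = b.repr (s y) := by
      have h4 : (fun j ↦ g.inner y (s y) (e j y)) = (G y).transpose.mulVec (b.repr (s y)) := by
        ext j
        rw [h2]; rfl
      have h5 : (G y).transpose = G y := by
        ext i j
        exact g.symm _ _ _
      have h6 : (fun i ↦ ∑ j, (G y)⁻¹ i j * g.inner y (s y) (e j y))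
          = (G y)⁻¹.mulVec (fun j ↦ g.inner y (s y) (e j y)) := rfl
      rw [h6, h4, h5, Matrix.mulVec_mulVec,
        Matrix.nonsing_inv_mul _ (isUnit_iff_ne_zero.2 (hG y ⟨b, hb⟩)), Matrix.one_mulVec]
    have h7 := b.sum_repr (s y)
    conv_lhs => rw [← h7]
    refine Finset.sum_congr rfl fun i _ ↦ ?_
    rw [hb, ← congrFun h3 i]
  have hsm : CMDiffAt ∞ (T% (fun y ↦
      ∑ i, (∑ j, (G y)⁻¹ i j * g.inner y (s y) (e j y)) • e i y)) x := by
    refine ContMDiffAt.sum_section fun i _ ↦ ContMDiffAt.smul_section ?_ (e i).contMDiff.contMDiffAt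
    refine ContMDiffAt.sum fun j _ ↦ ContMDiffAt.mul ?_ (h (e j)).contMDiffAt
    exact contMDiffAt_matrix_inv (fun i j ↦ (g.ip (e i) (e j)).contMDiff.contMDiffAt)
      (hG x he.self_of_nhds) i j
  refine hsm.congr_of_eventuallyEq ?_
  filter_upwards [hsum] with y hy
  simp only [← hy]

/-- A section of a bundle of linear maps from the tangent bundle is smooth if it takes smooth
vector fields to smooth sections. -/
theorem contMDiff_hom_of_apply {F₂ : Type*} [NormedAddCommGroup F₂] [NormedSpace ℝ F₂]
    {V₂ : M → Type*} [TopologicalSpace (TotalSpace F₂ V₂)] [∀ x, AddCommGroup (V₂ x)]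
    [∀ x, Module ℝ (V₂ x)] [∀ x, TopologicalSpace (V₂ x)] [∀ x, IsTopologicalAddGroup (V₂ x)]
    [∀ x, ContinuousSMul ℝ (V₂ x)] [FiberBundle F₂ V₂] [VectorBundle ℝ F₂ V₂]
    {φ : Π x : M, TangentSpace 𝓘(ℝ, E) x →L[ℝ] V₂ x}
    (h : ∀ Z : VF E M, ContMDiff 𝓘(ℝ, E) (𝓘(ℝ, E).prod 𝓘(ℝ, F₂)) ∞
      (fun x ↦ TotalSpace.mk' F₂ x (φ x (Z x)))) :
    ContMDiff 𝓘(ℝ, E) (𝓘(ℝ, E).prod 𝓘(ℝ, E →L[ℝ] F₂)) ∞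
      (fun x ↦ TotalSpace.mk' (E →L[ℝ] F₂)
        (E := fun x : M ↦ TangentSpace 𝓘(ℝ, E) x →L[ℝ] V₂ x) x (φ x)) := by
  intro x
  rw [contMDiffAt_hom_bundle]
  refine ⟨contMDiffAt_id, ?_⟩
  let b := Module.finBasis ℝ E
  -- Expansion in a fixed basis of the model space reduces smoothness of `φ` in coordinates to that
  -- of its values on a local frame.
  have hb (A : E →L[ℝ] F₂) :
      A = ∑ i, (LinearMap.toContinuousLinearMap (b.coord i)).smulRight (A (b i)) := by
    ext v
    conv_lhs => rw [← b.sum_repr v, map_sum]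
    simp
  rw [funext fun y ↦
    hb (ContinuousLinearMap.inCoordinates E (TangentSpace 𝓘(ℝ, E)) F₂ V₂ x y x y (φ y))]
  refine ContMDiffAt.sum fun i _ ↦ ?_
  refine ContDiff.comp_contMDiffAt
    (g := (ContinuousLinearMap.smulRightL ℝ E F₂ (LinearMap.toContinuousLinearMap (b.coord i))))
    (ContinuousLinearMap.contDiff _) ?_
  let t := trivializationAt E (fun x : M ↦ TangentSpace 𝓘(ℝ, E) x) x
  let t₂ := trivializationAt F₂ V₂ x
  have hx : x ∈ t.baseSet := FiberBundle.mem_baseSet_trivializationAt E _ x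
  have hx₂ : x ∈ t₂.baseSet := FiberBundle.mem_baseSet_trivializationAt F₂ _ x
  have ht : ∀ᶠ y in nhds x, y ∈ t.baseSet := t.open_baseSet.mem_nhds hx
  have ht₂ : ∀ᶠ y in nhds x, y ∈ t₂.baseSet := t₂.open_baseSet.mem_nhds hx₂
  obtain ⟨Z, hZ⟩ : ∃ X : VF E M, ∀ᶠ y in nhds x, X y = t.localFrame b i y := by
    refine exists_VF_eventuallyEq ?_
    filter_upwards [ht] with y hy
    exact contMDiffAt_localFrame_of_mem ∞ _ b i hy
  have h1 := (contMDiffAt_totalSpace.1 (h Z x)).2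
  refine h1.congr_of_eventuallyEq ?_
  filter_upwards [ht, ht₂, hZ] with y hy hy₂ hZ
  rw [ContinuousLinearMap.inCoordinates_eq hy hy₂, hZ, t.localFrame_apply_of_mem_baseSet b hy]
  simp [Trivialization.basisAt]
  rfl

end Criteria

/-! ### Connections on smooth vector fields -/

theorem fmul_sub (f : SmoothFn E M) (X Y : VF E M) : fmul f (X - Y) = fmul f X - fmul f Y := by
  ext x; simp [smul_sub]

theorem smul_eq_fmul (r : ℝ) (X : VF E M) : r • X = fmul (ContMDiffMap.const r) X := by
  ext x; rfl

theorem dir_const (X : VF E M) (r : ℝ) : dir X (ContMDiffMap.const r) = 0 := by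
  ext x
  exact congrArg (fun A ↦ A (X x)) (mvfderiv_const (I := 𝓘(ℝ, E)) r (x := x))

variable (E M) in
/-- A connection on the tangent bundle, acting on smooth vector fields: `nab X Y = ∇_X Y`. -/
structure Conn where
  nab : VF E M → VF E M → VF E M
  add_left (X X' Y : VF E M) : nab (X + X') Y = nab X Y + nab X' Y
  fmul_left (f : SmoothFn E M) (X Y : VF E M) : nab (fmul f X) Y = fmul f (nab X Y)
  add_right (X Y Y' : VF E M) : nab X (Y + Y') = nab X Y + nab X Y'
  leibniz (f : SmoothFn E M) (X Y : VF E M) :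
    nab X (fmul f Y) = fmul (dir X f) Y + fmul f (nab X Y)

namespace Conn

variable (c : Conn E M)

theorem smul_left (r : ℝ) (X Y : VF E M) : c.nab (r • X) Y = r • c.nab X Y := by
  rw [smul_eq_fmul, fmul_left, ← smul_eq_fmul]

theorem smul_right (r : ℝ) (X Y : VF E M) : c.nab X (r • Y) = r • c.nab X Y := by
  rw [smul_eq_fmul, leibniz, ← smul_eq_fmul, dir_const]
  ext x
  simp

/-- A connection as a bilinear map. -/
def bil : VF E M →ₗ[ℝ] VF E M →ₗ[ℝ] VF E M :=
  LinearMap.mk₂ ℝ c.nab c.add_left c.smul_left c.add_right c.smul_right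

theorem neg_left (X Y : VF E M) : c.nab (-X) Y = -c.nab X Y := LinearMap.map_neg₂ c.bil X Y

theorem neg_right (X Y : VF E M) : c.nab X (-Y) = -c.nab X Y := map_neg (c.bil X) Y

theorem sub_left (X X' Y : VF E M) : c.nab (X - X') Y = c.nab X Y - c.nab X' Y :=
  LinearMap.map_sub₂ c.bil X X' Y

theorem sub_right (X Y Y' : VF E M) : c.nab X (Y - Y') = c.nab X Y - c.nab X Y' :=
  map_sub (c.bil X) Y Y'

/-- The torsion of a connection. -/
def tor (X Y : VF E M) : VF E M := c.nab X Y - c.nab Y X - lie X Y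

theorem tor_swap (X Y : VF E M) : c.tor Y X = -c.tor X Y := by
  rw [tor, tor, lie_swap X Y]
  abel

theorem tor_add_left (X X' Y : VF E M) : c.tor (X + X') Y = c.tor X Y + c.tor X' Y := by
  simp only [tor, add_left, add_right, lie_add_left]
  abel

theorem tor_add_right (X Y Y' : VF E M) : c.tor X (Y + Y') = c.tor X Y + c.tor X Y' := by
  rw [tor_swap, tor_add_left, c.tor_swap X, c.tor_swap X]
  simp only [neg_add, neg_neg]

theorem tor_neg_left (X Y : VF E M) : c.tor (-X) Y = -c.tor X Y := by
  have h := c.tor_add_left X (-X) Y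
  have h0 := c.tor_add_left 0 0 Y
  simp only [add_zero, left_eq_add] at h0
  rw [add_neg_cancel, h0] at h
  exact (neg_eq_of_add_eq_zero_right h.symm).symm

/-- The curvature of a connection. -/
def curv (X Y Z : VF E M) : VF E M :=
  c.nab X (c.nab Y Z) - c.nab Y (c.nab X Z) - c.nab (lie X Y) Z

/-- The covariant derivative of the torsion. -/
def nabTor (X Y Z : VF E M) : VF E M :=
  c.nab X (c.tor Y Z) - c.tor (c.nab X Y) Z - c.tor Y (c.nab X Z)

/-- The first Bianchi identity for a connection with torsion. -/
theorem bianchi (X Y Z : VF E M) :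
    c.curv X Y Z + c.curv Y Z X + c.curv Z X Y =
      c.nabTor X Y Z + c.nabTor Y Z X + c.nabTor Z X Y
        + (c.tor (c.tor X Y) Z + c.tor (c.tor Y Z) X + c.tor (c.tor Z X) Y) := by
  have hT (A B C : VF E M) : c.tor (c.tor A B) C
      = c.tor (c.nab A B) C - c.tor (c.nab B A) C - c.tor (lie A B) C := by
    conv_lhs => rw [tor.eq_1 c A B]
    simp only [sub_eq_add_neg, tor_add_left, tor_neg_left]
  have hs (A B C : VF E M) : c.tor A (c.nab B C) = -c.tor (c.nab B C) A := c.tor_swap _ _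
  have hn (A B C : VF E M) : c.nab A (c.tor B C)
      = c.nab A (c.nab B C) - c.nab A (c.nab C B) - c.nab A (lie B C) := by
    rw [tor, sub_right, sub_right]
  have hl (A B C : VF E M) : c.tor (lie A B) C
      = c.nab (lie A B) C - c.nab C (lie A B) - lie (lie A B) C := rfl
  -- Once the torsions are expanded, the two sides differ only by this cyclic sum of iterated
  -- brackets.
  have hj : lie (lie X Y) Z + lie (lie Y Z) X + lie (lie Z X) Y = 0 := by
    have := lie_jacobi X Y Z
    rw [lie_swap X (lie Y Z), this, lie_swap Y (lie Z X), lie_swap X Z]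
    have h2 : lie Y (-lie X Z) = -lie Y (lie X Z) := by
      have h3 := lie_add_right Y (lie X Z) (-lie X Z)
      have h0 := lie_add_right Y (0 : VF E M) 0
      simp only [add_zero, left_eq_add] at h0
      rw [add_neg_cancel, h0] at h3
      exact (neg_eq_of_add_eq_zero_right h3.symm).symm
    rw [h2]
    abel
  simp only [curv, nabTor, hT, hs, hn, hl]
  rw [← sub_eq_zero, ← neg_eq_zero, ← hj]
  abel

/-- The connection is compatible with the metric. -/
def IsMetric (g : Metric E M) : Prop :=
  ∀ X Y Z, dir X (g.ip Y Z) = g.ip (c.nab X Y) Z + g.ip Y (c.nab X Z)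

theorem curv_swap (X Y Z : VF E M) : c.curv Y X Z = -c.curv X Y Z := by
  rw [curv, curv, lie_swap X Y, neg_left]
  abel

theorem curv_add_left (X X' Y Z : VF E M) : c.curv (X + X') Y Z = c.curv X Y Z + c.curv X' Y Z := by
  simp only [curv, lie_add_left, add_left, add_right]
  abel

theorem curv_add_mid (X Y Y' Z : VF E M) : c.curv X (Y + Y') Z = c.curv X Y Z + c.curv X Y' Z := by
  simp only [curv, lie_add_right, add_left, add_right]
  abel

theorem curv_add_right (X Y Z Z' : VF E M) :
    c.curv X Y (Z + Z') = c.curv X Y Z + c.curv X Y Z' := by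
  simp only [curv, add_right]
  abel

theorem curv_fmul_left (f : SmoothFn E M) (X Y Z : VF E M) :
    c.curv (fmul f X) Y Z = fmul f (c.curv X Y Z) := by
  simp only [curv, fmul_left, lie_fmul_left, sub_left, leibniz, fmul_sub]
  abel

theorem curv_fmul_mid (f : SmoothFn E M) (X Y Z : VF E M) :
    c.curv X (fmul f Y) Z = fmul f (c.curv X Y Z) := by
  rw [curv_swap, curv_fmul_left, c.curv_swap X Y]
  ext x
  simp

section

variable [T2Space M]

/-- Second derivatives of `f` enter as `XYf - YXf`, which `dir_lie` cancels against `[X, Y]f`. -/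
theorem curv_fmul_right (f : SmoothFn E M) (X Y Z : VF E M) :
    c.curv X Y (fmul f Z) = fmul f (c.curv X Y Z) := by
  have h := dir_lie X Y f
  simp only [curv, leibniz, add_right, fmul_sub, h]
  ext x
  simp
  module

/-- One slot is changed at a time, each by function-linearity. This frees `Rm` from the chosen
extensions. -/
theorem curv_congr {X X' Y Y' Z Z' : VF E M} {x : M} (hX : X x = X' x) (hY : Y x = Y' x)
    (hZ : Z x = Z' x) : c.curv X Y Z x = c.curv X' Y' Z' x := by
  have h1 := tensorial_congr (fun W ↦ c.curv W Y Z x)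
    (fun A B ↦ by rw [curv_add_left]; rfl) (fun f A ↦ by rw [curv_fmul_left]; rfl) hX
  have h2 := tensorial_congr (fun W ↦ c.curv X' W Z x)
    (fun A B ↦ by rw [curv_add_mid]; rfl) (fun f A ↦ by rw [curv_fmul_mid]; rfl) hY
  have h3 := tensorial_congr (fun W ↦ c.curv X' Y' W x)
    (fun A B ↦ by rw [curv_add_right]; rfl) (fun f A ↦ by rw [curv_fmul_right]; rfl) hZ
  exact h1.trans (h2.trans h3)

/-- The curvature tensor of a connection at a point. -/
def Rm (x : M) : TangentSpace 𝓘(ℝ, E) x →ₗ[ℝ] TangentSpace 𝓘(ℝ, E) x →ₗ[ℝ]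
    TangentSpace 𝓘(ℝ, E) x →ₗ[ℝ] TangentSpace 𝓘(ℝ, E) x :=
  LinearMap.mk₂ ℝ (fun u v ↦
    { toFun := fun w ↦ c.curv (linExt x u) (linExt x v) (linExt x w) x
      map_add' := fun w w' ↦ by rw [map_add, curv_add_right]; rfl
      map_smul' := fun r w ↦ by
        rw [map_smul, smul_eq_fmul, curv_fmul_right]; rfl })
    (fun u u' v ↦ by
      ext w
      change c.curv _ _ _ x = c.curv _ _ _ x + c.curv _ _ _ x
      rw [map_add, curv_add_left]; rfl)
    (fun r u v ↦ by
      ext w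
      change c.curv _ _ _ x = r • c.curv _ _ _ x
      rw [map_smul, smul_eq_fmul, curv_fmul_left]; rfl)
    (fun u v v' ↦ by
      ext w
      change c.curv _ _ _ x = c.curv _ _ _ x + c.curv _ _ _ x
      rw [map_add, curv_add_mid]; rfl)
    (fun r u v ↦ by
      ext w
      change c.curv _ _ _ x = r • c.curv _ _ _ x
      rw [map_smul, smul_eq_fmul, curv_fmul_mid]; rfl)

theorem Rm_apply (X Y Z : VF E M) (x : M) : c.Rm x (X x) (Y x) (Z x) = c.curv X Y Z x :=
  c.curv_congr (linExt_self _ _) (linExt_self _ _) (linExt_self _ _)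

theorem Rm_swap (x : M) (u v w : TangentSpace 𝓘(ℝ, E) x) : c.Rm x v u w = -c.Rm x u v w := by
  change c.curv _ _ _ x = -c.curv _ _ _ x
  rw [curv_swap]
  rfl

variable {c}

/-- Apply `[X, Y] = XY - YX` to the function `g(Z, W)` and expand by metric compatibility: the mixed
first-order terms cancel. -/
theorem IsMetric.ip_curv {g : Metric E M} (hc : c.IsMetric g) (X Y Z W : VF E M) :
    g.ip (c.curv X Y Z) W + g.ip Z (c.curv X Y W) = 0 := by
  have h1 := congrArg (dir X) (hc Y Z W)
  have h2 := congrArg (dir Y) (hc X Z W)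
  have h3 := hc (lie X Y) Z W
  have hc' : ∀ X Y Z, dir X (g.ip Y Z) = g.ip (c.nab X Y) Z + g.ip Y (c.nab X Z) := hc
  rw [dir_lie, h1, h2] at h3
  simp only [dir_add, hc'] at h3
  ext x
  have h4 := congrArg (fun f : SmoothFn E M ↦ f x) h3
  simp only [ContMDiffMap.coe_add, Pi.add_apply, ContMDiffMap.coe_sub, Pi.sub_apply,
    Metric.ip_apply, curv, ContMDiffSection.coe_sub, map_sub, sub_apply] at h4 ⊢
  change _ = (0 : ℝ)
  linarith

theorem IsMetric.inner_Rm {g : Metric E M} (hc : c.IsMetric g) (x : M)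
    (u v w z : TangentSpace 𝓘(ℝ, E) x) :
    g.inner x (c.Rm x u v w) z = -g.inner x w (c.Rm x u v z) := by
  have h := congrArg (fun f : SmoothFn E M ↦ f x)
    (hc.ip_curv (linExt x u) (linExt x v) (linExt x w) (linExt x z))
  have h' : g.inner x (c.curv (linExt x u) (linExt x v) (linExt x w) x) (linExt x z x)
    + g.inner x (linExt x w x) (c.curv (linExt x u) (linExt x v) (linExt x z) x) = 0 := h
  rw [linExt_self, linExt_self] at h'
  exact eq_neg_of_add_eq_zero_left h'

end

end Conn

/-! ### The Levi-Civita connection on smooth vector fields -/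

section LeviCivita

variable [T2Space M]

theorem koszul_eq (g : Metric E M) (X Y Z : VF E M) (x : M) :
    koszul g (fun y ↦ X y) (fun y ↦ Y y) (fun y ↦ Z y) x
      = (dir X (g.ip Y Z) + dir Y (g.ip X Z) - dir Z (g.ip X Y) + g.ip (lie X Y) Z
        - g.ip (lie X Z) Y - g.ip (lie Y Z) X) x := rfl

/-- The Levi-Civita connection, acting on smooth vector fields. -/
def lc (g : Metric E M) : Conn E M where
  nab X Y := ⟨fun x ↦ leviCivita g (fun y ↦ Y y) x (X x), g.contMDiff_of_inner fun Z ↦ by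
    -- By the Koszul formula the inner product of `∇_X Y` with any smooth field is a smooth
    -- function.
    have h : (fun y ↦ g.inner y (leviCivita g (fun y ↦ Y y) y (X y)) (Z y))
        = fun y ↦ (1 / 2 : ℝ) * (dir X (g.ip Y Z) + dir Y (g.ip X Z) - dir Z (g.ip X Y)
          + g.ip (lie X Y) Z - g.ip (lie X Z) Y - g.ip (lie Y Z) X) y := by
      ext y
      rw [← koszul_eq]
      exact inner_leviCivitaFun g (X.mdiff y) (Y.mdiff y) (Z.mdiff y)
    rw [h]
    exact contMDiff_const.mul (ContMDiffMap.contMDiff _)⟩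
  add_left X X' Y := by
    ext x
    exact map_add (leviCivita g (fun y ↦ Y y) x) (X x) (X' x)
  fmul_left f X Y := by
    ext x
    exact map_smul (leviCivita g (fun y ↦ Y y) x) (f x) (X x)
  add_right X Y Y' := by
    ext x
    have h := (leviCivita g).isCovariantDerivativeOnUniv.add (x := x) (Y.mdiff x) (Y'.mdiff x)
    exact congrArg (fun A ↦ A (X x)) h
  leibniz f X Y := by
    ext x
    have h := (leviCivita g).isCovariantDerivativeOnUniv.leibniz (x := x) (Y.mdiff x) (f.mdiff x)
    have h' := congrArg (fun A ↦ A (X x)) h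
    exact h'.trans (add_comm _ _)

theorem lc_apply (g : Metric E M) (X Y : VF E M) (x : M) :
    (lc g).nab X Y x = leviCivita g (fun y ↦ Y y) x (X x) := rfl

theorem lc_isMetric (g : Metric E M) : (lc g).IsMetric g := by
  intro X Y Z
  ext x
  exact leviCivita_metric g (X.mdiff x) (Y.mdiff x) (Z.mdiff x)

theorem lc_tor (g : Metric E M) (X Y : VF E M) : (lc g).tor X Y = 0 := by
  rw [Conn.tor, sub_eq_zero]
  ext x
  exact leviCivita_torsion_free g (X.mdiff x) (Y.mdiff x)

theorem VF.ext_inner (g : Metric E M) {X Y : VF E M} (h : ∀ Z, g.ip X Z = g.ip Y Z) : X = Y := by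
  ext x
  refine g.ext_inner fun u ↦ ?_
  have := congrArg (fun f : SmoothFn E M ↦ f x) (h (extVF u))
  simpa using this

theorem Metric.ip_comm (g : Metric E M) (X Y : VF E M) : g.ip X Y = g.ip Y X := by
  ext x
  exact g.symm _ _ _

theorem Metric.ip_sub_left (g : Metric E M) (X X' Y : VF E M) :
    g.ip (X - X') Y = g.ip X Y - g.ip X' Y := by
  ext x
  simp

/-- A metric torsion-free connection is the Levi-Civita connection. -/
theorem Conn.eq_lc {c : Conn E M} {g : Metric E M} (hm : c.IsMetric g) (ht : ∀ X Y, c.tor X Y = 0)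
    (X Y : VF E M) : c.nab X Y = (lc g).nab X Y := by
  -- The Koszul formula, using only metric compatibility and vanishing torsion; it determines the
  -- connection.
  have key : ∀ c : Conn E M, c.IsMetric g → (∀ X Y, c.tor X Y = 0) → ∀ X Y Z,
      g.ip (c.nab X Y) Z + g.ip (c.nab X Y) Z
        = dir X (g.ip Y Z) + dir Y (g.ip X Z) - dir Z (g.ip X Y) + g.ip (lie X Y) Z - g.ip (lie X Z) Y - g.ip (lie Y Z) X := by
    intro c hm ht X Y Z
    have hl (X Y : VF E M) : lie X Y = c.nab X Y - c.nab Y X := (sub_eq_zero.1 (ht X Y)).symm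
    rw [hm, hm, hm, hl, hl, hl, g.ip_sub_left, g.ip_sub_left, g.ip_sub_left,
      g.ip_comm Y (c.nab X Z), g.ip_comm X (c.nab Y Z), g.ip_comm X (c.nab Z Y)]
    ring
  refine VF.ext_inner g fun Z ↦ ?_
  have h := (key c hm ht X Y Z).trans (key (lc g) (lc_isMetric g) (lc_tor g) X Y Z).symm
  ext x
  have h' := congrArg (fun f : SmoothFn E M ↦ f x) h
  have h2 : g.ip (c.nab X Y) Z x + g.ip (c.nab X Y) Z x
      = g.ip ((lc g).nab X Y) Z x + g.ip ((lc g).nab X Y) Z x := h'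
  linarith

theorem leviCivita_congr (g : Metric E M) {Y Y' : Π x : M, TangentSpace 𝓘(ℝ, E) x} {x : M}
    (hY : MDiffAt (T% Y) x) (h : ∀ᶠ y in nhds x, Y y = Y' y) :
    leviCivita g Y x = leviCivita g Y' x := by
  have hT : (T% Y) =ᶠ[nhds x] (T% Y') := by
    filter_upwards [h] with y hy
    simp only [hy]
  exact (leviCivita g).isCovariantDerivativeOnUniv.congr_of_eventuallyEq hY
    (hY.congr_of_eventuallyEq hT.symm) Filter.univ_mem h

/-- The fields `extend` are only known to be smooth near `x`. The cut-off fields `extVF` have the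
same germs at `x`, and every term of the curvature depends on germs alone. -/
theorem curvature_extend (g : Metric E M) (x : M) (u v w : TangentSpace 𝓘(ℝ, E) x) :
    curvature g (extend E u) (extend E v) (extend E w) x = (lc g).Rm x u v w := by
  have h0 := (lc g).Rm_apply (extVF u) (extVF v) (extVF w) x
  rw [extVF_self, extVF_self, extVF_self] at h0
  rw [h0]
  have h1 (u v w : TangentSpace 𝓘(ℝ, E) x) : ∀ᶠ y in nhds x,
      (lc g).nab (extVF v) (extVF w) y = leviCivita g (extend E w) y (extend E v y) := by
    filter_upwards [extVF_eventuallyEq v, eventually_eventually_nhds.2 (extVF_eventuallyEq w)]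
      with y hv hw
    rw [lc_apply, leviCivita_congr g ((extVF w).mdiff y) hw, hv]
  have h2 (u v w : TangentSpace 𝓘(ℝ, E) x) :
      leviCivita g (fun y ↦ leviCivita g (extend E w) y (extend E v y)) x u
        = (lc g).nab (extVF u) ((lc g).nab (extVF v) (extVF w)) x := by
    rw [lc_apply, extVF_self,
      leviCivita_congr g (((lc g).nab (extVF v) (extVF w)).mdiff x) (h1 u v w)]
  have h3 : leviCivita g (extend E w) x (mlieBracket 𝓘(ℝ, E) (extend E u) (extend E v) x)
      = (lc g).nab (lie (extVF u) (extVF v)) (extVF w) x := by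
    rw [lc_apply, leviCivita_congr g ((extVF w).mdiff x) (extVF_eventuallyEq w), lie_apply]
    have e : ∀ {Y Y' : Π x : M, TangentSpace 𝓘(ℝ, E) x}, (∀ᶠ y in nhds x, Y y = Y' y) →
      Y =ᶠ[nhds x] Y' := fun h ↦ h
    rw [Filter.EventuallyEq.mlieBracket_vectorField_eq (I := 𝓘(ℝ, E))
      (e (extVF_eventuallyEq u)) (e (extVF_eventuallyEq v))]
  simp only [curvature, extend_apply_self]
  rw [h2, h2, h3]
  rfl

/-- The basis-free form of the Ricci tensor, to which the trace identities apply. -/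
theorem ricci_eq_trace (g : Metric E M) (x : M) (u v : TangentSpace 𝓘(ℝ, E) x) :
    ricci g x u v = LinearMap.trace ℝ (TangentSpace 𝓘(ℝ, E) x)
      (((lc g).Rm x).flip u |>.flip v) := by
  rw [LinearMap.trace_eq_matrix_trace ℝ (Module.finBasis ℝ (TangentSpace 𝓘(ℝ, E) x))]
  simp only [ricci, curvature_extend, Matrix.trace, Matrix.diag, LinearMap.toMatrix_apply,
    LinearMap.flip_apply]

end LeviCivita

end Manifold

section LinearAlgebra

variable {V : Type*} [AddCommGroup V] [Module ℝ V]

/-! ### Linear algebra of curvature tensors -/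

/-- If the cyclic sum of a tensor `R` which is skew and `J`-invariant in its last two arguments
is the cyclic sum of `b + q`, where `b x` is a 3-form of type `(3, 0) + (0, 3)` for each `x` and `q`
has the symmetries of `⟨T x y, T z w⟩` for an antilinear `T`, then `b = 0`. -/
theorem eq_zero_of_bianchi (J : V → V) {R b q : V → V → V → V → ℝ}
    (hR : ∀ x y z w, R x y w z = -R x y z w)
    (hRJ : ∀ x y z w, R x y (J z) (J w) = R x y z w)
    (hRJ' : ∀ x y z w, R x y (J z) w = -R x y z (J w))
    (hb₁ : ∀ x y z w, b x z y w = -b x y z w)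
    (hb₂ : ∀ x y z w, b x y w z = -b x y z w)
    (hbJ : ∀ x y z w, b x (J y) (J z) w = -b x y z w)
    (hbJ' : ∀ x y z w, b x (J y) z w = b x y (J z) w)
    (hbn : ∀ x y z w, b (J (J x)) y z w = -b x y z w)
    (hq₁ : ∀ x y z w, q (J x) (J y) z w = -q x y z w)
    (hq₂ : ∀ x y z w, q x y (J z) (J w) = -q x y z w)
    (hq₃ : ∀ x y z w, q (J x) y (J z) w = q x y z w)
    (hq₄ : ∀ x y z w, q (J x) y z (J w) = q x y z w)
    (hq₅ : ∀ x y z w, q x (J y) (J z) w = q x y z w)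
    (hq₆ : ∀ x y z w, q x (J y) z (J w) = q x y z w)
    (H : ∀ x y z w, R x y z w + R y z x w + R z x y w
      = b x y z w + b y z x w + b z x y w + (q x y z w + q y z x w + q z x y w))
    (x y z w : V) : b x y z w = 0 := by
  have hbJ₃ (x y z w) : b x y z (J w) = b x y (J z) w := by
    rw [hb₂, hb₁, hbJ', hb₁ x (J y), hb₂ x (J y), hbJ']; ring
  have hbJJ₂ (x y z w) : b x y (J z) (J w) = -b x y z w := by
    rw [← hbJ', hbJ₃, hbJ]
  have hbJJ₃ (x y z w) : b x (J y) z (J w) = -b x y z w := by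
    rw [hbJ₃, hbJ]
  -- Twice the component of `b` that is anti-invariant under `J` inserted in the first two slots
  -- together. Like `b`, it is skew in its last three arguments.
  let B (x y z w : V) : ℝ := b x y z w - b (J x) (J y) z w
  have hB₁ (x y z w) : B x z y w = -B x y z w := by
    simp only [B]
    rw [hb₁, hb₁ (J x), ← hbJ']; ring
  have hB₂ (x y z w) : B x y w z = -B x y z w := by
    simp only [B]
    rw [hb₂, hb₂ (J x)]; ring
  have hB₁₃ (x y z w) : B x w z y = -B x y z w := by
    rw [hB₁, hB₂, hB₁]; ring
  -- In `H(x,y,z,w) - H(x,y,Jz,Jw) - H(x,Jy,z,Jw) - H(x,Jy,Jz,w)` all terms in `q` cancel, as do two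
  -- of the three curvature terms; `S` is what survives of the curvature.
  let S (x y z w : V) : ℝ := R y z x w - R y (J z) x (J w) - R (J y) z x (J w) - R (J y) (J z) x w
  have hA (x y z w : V) : S x y z w = 4 * b x y z w + 2 * B y z x w + 2 * B z x y w := by
    have h1 := H x y z w
    have h2 := H x y (J z) (J w)
    have h3 := H x (J y) z (J w)
    have h4 := H x (J y) (J z) w
    simp only [S, B]
    simp only [hRJ, hRJ', hbJJ₂, hbJ, hbJJ₃, hq₁, hq₂, hq₃, hq₄, hq₅, hq₆] at h1 h2 h3 h4
    have e1 := hbJ₃ (J y) z x w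
    have e2 := hbJ₃ (J z) x y w
    have e3 := hbJ' (J y) z x w
    have e4 := hbJ' (J z) x y w
    linarith
  -- A second evaluation, from the Bianchi identities with `x` as the last argument; comparison with
  -- `hA` eliminates `R`.
  have hS (x y z w : V) : S x y z w + S x z w y + S x w y z
      = -(2 * B y z w x + 2 * B z w y x + 2 * B w y z x) := by
    have h1 := H y z w x
    have h2 := H y (J z) (J w) x
    have h3 := H (J y) z (J w) x
    have h4 := H (J y) (J z) w x
    simp only [S, B]
    simp only [hbJ, hq₁, hq₃, hq₅, hR _ _ x] at h1 h2 h3 h4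
    have e1 := hbJ' (J y) z w x
    have e2 := hbJ' (J z) w y x
    have e3 := hbJ' (J w) y z x
    linarith
  have hb6 (x y z w : V) : 6 * b x y z w = B y z w x + B z w y x + B w y z x := by
    have h := hS x y z w
    rw [hA, hA, hA] at h
    have e1 : b x z w y = b x y z w := by rw [hb₂, hb₁]; ring
    have e2 : b x w y z = b x y z w := by rw [hb₁, hb₂]; ring
    have e3 := hB₂ y z w x
    have e4 := hB₁₃ z w y x
    have e5 := hB₂ z w y x
    have e6 := hB₁₃ w y z x
    have e7 := hB₂ w y z x
    have e8 := hB₁₃ y z w x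
    linarith
  have hBJ (x y z w) : B x (J y) (J z) w = -B x y z w := by
    simp only [B]
    rw [hbJ, hbJ]; ring
  have hBJ₂ (x y z w) : B x y (J z) (J w) = -B x y z w := by
    simp only [B, hbJJ₂]; ring
  have hBm₃ (x y z w) : B x y z (J w) = B x y (J z) w := by
    simp only [B, hbJ₃]
  have hBJ₁ (x y z w) : B (J x) y z (J w) = -B x y z w := by
    simp only [B]
    rw [hbn, hbJ₃, ← hbJ' (J x), hbJ₃ x, hbJ]; ring
  -- Subtracting the instance of `hb6` at `(Jx, Jy, z, w)` leaves a relation in `B` alone.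
  have hB3 (x y z w : V) : 3 * B x y z w = B y z w x + B z w y x + B w y z x := by
    have h1 := hb6 x y z w
    have h2 := hb6 (J x) (J y) z w
    rw [hBJ₁, hBJ₂, hBm₃, hBJ] at h2
    simp only [B] at h1 h2 ⊢
    linarith
  -- With each of the four arguments in turn in the first slot, `hB3` becomes a nonsingular linear
  -- system for four values of `B`.
  have hB0 (x y z w : V) : B x y z w = 0 := by
    have h1 := hB3 x y z w
    have h2 := hB3 y z w x
    have h3 := hB3 z w y x
    have h4 := hB3 w y z x
    have e1 := hB₂ z w y x
    have e2 := hB₁₃ w y z x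
    have e3 : B x z w y = B x y z w := by rw [hB₂, hB₁]; ring
    have e4 := hB₂ w y z x
    have e5 := hB₁₃ y z w x
    have e6 : B x w y z = B x y z w := by rw [hB₁, hB₂]; ring
    have e7 := hB₂ y z w x
    have e8 := hB₁₃ z w y x
    linarith
  have h := hb6 x y z w
  simp only [hB0] at h
  linarith

/-- Any two vectors of a complex line are related by a complex number. -/
theorem exists_smul_add_of_finrank_two {g : LinearMap.BilinForm ℝ V} (symm : ∀ u v, g u v = g v u)
    (pos : ∀ v, v ≠ 0 → 0 < g v v) {J : V →ₗ[ℝ] V} (hJ : ∀ u v, g (J u) v = -g u (J v))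
    (hJg : ∀ u v, g (J u) (J v) = g u v) {L : Submodule ℝ V} (hL : Module.finrank ℝ L = 2)
    (hJL : ∀ v ∈ L, J v ∈ L) {v w : V} (hv : v ∈ L) (h0 : v ≠ 0) (hw : w ∈ L) :
    ∃ a b : ℝ, w = a • v + b • J v := by
  have hJv : g v (J v) = 0 := by
    have h := hJ v v
    rw [symm] at h
    linarith
  have hpos := pos v h0
  have hli : LinearIndependent ℝ ![(⟨v, hv⟩ : L), ⟨J v, hJL v hv⟩] := by
    rw [LinearIndependent.pair_iff]
    intro s t hst
    have h1 : s • v + t • J v = 0 := congrArg Subtype.val hst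
    have h2 := congrArg (g v) h1
    have h3 := congrArg (g (J v)) h1
    simp only [map_add, map_smul, hJv, hJg, symm (J v) v, map_zero, smul_eq_mul, mul_zero,
      add_zero, zero_add, mul_eq_zero, hpos.ne', or_false] at h2 h3
    exact ⟨h2, h3⟩
  have hspan := hli.span_eq_top_of_card_eq_finrank (by simp [hL])
  have hmem : (⟨w, hw⟩ : L) ∈ Submodule.span ℝ
      (Set.range ![(⟨v, hv⟩ : L), ⟨J v, hJL v hv⟩]) := by
    rw [hspan]; trivial
  rw [Matrix.range_cons, Matrix.range_cons, Matrix.range_empty, Set.union_empty,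
    Set.singleton_union, Submodule.mem_span_pair] at hmem
  obtain ⟨a, b, hab⟩ := hmem
  exact ⟨a, b, (congrArg Subtype.val hab).symm⟩

variable (V) in
/-- The data induced on a tangent space by a metric connection `∇̄` with parallel skew-symmetric
torsion `T`, preserving an almost complex structure `J` anticommuting with `T`, and a plane `L`:
`R` is the curvature tensor of the connection and `P` is the orthogonal projection onto `L`. -/
structure HolonomyModel where
  g : LinearMap.BilinForm ℝ V
  symm (u v) : g u v = g v u
  pos (v) : v ≠ 0 → 0 < g v v
  J : V →ₗ[ℝ] V
  J_sq (v) : J (J v) = -v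
  J_orth (u v) : g (J u) (J v) = g u v
  T : V →ₗ[ℝ] V →ₗ[ℝ] V
  T_swap (u v) : T v u = -T u v
  T_skew (u v w) : g (T u v) w = -g v (T u w)
  T_J (u v) : T u (J v) = -J (T u v)
  R : V →ₗ[ℝ] V →ₗ[ℝ] V →ₗ[ℝ] V
  R_swap (u v w) : R v u w = -R u v w
  R_skew (u v w z) : g (R u v w) z = -g w (R u v z)
  R_J (u v w) : R u v (J w) = J (R u v w)
  R_T (u v w z) : R u v (T w z) = T (R u v w) z + T w (R u v z)
  bianchi (u v w) : R u v w + R v w u + R w u v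
    = T (T u v) w + T (T v w) u + T (T w u) v
  L : Submodule ℝ V
  finrank_L : Module.finrank ℝ L = 2
  J_L (v) : v ∈ L → J v ∈ L
  R_L (u v w) : w ∈ L → R u v w ∈ L
  P : V →ₗ[ℝ] V
  P_mem (v) : P v ∈ L
  P_of_mem (v) : v ∈ L → P v = v
  P_symm (u v) : g (P u) v = g u (P v)
  inj (v u) : v ∈ L → v ≠ 0 → P u = 0 → T v u = 0 → u = 0

/-! ### Algebra of torsion and curvature on one tangent space -/

namespace HolonomyModel

variable (m : HolonomyModel V)

theorem eq_of_forall {u v : V} (h : ∀ w, m.g u w = m.g v w) : u = v := by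
  by_contra hne
  have h1 := m.pos (u - v) (sub_ne_zero.2 hne)
  rw [LinearMap.map_sub₂, h, sub_self] at h1
  exact lt_irrefl _ h1

theorem J_skew (u v : V) : m.g (m.J u) v = -m.g u (m.J v) := by
  rw [← m.J_orth u (m.J v), m.J_sq, map_neg, neg_neg]

theorem T_J_left (u v : V) : m.T (m.J u) v = -m.J (m.T u v) := by
  rw [m.T_swap, m.T_J, m.T_swap u v, map_neg, neg_neg]

theorem T_self (u : V) : m.T u u = 0 := by
  have h := m.T_swap u u
  have h2 : (2 : ℝ) • m.T u u = 0 := by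
    rw [two_smul]
    exact add_eq_zero_iff_eq_neg.2 h
  exact (smul_eq_zero.1 h2).resolve_left two_ne_zero

/-- The torsion is totally skew-symmetric. -/
theorem T_cyc (u v w : V) : m.g (m.T u v) w = m.g (m.T v w) u := by
  have h (u v w : V) : m.g (m.T u v) w = m.g (m.T w u) v := by
    rw [m.T_skew, m.T_swap w u, map_neg, neg_neg, m.symm]
  rw [h, h]

/-- Pair symmetry of the curvature. -/
theorem R_pair (x y z w : V) : m.g (m.R x y z) w = m.g (m.R z w x) y := by
  have hs (x y z w : V) : m.g (m.R y x z) w = -m.g (m.R x y z) w := by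
    rw [m.R_swap, map_neg, LinearMap.neg_apply]
  have hk (x y z w : V) : m.g (m.R x y w) z = -m.g (m.R x y z) w := by
    rw [m.R_skew, m.symm]
  have hq (x y z w : V) : m.g (m.T (m.T x y) z) w = m.g (m.T x y) (m.T z w) := by
    rw [m.T_cyc, m.symm]
  -- The right-hand side is alternating in all four arguments, so the usual derivation of pair
  -- symmetry from four Bianchi identities survives the torsion.
  have hb (x y z w : V) : m.g (m.R x y z) w + m.g (m.R y z x) w + m.g (m.R z x y) w
      = m.g (m.T x y) (m.T z w) + m.g (m.T y z) (m.T x w) + m.g (m.T z x) (m.T y w) := by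
    rw [← hq, ← hq, ← hq, ← LinearMap.add_apply, ← map_add, ← LinearMap.add_apply, ← map_add,
      m.bianchi]
    simp only [map_add, LinearMap.add_apply]
  have hT (x y z w : V) : m.g (m.T y x) (m.T z w) = -m.g (m.T x y) (m.T z w) := by
    rw [m.T_swap, map_neg, LinearMap.neg_apply]
  have hT' (x y z w : V) : m.g (m.T x y) (m.T w z) = -m.g (m.T x y) (m.T z w) := by
    rw [m.T_swap z w, map_neg]
  have h1 := hb x y z w
  have h2 := hb y z w x
  have h3 := hb z w x y
  have h4 := hb w x y z
  have r1 := hk y z x w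
  have r2 := hk z w x y
  have r3 := hk x y z w
  have r4 : m.g (m.R w y z) x = m.g (m.R y w x) z := by rw [hs, hk]; ring
  have r5 : m.g (m.R x z w) y = m.g (m.R z x y) w := by rw [hs, hk]; ring
  have r6 := hk w x y z
  have t1 := hT' y z x w
  have t2 : m.g (m.T z w) (m.T y x) = -m.g (m.T x y) (m.T z w) := by rw [hT', m.symm]
  have t3 : m.g (m.T w y) (m.T z x) = -m.g (m.T z x) (m.T y w) := by rw [hT, m.symm]
  have t4 := m.symm (m.T z w) (m.T x y)
  have t5 : m.g (m.T w x) (m.T z y) = m.g (m.T y z) (m.T x w) := by rw [hT, hT', m.symm]; ring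
  have t6 : m.g (m.T x z) (m.T w y) = m.g (m.T z x) (m.T y w) := by rw [hT, hT']; ring
  have t7 : m.g (m.T w x) (m.T y z) = -m.g (m.T y z) (m.T x w) := by rw [hT, m.symm]
  have t8 := hT' x y z w
  have t9 : m.g (m.T y w) (m.T x z) = -m.g (m.T z x) (m.T y w) := by rw [hT', m.symm]
  linarith

theorem P_idem (u : V) : m.P (m.P u) = m.P u := m.P_of_mem _ (m.P_mem u)

theorem mem_L_iff (u : V) : u ∈ m.L ↔ m.P u = u :=
  ⟨m.P_of_mem u, fun h ↦ h ▸ m.P_mem u⟩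

theorem inner_eq_zero {u v : V} (hu : m.P u = 0) (hv : v ∈ m.L) : m.g u v = 0 := by
  rw [← m.P_of_mem v hv, ← m.P_symm, hu, map_zero, LinearMap.zero_apply]

theorem P_J (u : V) : m.P (m.J u) = m.J (m.P u) := by
  refine m.eq_of_forall fun w ↦ ?_
  have h : m.g u (m.J (m.P w)) = -m.g (m.J (m.P u)) w := by
    rw [← m.P_of_mem _ (m.J_L _ (m.P_mem w)), ← m.P_symm, ← neg_eq_iff_eq_neg, ← m.J_skew,
      ← m.P_symm, m.P_of_mem _ (m.J_L _ (m.P_mem u))]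
  rw [m.P_symm, m.J_skew, h, neg_neg]

theorem exists_of_mem {v w : V} (hv : v ∈ m.L) (h0 : v ≠ 0) (hw : w ∈ m.L) :
    ∃ a b : ℝ, w = a • v + b • m.J v :=
  exists_smul_add_of_finrank_two m.symm m.pos m.J_skew m.J_orth m.finrank_L m.J_L hv h0 hw

theorem exists_ne_zero : ∃ v ∈ m.L, v ≠ 0 := by
  have h : m.L ≠ ⊥ := by
    intro h
    have := m.finrank_L
    rw [h, finrank_bot] at this
    omega
  exact m.L.exists_mem_ne_zero_of_ne_bot h

/-- `L` is the complex line spanned by `v`; `T_v` kills `v` and, being antilinear, also `Jv`. -/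
theorem T_mem_mem {v w : V} (hv : v ∈ m.L) (hw : w ∈ m.L) : m.T v w = 0 := by
  by_cases h0 : v = 0
  · rw [h0, map_zero, LinearMap.zero_apply]
  · obtain ⟨a, b, rfl⟩ := m.exists_of_mem hv h0 hw
    simp only [map_add, map_smul, m.T_J, m.T_self, map_zero, neg_zero, smul_zero, add_zero]

/-- By skewness the component along `w ∈ L` is `-g(u, T_v w)`, which is zero. -/
theorem P_T_left {v : V} (hv : v ∈ m.L) (u : V) : m.P (m.T v u) = 0 := by
  refine m.eq_of_forall fun w ↦ ?_
  rw [m.P_symm, m.T_skew, m.T_mem_mem hv (m.P_mem w)]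
  simp

theorem P_T_right {v : V} (hv : v ∈ m.L) (u : V) : m.P (m.T u v) = 0 := by
  rw [m.T_swap, map_neg, m.P_T_left hv, neg_zero]

theorem P_R {z : V} (hz : m.P z = 0) (x y : V) : m.P (m.R x y z) = 0 := by
  refine m.eq_of_forall fun w ↦ ?_
  rw [m.P_symm, m.R_skew, m.inner_eq_zero hz (m.R_L x y _ (m.P_mem w))]
  simp

theorem R_P (x y z : V) : m.P (m.R x y z) = m.R x y (m.P z) := by
  have h : m.P (z - m.P z) = 0 := by rw [map_sub, m.P_idem, sub_self]
  have h1 := m.P_R h x y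
  rw [map_sub, map_sub, m.P_of_mem _ (m.R_L x y _ (m.P_mem z))] at h1
  exact sub_eq_zero.1 h1

/-- Pair symmetry turns the inner product with `w` into `g(R(y, w)v, x)`, and `R(y, w)` preserves
`L`. This vanishing is what isolates single curvature terms in the Bianchi identity. -/
theorem R_mem_left {v x : V} (hv : v ∈ m.L) (hx : m.P x = 0) (y : V) : m.R v x y = 0 := by
  refine m.eq_of_forall fun w ↦ ?_
  rw [m.R_pair, m.symm, m.inner_eq_zero hx (m.R_L _ _ _ hv), map_zero, LinearMap.zero_apply]

/-- The torsion of two vectors orthogonal to `L` is in `L`. -/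
theorem P_T {x y : V} (hx : m.P x = 0) (hy : m.P y = 0) : m.P (m.T x y) = m.T x y := by
  obtain ⟨v, hv, h0⟩ := m.exists_ne_zero
  -- The component of the torsion orthogonal to `L`, to be shown zero.
  let q (x y : V) : V := m.T x y - m.P (m.T x y)
  have hq (x y : V) : m.P (q x y) = 0 := by simp only [q, map_sub, m.P_idem, sub_self]
  have hqs (x y : V) : q y x = -q x y := by
    simp only [q]
    rw [m.T_swap, map_neg]
    abel
  have hqJ (x y : V) : q (m.J x) y = -m.J (q x y) := by
    simp only [q]
    rw [m.T_J_left, map_neg, m.P_J, map_sub]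
    abel
  have hTq (x y : V) : m.T v (q x y) = m.T v (m.T x y) := by
    simp only [q, map_sub, m.T_mem_mem hv (m.P_mem _), sub_zero]
  have hPJ {x : V} (hx : m.P x = 0) : m.P (m.J x) = 0 := by rw [m.P_J, hx, map_zero]
  -- The component orthogonal to `L` of the Bianchi identity for `x`, `y`, `v`: the mixed curvatures
  -- vanish and `R(x, y)v` lies in `L`.
  have key {x y : V} (hx : m.P x = 0) (hy : m.P y = 0) :
      m.T v (q x y) = q (m.T v x) y + q x (m.T v y) := by
    have h := m.bianchi x y v
    have h1 : m.R y v x = 0 := by rw [m.R_swap, m.R_mem_left hv hy, neg_zero]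
    rw [h1, m.R_mem_left hv hx, add_zero, add_zero] at h
    have h2 : m.R x y v - m.P (m.R x y v) = 0 := by
      rw [m.P_of_mem _ (m.R_L _ _ _ hv), sub_self]
    rw [h, m.T_swap v (m.T x y), m.T_swap v y, map_neg, LinearMap.neg_apply, m.T_swap x (m.T v y),
      neg_neg, map_add, map_add, map_neg, m.P_T_left hv] at h2
    rw [hTq, ← sub_eq_zero, ← neg_eq_zero, ← h2]
    simp only [q]
    abel
  -- Replacing `x` by `Jx` in `key` changes the sign of this term relative to the other two, because
  -- `q` and `T_v` are antilinear.
  have hzero {x y : V} (hx : m.P x = 0) (hy : m.P y = 0) : q x (m.T v y) = 0 := by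
    have h1 := key hx hy
    have h2 := key (hPJ hx) hy
    have hqn (x y : V) : q (-x) y = -q x y := by
      simp only [q, map_neg, LinearMap.neg_apply]
      abel
    rw [hqJ, hqJ, map_neg, m.T_J, neg_neg, m.T_J, hqn, hqJ, neg_neg, h1, map_add] at h2
    have h3 : (2 : ℝ) • m.J (q x (m.T v y)) = 0 := by
      rw [two_smul]
      have := add_left_cancel h2
      nth_rewrite 1 [this]
      exact neg_add_cancel _
    have h4 := congrArg m.J ((smul_eq_zero.1 h3).resolve_left two_ne_zero)
    rwa [m.J_sq, map_zero, neg_eq_zero] at h4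
  have h1 := key hx hy
  rw [hzero hx hy, hqs y (m.T v x), hzero hy hx, neg_zero, add_zero] at h1
  exact (sub_eq_zero.1 (m.inj v _ hv h0 (hq x y) h1)).symm

/-- In the Bianchi identity two curvature terms vanish by `R_mem_left`, and `T(T(x, y), v) = 0`
since `T(x, y) ∈ L`. The two remaining torsion terms contribute equally. -/
theorem inner_R_J {v x y : V} (hv : v ∈ m.L) (hx : m.P x = 0) (hy : m.P y = 0) :
    m.g (m.R x y v) (m.J v) = -2 * m.g (m.J (m.T v (m.T v x))) y := by
  have h := m.bianchi x y v
  have hTxy : m.T x y ∈ m.L := (m.mem_L_iff _).2 (m.P_T hx hy)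
  rw [m.R_swap v y x, m.R_mem_left hv hy, neg_zero, m.R_mem_left hv hx, add_zero, add_zero,
    m.T_mem_mem hTxy hv, zero_add] at h
  have e1 : m.g (m.T (m.T y v) x) (m.J v) = -m.g (m.J (m.T v x)) (m.T v y) := by
    rw [m.T_cyc, m.T_J, m.T_swap v x, m.T_swap v y]
    simp
  have e2 : m.g (m.T (m.T v x) y) (m.J v) = -m.g (m.J (m.T v x)) (m.T v y) := by
    rw [m.T_cyc, m.T_J, m.T_swap v y, map_neg m.J, neg_neg, m.J_skew, m.symm]
  have e3 : m.g (m.J (m.T v (m.T v x))) y = m.g (m.J (m.T v x)) (m.T v y) := by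
    rw [← neg_neg (m.J (m.T v (m.T v x))), ← m.T_J, map_neg, LinearMap.neg_apply, m.T_skew, neg_neg]
  rw [h, map_add, LinearMap.add_apply, e1, e2, e3]
  ring

/-- Pair symmetry applied to `inner_R_J`; both sides are orthogonal to `L`, so testing against the
complement suffices. -/
theorem R_J_self {v x : V} (hv : v ∈ m.L) (hx : m.P x = 0) :
    m.R v (m.J v) x = (-2 : ℝ) • m.J (m.T v (m.T v x)) := by
  refine m.eq_of_forall fun w ↦ ?_
  have h1 : m.P (m.R v (m.J v) x) = 0 := m.P_R hx _ _
  have h2 : m.P (m.J (m.T v (m.T v x))) = 0 := by rw [m.P_J, m.P_T_left hv, map_zero]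
  have h3 : m.P (w - m.P w) = 0 := by rw [map_sub, m.P_idem, sub_self]
  have h4 := m.inner_R_J hv hx h3
  rw [← sub_add_cancel w (m.P w), map_add, map_add, m.inner_eq_zero h1 (m.P_mem w), map_smul,
    LinearMap.smul_apply, LinearMap.smul_apply, m.inner_eq_zero h2 (m.P_mem w), m.R_pair, h4]
  simp

/-- On the orthogonal complement of `L`, `(T v)²` is a multiple of the identity. -/
theorem exists_T_T : ∃ l : ℝ, ∀ v ∈ m.L, ∀ x, m.P x = 0 →
    m.T v (m.T v x) = -(l * m.g v v) • x := by
  obtain ⟨v, hv, h0⟩ := m.exists_ne_zero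
  have hpos := m.pos v h0
  obtain ⟨a, κ, hκ⟩ := m.exists_of_mem hv h0 (m.R_L v (m.J v) v hv)
  have hJv : m.g (m.J v) v = 0 := by
    have h := m.J_skew v v
    rw [m.symm v] at h
    linarith
  -- The operator `R(v, Jv)` is skew, so its value at `v` has no `v`-component.
  have ha : a = 0 := by
    have h := m.R_skew v (m.J v) v v
    rw [hκ, m.symm v] at h
    simp only [map_add, map_smul, LinearMap.add_apply, LinearMap.smul_apply, hJv, smul_eq_mul,
      mul_zero, add_zero] at h
    have : a * m.g v v = 0 := by linarith
    exact (mul_eq_zero.1 this).resolve_right hpos.ne'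
  rw [ha, zero_smul, zero_add] at hκ
  -- Applying `R(v, Jv)` to `T_v x` as a derivation gives `4 J T_v³ x = κ J T_v x`; injectivity of
  -- `T_v` on the complement removes one factor `T_v`.
  have key (x : V) (hx : m.P x = 0) : m.T v (m.T v x) = (κ / 4) • x := by
    have h := m.R_T v (m.J v) v x
    rw [m.R_J_self hv (m.P_T_left hv x), hκ, m.R_J_self hv hx, map_smul, map_smul, m.T_J,
      LinearMap.smul_apply, m.T_J_left, ← sub_eq_zero] at h
    have h1 : m.T v (m.J (m.T v (m.T v x) - (κ / 4) • x)) = 0 := by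
      rw [m.T_J, map_sub, map_smul, map_sub, map_smul]
      have e : (4 : ℝ) • -(m.J (m.T v (m.T v (m.T v x))) - (κ / 4) • m.J (m.T v x)) = 0 := by
        rw [← h]
        module
      exact (smul_eq_zero.1 e).resolve_left four_ne_zero
    have h2 : m.P (m.J (m.T v (m.T v x) - (κ / 4) • x)) = 0 := by
      rw [m.P_J, map_sub, m.P_T_left hv, map_smul, hx, smul_zero, sub_zero, map_zero]
    have h3 := congrArg m.J (m.inj v _ hv h0 h2 h1)
    rw [m.J_sq, map_zero, neg_eq_zero] at h3
    exact sub_eq_zero.1 h3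
  -- Division by `|v|²` makes the constant independent of `v`: for `w = av + bJv` antilinearity
  -- gives `T_w² = (a² + b²) T_v²` on the complement.
  refine ⟨-(κ / 4) / m.g v v, fun w hw x hx ↦ ?_⟩
  obtain ⟨a, b, rfl⟩ := m.exists_of_mem hv h0 hw
  have hTw (x : V) : m.T (a • v + b • m.J v) x = a • m.T v x - b • m.J (m.T v x) := by
    simp only [map_add, map_smul, LinearMap.add_apply, LinearMap.smul_apply, m.T_J_left]
    module
  have hg : m.g (a • v + b • m.J v) (a • v + b • m.J v) = (a ^ 2 + b ^ 2) * m.g v v := by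
    simp only [map_add, map_smul, LinearMap.add_apply, LinearMap.smul_apply, m.symm v (m.J v), hJv,
      m.J_orth, smul_eq_mul]
    ring
  rw [hTw, hTw, map_sub, map_smul, map_smul, m.T_J, key x hx, hg]
  simp only [map_sub, map_smul, map_neg, m.J_sq]
  have : -(-(κ / 4) / m.g v v * ((a ^ 2 + b ^ 2) * m.g v v)) = (κ / 4) * (a ^ 2 + b ^ 2) := by
    field_simp
  rw [this]
  module

/-- The derivation identity behind `exists_T_T`, read in the other direction: with `T_v²` known it
determines `κ`. A nonzero `x` orthogonal to `L` is needed in order that `T_v x ≠ 0`. -/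
theorem R_J_self_mem {l : ℝ} (hl : ∀ v ∈ m.L, ∀ x, m.P x = 0 → m.T v (m.T v x) = -(l * m.g v v) • x)
    (hE : ∃ x, x ≠ 0 ∧ m.P x = 0) {v : V} (hv : v ∈ m.L) :
    m.R v (m.J v) v = (-4 * l * m.g v v) • m.J v := by
  by_cases h0 : v = 0
  · simp [h0]
  have hpos := m.pos v h0
  obtain ⟨x, hx0, hx⟩ := hE
  obtain ⟨a, κ, hκ⟩ := m.exists_of_mem hv h0 (m.R_L v (m.J v) v hv)
  have hJv : m.g (m.J v) v = 0 := by
    have h := m.J_skew v v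
    rw [m.symm v] at h
    linarith
  have ha : a = 0 := by
    have h := m.R_skew v (m.J v) v v
    rw [hκ, m.symm v] at h
    simp only [map_add, map_smul, LinearMap.add_apply, LinearMap.smul_apply, hJv, smul_eq_mul,
      mul_zero, add_zero] at h
    have : a * m.g v v = 0 := by linarith
    exact (mul_eq_zero.1 this).resolve_right hpos.ne'
  rw [ha, zero_smul, zero_add] at hκ
  have hTx : m.T v x ≠ 0 := fun h ↦ hx0 (m.inj v x hv h0 hx h)
  have h := m.R_T v (m.J v) v x
  rw [m.R_J_self hv (m.P_T_left hv x), hκ, m.R_J_self hv hx, map_smul, map_smul, m.T_J,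
    LinearMap.smul_apply, m.T_J_left, hl v hv _ (m.P_T_left hv x), map_smul] at h
  have h1 : (κ + 4 * l * m.g v v) • m.J (m.T v x) = 0 := by
    rw [← sub_eq_zero] at h
    rw [← h]
    module
  have h2 : m.J (m.T v x) ≠ 0 := fun h ↦ hTx (by
    have := congrArg m.J h
    rwa [m.J_sq, map_zero, neg_eq_zero] at this)
  have h3 := (smul_eq_zero.1 h1).resolve_right h2
  rw [hκ]
  congr 1
  linarith

/-- The curvature of `L`. -/
theorem R_mem {l : ℝ} (hl : ∀ v ∈ m.L, ∀ x, m.P x = 0 → m.T v (m.T v x) = -(l * m.g v v) • x)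
    (hE : ∃ x, x ≠ 0 ∧ m.P x = 0) {v : V} (hv : v ∈ m.L) (x y : V) :
    m.R x y v = (2 * l * (m.g (m.J x) y - 3 * m.g (m.J (m.P x)) y)) • m.J v := by
  by_cases h0 : v = 0
  · simp [h0]
  have hpos := m.pos v h0
  have hJv : m.g (m.J v) v = 0 := by
    have h := m.J_skew v v
    rw [m.symm v] at h
    linarith
  obtain ⟨a, c, hc⟩ := m.exists_of_mem hv h0 (m.R_L x y v hv)
  have ha : a = 0 := by
    have h := m.R_skew x y v v
    rw [hc, m.symm v] at h
    simp only [map_add, map_smul, LinearMap.add_apply, LinearMap.smul_apply, hJv, smul_eq_mul,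
      mul_zero, add_zero] at h
    have : a * m.g v v = 0 := by linarith
    exact (mul_eq_zero.1 this).resolve_right hpos.ne'
  rw [ha, zero_smul, zero_add] at hc
  -- `R(v, Jv)` is `2l|v|² J` on the complement and `-4l|v|² J` on `L`; as `-4 = 2 - 6`, a single
  -- formula covers both. Pair symmetry then yields `c`.
  have hR : m.R v (m.J v) x
      = (2 * l * m.g v v) • m.J x - (6 * l * m.g v v) • m.J (m.P x) := by
    have hQ : m.P (x - m.P x) = 0 := by rw [map_sub, m.P_idem, sub_self]
    have h1 := m.R_J_self hv hQ
    rw [hl v hv _ hQ] at h1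
    have h2 : m.R v (m.J v) (m.P x) = (-4 * l * m.g v v) • m.J (m.P x) := by
      obtain ⟨s, t, hst⟩ := m.exists_of_mem hv h0 (m.P_mem x)
      rw [hst]
      simp only [map_add, map_smul, m.R_J, m.R_J_self_mem hl hE hv]
      module
    have h3 : m.R v (m.J v) x = m.R v (m.J v) (x - m.P x) + m.R v (m.J v) (m.P x) := by
      rw [← map_add, sub_add_cancel]
    rw [h3, h1, h2]
    simp only [map_smul, map_sub]
    module
  have h := m.R_pair x y v (m.J v)
  rw [hc, hR, map_smul, LinearMap.smul_apply, m.J_orth] at h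
  simp only [map_sub, map_smul, LinearMap.sub_apply, LinearMap.smul_apply, smul_eq_mul] at h
  have hc' : c = 2 * l * (m.g (m.J x) y - 3 * m.g (m.J (m.P x)) y) := by
    apply mul_right_cancel₀ hpos.ne'
    linarith
  rw [hc, hc']

/-- The almost complex structure `J`, reversed on `L`. -/
def Jrev : V →ₗ[ℝ] V := m.J - (2 : ℝ) • m.J ∘ₗ m.P

theorem Jrev_apply (x : V) : m.Jrev x = m.J x - (2 : ℝ) • m.J (m.P x) := rfl

/-! ### The trace of the curvature against the reversed structure -/

section Trace

variable [FiniteDimensional ℝ V]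

local notation "tr" => LinearMap.trace ℝ V

theorem trace_P : tr m.P = 2 := by
  have h : LinearMap.IsProj m.L m.P := ⟨m.P_mem, m.P_of_mem⟩
  rw [h.trace, m.finrank_L]
  norm_num

/-- The bracket on the right is the modified Kähler form `ω̄(x, y)`. With `ρ = 2l ω̄(x, y)`, the
line `L` contributes `2ρ`, since there `J̄ = -J` meets `ρJ`; the complement, of dimension `2n - 2`,
contributes `(n - 1)ρ`. -/
theorem trace_Jrev_R {n : ℕ} (hn : Module.finrank ℝ V = 2 * n) {l : ℝ} (hl0 : l ≠ 0)
    (hl : ∀ v ∈ m.L, ∀ x, m.P x = 0 → m.T v (m.T v x) = -(l * m.g v v) • x)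
    (hE : ∃ x, x ≠ 0 ∧ m.P x = 0) (x y : V) :
    tr (m.Jrev ∘ₗ m.R x y) = (n + 1) * (2 * l * (m.g (m.J x) y - 3 * m.g (m.J (m.P x)) y)) := by
  obtain ⟨v, hv, h0⟩ := m.exists_ne_zero
  have hpos := m.pos v h0
  set ρ := 2 * l * (m.g (m.J x) y - 3 * m.g (m.J (m.P x)) y) with hρ
  have hR (w : V) (hw : w ∈ m.L) : m.R x y w = ρ • m.J w := m.R_mem hl hE hw x y
  set Q : V →ₗ[ℝ] V := LinearMap.id - m.P with hQ
  set N : V →ₗ[ℝ] V := m.R x y with hN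
  set θ : V →ₗ[ℝ] V := m.T v with hθ
  have hid : tr (LinearMap.id : V →ₗ[ℝ] V) = 2 * n := by
    rw [LinearMap.trace_id, hn]
    push_cast
    ring
  have htQ : tr Q = 2 * n - 2 := by
    rw [hQ, map_sub, m.trace_P, hid]
  have hθθ : θ ∘ₗ θ = -(l * m.g v v) • Q := by
    ext w
    have h1 : m.P (w - m.P w) = 0 := by rw [map_sub, m.P_idem, sub_self]
    have h2 := hl v hv _ h1
    rw [map_sub, map_sub, m.T_mem_mem hv (m.P_mem w), map_zero, sub_zero] at h2
    simpa [hQ] using h2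
  -- The derivation property again: the commutator is `T(R(x, y)v, ·) = ρ T(Jv, ·)`.
  have hNθ : N ∘ₗ θ - θ ∘ₗ N = -ρ • m.J ∘ₗ θ := by
    ext w
    have h1 := m.R_T x y v w
    rw [hR v hv, map_smul, LinearMap.smul_apply, m.T_J_left] at h1
    simp only [LinearMap.sub_apply, LinearMap.comp_apply, LinearMap.smul_apply, hN, hθ, h1]
    module
  have h1 : tr (m.J ∘ₗ N ∘ₗ θ ∘ₗ θ) - tr (m.J ∘ₗ θ ∘ₗ N ∘ₗ θ) = ρ * tr (θ ∘ₗ θ) := by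
    have e : m.J ∘ₗ N ∘ₗ θ ∘ₗ θ - m.J ∘ₗ θ ∘ₗ N ∘ₗ θ = ρ • (θ ∘ₗ θ) := by
      have := congrArg (fun A ↦ m.J ∘ₗ A ∘ₗ θ) hNθ
      ext w
      have h2 := congrArg (fun A ↦ A w) this
      simp only [LinearMap.comp_apply, LinearMap.sub_apply, LinearMap.smul_apply, map_sub, map_smul,
        m.J_sq] at h2 ⊢
      rw [h2]
      module
    rw [← map_sub, e, map_smul, smul_eq_mul]
  have hJθ : m.J ∘ₗ θ = -(θ ∘ₗ m.J) := by
    ext w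
    simp [hθ, m.T_J]
  -- Cyclicity of the trace and `θJθ = -Jθ² = l|v|² JQ`: both traces in `h1` become multiples of
  -- `tr(JNQ)`, with opposite signs, so that their difference doubles it.
  have h2 : tr (m.J ∘ₗ θ ∘ₗ N ∘ₗ θ) = l * m.g v v * tr (m.J ∘ₗ N ∘ₗ Q) := by
    have e1 : tr (m.J ∘ₗ θ ∘ₗ N ∘ₗ θ) = tr ((θ ∘ₗ m.J ∘ₗ θ) ∘ₗ N) := by
      rw [← LinearMap.comp_assoc, ← LinearMap.comp_assoc, LinearMap.trace_comp_comm']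
      rfl
    have e2 : θ ∘ₗ m.J ∘ₗ θ = (l * m.g v v) • (m.J ∘ₗ Q) := by
      rw [← LinearMap.comp_assoc, ← neg_neg (θ ∘ₗ m.J), ← hJθ, LinearMap.neg_comp,
        LinearMap.comp_assoc, hθθ]
      ext w
      simp
    have e3 : Q ∘ₗ N = N ∘ₗ Q := by
      ext w
      simp [hQ, hN, m.R_P]
    rw [e1, e2, LinearMap.smul_comp, map_smul, smul_eq_mul, LinearMap.comp_assoc, e3]
  have h3 : tr (m.J ∘ₗ N ∘ₗ Q) = ρ * (n - 1) := by
    rw [h2, hθθ, LinearMap.comp_smul, LinearMap.comp_smul] at h1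
    simp only [map_smul, smul_eq_mul, htQ] at h1
    apply mul_left_cancel₀ (mul_ne_zero hl0 hpos.ne')
    linarith
  have h4 : m.Jrev ∘ₗ N = m.J ∘ₗ N ∘ₗ Q + ρ • m.P := by
    ext w
    have hP : m.R x y (m.P w) = ρ • m.J (m.P w) := hR _ (m.P_mem w)
    simp only [LinearMap.comp_apply, LinearMap.add_apply, LinearMap.smul_apply, hQ, hN,
      LinearMap.sub_apply, LinearMap.id_apply, map_sub, m.Jrev_apply, m.R_P, hP,
      map_smul, m.J_sq]
    module
  rw [h4, map_add, h3, map_smul, m.trace_P, smul_eq_mul]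
  ring

end Trace

end HolonomyModel

/-! ### Ricci curvature of Kähler curvature tensors -/

section KahlerCurvature

variable [FiniteDimensional ℝ V]

local notation "tr" => LinearMap.trace ℝ V

/-- Under the isomorphism with the dual given by `g`, `A` becomes the transpose of `B`. -/
theorem trace_eq_of_adjoint {g : LinearMap.BilinForm ℝ V} (hg : g.Nondegenerate) {A B : V →ₗ[ℝ] V}
    (h : ∀ e f, g (A e) f = g e (B f)) : tr A = tr B := by
  have h1 : (g.toDual hg).conj A = Module.Dual.transpose (R := ℝ) B := by
    ext φ f
    obtain ⟨e, rfl⟩ := (g.toDual hg).surjective φ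
    simp [LinearEquiv.conj_apply, LinearMap.BilinForm.toDual_def, h, Module.Dual.transpose_apply]
  rw [← LinearMap.trace_conj' A (g.toDual hg), h1, LinearMap.trace_transpose']

theorem curvature_pair_symm {R : V → V → V → V → ℝ} (h₁ : ∀ x y z w, R y x z w = -R x y z w)
    (h₂ : ∀ x y z w, R x y w z = -R x y z w)
    (hb : ∀ x y z w, R x y z w + R y z x w + R z x y w = 0) (x y z w : V) :
    R x y z w = R z w x y := by
  have r4 : R w y z x = R y w x z := by rw [h₁, h₂]; ring
  have r5 : R x z w y = R z x y w := by rw [h₁, h₂]; ring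
  linarith [hb x y z w, hb y z w x, hb z w x y, hb w x y z, h₂ y z x w, h₂ z w x y, h₂ x y z w,
    h₂ w x y z]

/-- For a curvature tensor of Kähler type, the trace of `J ∘ S u v` is twice the Ricci
form. -/
theorem trace_J_comp_curvature {g : LinearMap.BilinForm ℝ V} (hg : g.Nondegenerate)
    (hsymm : ∀ u v, g u v = g v u) {J : V →ₗ[ℝ] V} (hJ : ∀ v, J (J v) = -v)
    (hJg : ∀ u v, g (J u) (J v) = g u v) {S : V →ₗ[ℝ] V →ₗ[ℝ] V →ₗ[ℝ] V}
    (h₁ : ∀ u v w, S v u w = -S u v w) (h₂ : ∀ u v w z, g (S u v w) z = -g w (S u v z))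
    (hSJ : ∀ u v w, S u v (J w) = J (S u v w)) (hb : ∀ u v w, S u v w + S v w u + S w u v = 0)
    (u v : V) : tr (J ∘ₗ S u v) = 2 * tr ((S.flip v).flip (J u)) := by
  have hpair (x y z w : V) : g (S x y z) w = g (S z w x) y := by
    refine curvature_pair_symm (R := fun x y z w ↦ g (S x y z) w) (fun x y z w ↦ ?_)
      (fun x y z w ↦ ?_) (fun x y z w ↦ ?_) x y z w
    · simp only [h₁ x y z, map_neg, LinearMap.neg_apply]
    · simp only [h₂ x y w z, hsymm w]
    · simp only [← LinearMap.add_apply, ← map_add, hb, map_zero, LinearMap.zero_apply]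
  have hext {a b : V} (h : ∀ w, g a w = g b w) : a = b :=
    sub_eq_zero.1 (hg.1 (a - b) fun w ↦ by rw [LinearMap.map_sub₂, h, sub_self])
  have hSJJ (x y z : V) : S (J x) (J y) z = S x y z := by
    refine hext fun w ↦ ?_
    rw [hpair, hSJ, hJg, ← hpair]
  -- By pair symmetry `e ↦ S(e, u)v` and `e ↦ S(e, v)u` are adjoint.
  have hric_symm (u v : V) : tr ((S.flip u).flip v) = tr ((S.flip v).flip u) := by
    refine trace_eq_of_adjoint hg fun e f ↦ ?_
    simp only [LinearMap.flip_apply]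
    rw [hpair, h₁, map_neg, LinearMap.neg_apply, h₂, neg_neg]
  have hric_J (u v : V) : tr ((S.flip (J u)).flip (J v)) = tr ((S.flip u).flip v) := by
    have h : (S.flip (J u)).flip (J v) = -(J ∘ₗ ((S.flip u).flip v) ∘ₗ J) := by
      ext e
      simp only [LinearMap.flip_apply, LinearMap.neg_apply, LinearMap.comp_apply]
      have h := hSJJ (J e) u v
      rw [hJ, map_neg, LinearMap.neg_apply, LinearMap.neg_apply] at h
      rw [hSJ, ← h, map_neg, neg_neg]
    rw [h, map_neg, LinearMap.trace_comp_comm', LinearMap.comp_assoc]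
    have hJJ : J ∘ₗ J = -LinearMap.id := by
      ext e
      simp [hJ]
    rw [hJJ, LinearMap.comp_neg, map_neg, neg_neg, LinearMap.comp_id]
  -- The Bianchi identity for `u`, `v`, `e`, with `J` moved through `S`.
  have h : J ∘ₗ S u v = (S.flip v).flip (J u) - (S.flip u).flip (J v) := by
    ext e
    simp only [LinearMap.comp_apply, LinearMap.sub_apply, LinearMap.flip_apply, hSJ]
    have h3 := hb u v e
    rw [h₁ e v u] at h3
    rw [← map_sub]
    congr 1
    rw [← sub_eq_zero, ← h3]
    abel
  have h4 : tr ((S.flip u).flip (J v)) = -tr ((S.flip v).flip (J u)) := by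
    rw [← hric_J, hJ, map_neg, map_neg, hric_symm]
  rw [h, map_sub, h4]
  ring

end KahlerCurvature

/-! ### The difference tensor of the modified connection -/

namespace HolonomyModel

variable (m : HolonomyModel V)

/-- The difference between the Levi-Civita connection of the modified metric and the connection with
torsion `T`. -/
def C (u : V) : V →ₗ[ℝ] V := -(1 / 2 : ℝ) • (m.T (u - m.P u) ∘ₗ (LinearMap.id + m.P))

theorem C_apply (u z : V) : m.C u z = -(1 / 2 : ℝ) • m.T (u - m.P u) (z + m.P z) := rfl

theorem T_add_P (u z : V) : m.T (u - m.P u) z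
    = m.T (u - m.P u) (z - m.P z) + m.T (u - m.P u) (m.P z) := by
  rw [← map_add, sub_add_cancel]

/-- For `e ⊥ L`, `T_e` exchanges `L` and its complement: only the part of `z` orthogonal to `L` has
an image in `L`. -/
theorem P_T_sub (u z : V) : m.P (m.T (u - m.P u) z) = m.T (u - m.P u) (z - m.P z) := by
  have h1 : m.P (u - m.P u) = 0 := by rw [map_sub, m.P_idem, sub_self]
  have h2 : m.P (z - m.P z) = 0 := by rw [map_sub, m.P_idem, sub_self]
  rw [m.T_add_P, map_add, m.P_T h1 h2, m.P_T_right (m.P_mem z), add_zero]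

/-- `T_e` anticommutes with `J` and exchanges the two summands, on which `J̄` is `J` with opposite
signs; the two signs compensate. -/
theorem Jrev_C (u : V) : m.Jrev ∘ₗ m.C u = m.C u ∘ₗ m.Jrev := by
  ext z
  have hP := m.P_T_sub u
  simp only [LinearMap.comp_apply, m.C_apply, m.Jrev_apply]
  generalize u - m.P u = e at hP
  simp only [map_add, map_sub, map_smul, hP, m.P_J, m.P_idem, m.T_J]
  module

/-- The modified metric is `g(·, z + Pz)`, and `C` feeds exactly `z + Pz` to the torsion, so this is
the skewness of `T`. -/
theorem C_skew (u y z : V) :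
    m.g (m.C u y) (z + m.P z) + m.g (y + m.P y) (m.C u z) = 0 := by
  rw [m.C_apply, m.C_apply, map_smul, map_smul, LinearMap.smul_apply, m.T_skew, smul_neg,
    neg_add_cancel]

/-- `C x y` is `-½ T(x, y)` when both vectors are orthogonal to `L`, `-T(x, y)` when only `y` is in
`L`, and `0` when `x` is in `L`; in each case the skew part cancels `T`. -/
theorem T_add_C_sub_C (x y : V) : m.T x y + m.C x y - m.C y x = 0 := by
  have h1 := m.T_mem_mem (m.P_mem x) (m.P_mem y)
  have h2 := m.T_swap y x
  have h3 := m.T_swap (m.P y) x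
  have h4 := m.T_swap y (m.P x)
  have h5 := m.T_mem_mem (m.P_mem y) (m.P_mem x)
  simp only [m.C_apply, map_add, map_sub, LinearMap.sub_apply, h1, h2, h3, h4, h5]
  module

variable [FiniteDimensional ℝ V]

local notation "tr" => LinearMap.trace ℝ V

/-- The operator is off-diagonal for the splitting by `L`, hence changes sign under conjugation by
the reflection `1 - 2P`. -/
theorem trace_Jrev_C (u : V) : tr (m.Jrev ∘ₗ m.C u) = 0 := by
  let K : V →ₗ[ℝ] V := LinearMap.id - (2 : ℝ) • m.P
  have h1 : m.Jrev ∘ₗ m.C u = -(K ∘ₗ (m.Jrev ∘ₗ m.C u) ∘ₗ K) := by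
    ext z
    have hP := m.P_T_sub u
    simp only [LinearMap.comp_apply, LinearMap.neg_apply, m.C_apply, m.Jrev_apply, K,
      LinearMap.sub_apply, LinearMap.id_apply, LinearMap.smul_apply]
    generalize u - m.P u = e at hP
    simp only [map_add, map_sub, map_smul, hP, m.P_J, m.P_idem]
    module
  have h2 : K ∘ₗ K = LinearMap.id := by
    ext z
    simp only [LinearMap.comp_apply, K, LinearMap.sub_apply, LinearMap.id_apply,
      LinearMap.smul_apply, map_sub, map_smul, m.P_idem]
    module
  have h3 : tr (m.Jrev ∘ₗ m.C u) = -tr (m.Jrev ∘ₗ m.C u) := by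
    nth_rewrite 1 [h1]
    rw [map_neg, ← LinearMap.comp_assoc, LinearMap.trace_comp_comm', ← LinearMap.comp_assoc, h2,
      LinearMap.id_comp]
  linarith

/-- `J̄` commutes with every `C_u`, so cyclicity kills the commutator term. -/
theorem trace_Jrev_curvature (u v : V) :
    tr (m.Jrev ∘ₗ (m.R u v + m.C (m.T u v) + (m.C u ∘ₗ m.C v - m.C v ∘ₗ m.C u)))
      = tr (m.Jrev ∘ₗ m.R u v) := by
  have h : tr (m.Jrev ∘ₗ m.C u ∘ₗ m.C v) = tr (m.Jrev ∘ₗ m.C v ∘ₗ m.C u) := by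
    rw [← LinearMap.comp_assoc, m.Jrev_C, LinearMap.comp_assoc, LinearMap.trace_comp_comm',
      LinearMap.comp_assoc]
  rw [LinearMap.comp_add, LinearMap.comp_add, LinearMap.comp_sub, map_add, map_add, map_sub, h,
    m.trace_Jrev_C]
  ring

end HolonomyModel

end LinearAlgebra

section Manifold

variable {E : Type*} [NormedAddCommGroup E] [NormedSpace ℝ E]
  {M : Type*} [TopologicalSpace M] [ChartedSpace E M] [IsManifold 𝓘(ℝ, E) ∞ M]
  [FiniteDimensional ℝ E]

/-! ### The canonical Hermitian connection of a nearly Kähler manifold -/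

/-- The action of an almost complex structure on smooth vector fields. -/
def AlmostComplex.app (J : AlmostComplex E M) (X : VF E M) : VF E M :=
  ⟨fun x ↦ J x (X x), ContMDiff.clm_bundle_apply (F₁ := E) (F₂ := E) J.smooth X.contMDiff⟩

@[simp]
theorem AlmostComplex.app_apply (J : AlmostComplex E M) (X : VF E M) (x : M) :
    J.app X x = J x (X x) := rfl

theorem AlmostComplex.app_app (J : AlmostComplex E M) (X : VF E M) : J.app (J.app X) = -X := by
  ext x
  exact J.sq x _

theorem AlmostComplex.app_neg (J : AlmostComplex E M) (X : VF E M) : J.app (-X) = -J.app X := by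
  ext x
  exact map_neg (J x) (X x)

theorem AlmostComplex.app_sub (J : AlmostComplex E M) (X Y : VF E M) :
    J.app (X - Y) = J.app X - J.app Y := by
  ext x
  exact map_sub (J x) (X x) (Y x)

theorem inner_J_left {g : Metric E M} {J : AlmostComplex E M} (h : IsAlmostHermitian g J) {x : M}
    (v w : TangentSpace 𝓘(ℝ, E) x) : g.inner x (J x v) w = -g.inner x v (J x w) := by
  rw [← h x v (J x w), J.sq, map_neg, neg_neg]

/-! ### Torsion and parallelism of the canonical connection -/

section Canonical

variable [T2Space M]

/-- The vector field `(∇_X J)Y`. -/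
def nabJ (g : Metric E M) (J : AlmostComplex E M) (X Y : VF E M) : VF E M :=
  (lc g).nab X (J.app Y) - J.app ((lc g).nab X Y)

theorem nabJ_eq (g : Metric E M) (J : AlmostComplex E M) (X Y : VF E M) (x : M) :
    nabJ g J X Y x = nablaJ g J x (X x) (Y x) :=
  (nablaJ_apply g J (Y.mdiff x) (X x)).symm

variable {g : Metric E M} {J : AlmostComplex E M}

/-- The derivative of `J² = -1`. -/
theorem nablaJ_J (g : Metric E M) (J : AlmostComplex E M) {x : M} (v w : TangentSpace 𝓘(ℝ, E) x) :
    nablaJ g J x v (J x w) = -J x (nablaJ g J x v w) := by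
  have h : nabJ g J (extVF v) (J.app (extVF w)) = -J.app (nabJ g J (extVF v) (extVF w)) := by
    simp only [nabJ, J.app_sub, J.app_app, Conn.neg_right]
    abel
  have h1 := congrArg (fun W : VF E M ↦ W x) h
  simpa [nabJ_eq] using h1

/-- The derivative of the skewness of `J`. -/
theorem inner_nablaJ (hJ : IsAlmostHermitian g J) {x : M} (u v w : TangentSpace 𝓘(ℝ, E) x) :
    g.inner x (nablaJ g J x u v) w = -g.inner x v (nablaJ g J x u w) := by
  have h0 (X Y : VF E M) : g.ip (J.app X) Y + g.ip X (J.app Y) = ContMDiffMap.const 0 := by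
    ext y
    change g.inner y (J y (X y)) (Y y) + g.inner y (X y) (J y (Y y)) = 0
    rw [inner_J_left hJ, neg_add_cancel]
  have h := congrArg (fun f : SmoothFn E M ↦ f x)
    (congrArg (dir (extVF u)) (h0 (extVF v) (extVF w)))
  have hm : ∀ X Y Z, dir X (g.ip Y Z) = g.ip ((lc g).nab X Y) Z + g.ip Y ((lc g).nab X Z) :=
    lc_isMetric g
  rw [dir_const, dir_add, hm, hm] at h
  have e1 := nabJ_eq g J (extVF u) (extVF v) x
  have e2 := nabJ_eq g J (extVF u) (extVF w) x
  simp only [extVF_self] at e1 e2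
  rw [← e1, ← e2]
  simp only [nabJ, ContMDiffMap.coe_add, Pi.add_apply, Metric.ip_apply, AlmostComplex.app_apply,
    extVF_self, ContMDiffSection.coe_sub, Pi.sub_apply, map_sub, sub_apply] at h ⊢
  have h3 := inner_J_left hJ ((lc g).nab (extVF u) (extVF v) x) w
  have h4 := inner_J_left hJ v ((lc g).nab (extVF u) (extVF w) x)
  have h5 : (0 : SmoothFn E M) x = 0 := rfl
  rw [h5] at h
  linarith

theorem nablaJ_swap (h : IsNearlyKahler g J) {x : M} (v w : TangentSpace 𝓘(ℝ, E) x) :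
    nablaJ g J x w v = -nablaJ g J x v w := by
  have h1 := h.2 x (v + w)
  simp only [map_add, LinearMap.add_apply, h.2, zero_add, add_zero] at h1
  rw [← sub_eq_zero, sub_neg_eq_add, ← h1]

/-- The torsion of the canonical Hermitian connection. -/
def torsion (g : Metric E M) (J : AlmostComplex E M) (x : M) :
    TangentSpace 𝓘(ℝ, E) x →ₗ[ℝ] TangentSpace 𝓘(ℝ, E) x →ₗ[ℝ] TangentSpace 𝓘(ℝ, E) x :=
  (nablaJ g J x).compl₂ (J x).toLinearMap

theorem torsion_apply (g : Metric E M) (J : AlmostComplex E M) (x : M)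
    (v w : TangentSpace 𝓘(ℝ, E) x) : torsion g J x v w = nablaJ g J x v (J x w) := rfl

theorem nablaJ_eq_torsion (g : Metric E M) (J : AlmostComplex E M) (x : M)
    (v w : TangentSpace 𝓘(ℝ, E) x) : nablaJ g J x v w = J x (torsion g J x v w) := by
  rw [torsion_apply, nablaJ_J, map_neg, J.sq, neg_neg]

theorem torsion_swap (h : IsNearlyKahler g J) {x : M} (v w : TangentSpace 𝓘(ℝ, E) x) :
    torsion g J x w v = -torsion g J x v w := by
  rw [torsion_apply, torsion_apply, nablaJ_J, nablaJ_J, nablaJ_swap h, map_neg]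

theorem inner_torsion (h : IsNearlyKahler g J) {x : M} (u v w : TangentSpace 𝓘(ℝ, E) x) :
    g.inner x (torsion g J x u v) w = -g.inner x v (torsion g J x u w) := by
  rw [torsion_apply, torsion_apply, inner_nablaJ h.1, inner_J_left h.1, nablaJ_J, map_neg]

theorem torsion_J (g : Metric E M) (J : AlmostComplex E M) {x : M} (u v : TangentSpace 𝓘(ℝ, E) x) :
    torsion g J x u (J x v) = -J x (torsion g J x u v) := by
  rw [torsion_apply, torsion_apply, nablaJ_J]

/-- The canonical Hermitian connection, acting on smooth vector fields. -/
def canon (g : Metric E M) (J : AlmostComplex E M) : Conn E M where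
  nab X Y := (lc g).nab X Y + (1 / 2 : ℝ) • nabJ g J X (J.app Y)
  add_left X X' Y := by
    ext x
    have h (X : VF E M) := nabJ_eq g J X (J.app Y) x
    simp [h, Conn.add_left]
    module
  fmul_left f X Y := by
    ext x
    have h (X : VF E M) := nabJ_eq g J X (J.app Y) x
    simp [h, Conn.fmul_left]
    module
  add_right X Y Y' := by
    ext x
    have h (Y : VF E M) := nabJ_eq g J X (J.app Y) x
    simp [h, Conn.add_right]
    module
  leibniz f X Y := by
    ext x
    have h (Y : VF E M) := nabJ_eq g J X (J.app Y) x
    simp [h, Conn.leibniz]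
    module

theorem canon_nab (X Y : VF E M) :
    (canon g J).nab X Y = (lc g).nab X Y + (1 / 2 : ℝ) • nabJ g J X (J.app Y) := rfl

theorem canon_apply (X Y : VF E M) (x : M) :
    (canon g J).nab X Y x = canonicalConnection g J (fun y ↦ Y y) x (X x) := by
  rw [canonicalConnection_apply, canon_nab, ← lc_apply, ← J.app_apply, ← nabJ_eq]
  rfl

/-- Both sides equal `J∇_X Y + ½ (∇_X J)Y`; the correction term shares the defect `(∇_X J)Y` equally
between them. -/
theorem canon_app (X Y : VF E M) : (canon g J).nab X (J.app Y) = J.app ((canon g J).nab X Y) := by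
  ext x
  have h := nabJ_eq g J X Y x
  have h1 := nabJ_eq g J X (J.app Y) x
  have h2 := nabJ_eq g J X (J.app (J.app Y)) x
  rw [nabJ] at h
  simp only [canon_nab, ContMDiffSection.coe_add, Pi.add_apply, ContMDiffSection.coe_smul,
    Pi.smul_apply, h1, h2, J.app_apply, J.sq, map_neg, map_add, map_smul, nablaJ_J, neg_neg,
    ContMDiffSection.coe_sub, Pi.sub_apply, sub_eq_iff_eq_add] at h ⊢
  rw [h]
  module

theorem canon_isMetric (h : IsNearlyKahler g J) : (canon g J).IsMetric g := by
  intro X Y Z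
  rw [lc_isMetric]
  ext x
  have h1 := nabJ_eq g J X (J.app Y) x
  have h2 := nabJ_eq g J X (J.app Z) x
  rw [J.app_apply, ← torsion_apply] at h1 h2
  have h3 := inner_torsion h (X x) (Y x) (Z x)
  simp only [canon_nab, ContMDiffMap.coe_add, Pi.add_apply, Metric.ip_apply,
    ContMDiffSection.coe_add, ContMDiffSection.coe_smul, Pi.smul_apply, map_add, add_apply,
    map_smul, smul_apply, h1, h2, h3, smul_eq_mul]
  ring

/-- The Levi-Civita part has no torsion, and the two halves of the correction add up by skewness. -/
theorem canon_tor (h : IsNearlyKahler g J) (X Y : VF E M) (x : M) :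
    (canon g J).tor X Y x = torsion g J x (X x) (Y x) := by
  have h0 := congrArg (fun W : VF E M ↦ W x) (lc_tor g X Y)
  have h1 := nabJ_eq g J X (J.app Y) x
  have h2 := nabJ_eq g J Y (J.app X) x
  rw [J.app_apply, ← torsion_apply] at h1 h2
  rw [torsion_swap h (X x)] at h2
  simp only [Conn.tor, canon_nab, ContMDiffSection.coe_sub, ContMDiffSection.coe_add,
    ContMDiffSection.coe_smul, Pi.sub_apply, Pi.add_apply, Pi.smul_apply, h1, h2] at h0 ⊢
  change _ = (0 : TangentSpace 𝓘(ℝ, E) x) at h0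
  rw [← sub_eq_zero] at h0 ⊢
  rw [← h0]
  module

theorem canon_tor_app (h : IsNearlyKahler g J) (X Y : VF E M) :
    (canon g J).tor X (J.app Y) = -J.app ((canon g J).tor X Y) := by
  ext x
  simp [canon_tor h, torsion_J]

theorem ip_canon_tor (h : IsNearlyKahler g J) (X Y Z : VF E M) :
    g.ip ((canon g J).tor X Y) Z = -g.ip Y ((canon g J).tor X Z) := by
  ext x
  simp [canon_tor h, inner_torsion h]

end Canonical

theorem Conn.tor_neg_right (c : Conn E M) (X Y : VF E M) : c.tor X (-Y) = -c.tor X Y := by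
  rw [tor_swap, tor_neg_left, c.tor_swap X Y, neg_neg]

theorem Conn.nabTor_neg_left (c : Conn E M) (X Y Z : VF E M) :
    c.nabTor (-X) Y Z = -c.nabTor X Y Z := by
  simp only [nabTor, neg_left, tor_neg_left, tor_neg_right]
  abel

/-! ### The torsion is parallel -/

section ParallelTorsion

variable [T2Space M] {g : Metric E M} {J : AlmostComplex E M}

theorem canon_nabTor_swap (X Y Z : VF E M) :
    (canon g J).nabTor X Z Y = -(canon g J).nabTor X Y Z := by
  simp only [Conn.nabTor]
  rw [(canon g J).tor_swap Y Z, (canon g J).tor_swap Y ((canon g J).nab X Z),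
    (canon g J).tor_swap ((canon g J).nab X Y) Z, Conn.neg_right]
  abel

theorem canon_nabTor_app (h : IsNearlyKahler g J) (X Y Z : VF E M) :
    (canon g J).nabTor X Y (J.app Z) = -J.app ((canon g J).nabTor X Y Z) := by
  simp only [Conn.nabTor, canon_tor_app h, canon_app, Conn.neg_right, J.app_sub]
  abel

theorem canon_nabTor_app_left (h : IsNearlyKahler g J) (X Y Z : VF E M) :
    (canon g J).nabTor X (J.app Y) Z = -J.app ((canon g J).nabTor X Y Z) := by
  rw [canon_nabTor_swap, canon_nabTor_app h, canon_nabTor_swap X Y Z, J.app_neg, neg_neg]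

theorem ip_canon_nabTor (h : IsNearlyKahler g J) (X Y Z W : VF E M) :
    g.ip ((canon g J).nabTor X Y Z) W = -g.ip Z ((canon g J).nabTor X Y W) := by
  have hm : ∀ X Y Z, dir X (g.ip Y Z)
    = g.ip ((canon g J).nab X Y) Z + g.ip Y ((canon g J).nab X Z) := canon_isMetric h
  have h0 : g.ip ((canon g J).tor Y Z) W + g.ip Z ((canon g J).tor Y W)
      = ContMDiffMap.const 0 := by
    rw [ip_canon_tor h, neg_add_cancel]
    rfl
  have h1 := congrArg (dir X) h0
  rw [dir_const, dir_add, hm, hm] at h1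
  have h2 := ip_canon_tor h ((canon g J).nab X Y) Z W
  have h3 := ip_canon_tor h Y ((canon g J).nab X Z) W
  have h4 := ip_canon_tor h Y Z ((canon g J).nab X W)
  ext x
  have h1 := congrArg (fun f : SmoothFn E M ↦ f x) h1
  have h2 := congrArg (fun f : SmoothFn E M ↦ f x) h2
  have h3 := congrArg (fun f : SmoothFn E M ↦ f x) h3
  have h4 := congrArg (fun f : SmoothFn E M ↦ f x) h4
  have h5 : (0 : SmoothFn E M) x = 0 := rfl
  simp only [Conn.nabTor, Metric.ip_apply, ContMDiffMap.coe_neg, Pi.neg_apply, ContMDiffMap.coe_add,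
    Pi.add_apply, ContMDiffSection.coe_sub, Pi.sub_apply, map_sub, sub_apply, h5] at h1 h2 h3 h4 ⊢
  linarith

theorem canon_curv_app (X Y Z : VF E M) :
    (canon g J).curv X Y (J.app Z) = J.app ((canon g J).curv X Y Z) := by
  simp only [Conn.curv, canon_app, J.app_sub]

/-- The torsion of the canonical Hermitian connection is parallel. -/
theorem canon_nabTor (h : IsNearlyKahler g J) (X Y Z : VF E M) :
    (canon g J).nabTor X Y Z = 0 := by
  ext x
  refine g.ext_inner fun u ↦ ?_
  have hn (u : TangentSpace 𝓘(ℝ, E) x) : g.inner x ((0 : VF E M) x) u = 0 := by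
    change g.inner x 0 u = 0
    simp
  rw [hn]
  have hJJ (u v : TangentSpace 𝓘(ℝ, E) x) : g.inner x (J x u) v = -g.inner x u (J x v) :=
    inner_J_left h.1 u v
  have hT := fun u v : TangentSpace 𝓘(ℝ, E) x ↦ torsion_swap h u v
  have hTJ (u v : TangentSpace 𝓘(ℝ, E) x) : torsion g J x (J x u) v = -J x (torsion g J x u v) := by
    rw [hT, torsion_J, hT u v, map_neg, neg_neg]
  have hm := (canon_isMetric h).ip_curv
  -- The type argument runs on the space of vector fields, with values taken at `x`, so tensoriality
  -- of the derivative of the torsion is not needed.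
  have key := eq_zero_of_bianchi (V := VF E M) J.app
    (R := fun X Y Z W ↦ g.inner x ((canon g J).curv X Y Z x) (W x))
    (b := fun X Y Z W ↦ g.inner x ((canon g J).nabTor X Y Z x) (W x))
    (q := fun X Y Z W ↦ g.inner x (torsion g J x (X x) (Y x)) (torsion g J x (Z x) (W x)))
    (fun X Y Z W ↦ by
      have h1 := congrArg (fun f : SmoothFn E M ↦ f x) (hm X Y Z W)
      change g.inner x _ _ + g.inner x _ _ = (0 : ℝ) at h1
      rw [g.symm x _ (Z x), add_eq_zero_iff_eq_neg] at *
      linarith)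
    (fun X Y Z W ↦ by simp only [canon_curv_app, J.app_apply, h.1 x])
    (fun X Y Z W ↦ by simp only [canon_curv_app, J.app_apply, hJJ])
    (fun X Y Z W ↦ by simp [canon_nabTor_swap X Y Z])
    (fun X Y Z W ↦ by
      have h1 := congrArg (fun f : SmoothFn E M ↦ f x) (ip_canon_nabTor h X Y W Z)
      change g.inner x _ _ = -g.inner x _ _ at h1
      rw [h1, g.symm])
    (fun X Y Z W ↦ by simp [canon_nabTor_app h, canon_nabTor_app_left h, J.sq])
    (fun X Y Z W ↦ by simp [canon_nabTor_app h, canon_nabTor_app_left h])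
    (fun X Y Z W ↦ by simp [J.app_app, Conn.nabTor_neg_left])
    (fun X Y Z W ↦ by simp [hTJ, torsion_J, J.sq])
    (fun X Y Z W ↦ by simp [hTJ, torsion_J, J.sq])
    (fun X Y Z W ↦ by simp [hTJ, h.1 x])
    (fun X Y Z W ↦ by simp [hTJ, torsion_J, h.1 x])
    (fun X Y Z W ↦ by simp [hTJ, torsion_J, h.1 x])
    (fun X Y Z W ↦ by simp [torsion_J, h.1 x])
    (fun X Y Z W ↦ by
      have h1 := congrArg (fun V : VF E M ↦ g.inner x (V x) (W x)) ((canon g J).bianchi X Y Z)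
      have h2 (X Y Z : VF E M) : g.inner x ((canon g J).tor ((canon g J).tor X Y) Z x) (W x)
          = g.inner x (torsion g J x (X x) (Y x)) (torsion g J x (Z x) (W x)) := by
        rw [canon_tor h, canon_tor h, hT, map_neg, neg_apply, inner_torsion h, neg_neg]
      simp only [ContMDiffSection.coe_add, Pi.add_apply, map_add, add_apply, h2] at h1
      exact h1)
    X Y Z (extVF u)
  simpa using key

end ParallelTorsion

/-! ### Parallel plane distributions -/

section Projection

variable (g : Metric E M) (L : Distribution E M)

/-- The orthogonal projection onto `L`, as an endomorphism of the tangent space. -/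
def proj (x : M) : TangentSpace 𝓘(ℝ, E) x →L[ℝ] TangentSpace 𝓘(ℝ, E) x :=
  LinearMap.toContinuousLinearMap ((L x).subtype ∘ₗ orthProj g L x)

theorem proj_apply (x : M) (v : TangentSpace 𝓘(ℝ, E) x) : proj g L x v = orthProj g L x v := rfl

theorem proj_mem (x : M) (v : TangentSpace 𝓘(ℝ, E) x) : proj g L x v ∈ L x :=
  (orthProj g L x v).2

theorem proj_of_mem {x : M} {v : TangentSpace 𝓘(ℝ, E) x} (hv : v ∈ L x) : proj g L x v = v := by
  rw [proj_apply, orthProj, Submodule.projectionOnto_apply_of_mem_left _ hv]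

theorem proj_proj (x : M) (v : TangentSpace 𝓘(ℝ, E) x) :
    proj g L x (proj g L x v) = proj g L x v := proj_of_mem g L (proj_mem g L x v)

theorem proj_eq_zero_iff {x : M} {v : TangentSpace 𝓘(ℝ, E) x} :
    proj g L x v = 0 ↔ v ∈ orthCompl g L x := by
  rw [proj_apply, orthProj, ZeroMemClass.coe_eq_zero, Submodule.projectionOnto_apply_eq_zero_iff]

theorem inner_of_mem {x : M} {v w : TangentSpace 𝓘(ℝ, E) x} (hv : proj g L x v = 0)
    (hw : w ∈ L x) : g.inner x v w = 0 := by
  rw [g.symm]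
  exact ((proj_eq_zero_iff g L).1 hv) w hw

theorem proj_sub_proj (x : M) (v : TangentSpace 𝓘(ℝ, E) x) : proj g L x (v - proj g L x v) = 0 := by
  rw [map_sub, proj_proj, sub_self]

theorem inner_proj (x : M) (v w : TangentSpace 𝓘(ℝ, E) x) :
    g.inner x (proj g L x v) w = g.inner x v (proj g L x w) := by
  have h1 := inner_of_mem g L (proj_sub_proj g L x v) (proj_mem g L x w)
  have h2 := inner_of_mem g L (proj_sub_proj g L x w) (proj_mem g L x v)
  rw [map_sub, sub_apply] at h1 h2
  rw [g.symm, g.symm x (proj g L x w)] at h2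
  linarith [h1, h2, g.symm x w (proj g L x v)]

end Projection

/-- A strict nearly Kähler structure with a parallel plane distribution `L` such that the torsion
form of `L` is nondegenerate on the orthogonal complement of `L`. -/
structure HasParallelPlane (g : Metric E M) (J : AlmostComplex E M) (L : Distribution E M) :
    Prop where
  nearlyKahler : IsNearlyKahler g J
  strict : IsStrict g J
  subbundle : IsSubbundle L 2
  stable : IsStable J L
  parallel : IsParallel g J L
  inj : ∀ x : M, ∀ u ∈ orthCompl g L x, torsionEndo g J L x u = 0 → u = 0

namespace HasParallelPlane

variable {g : Metric E M} {J : AlmostComplex E M} {L : Distribution E M}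
  (h : HasParallelPlane g J L)
include h

theorem exists_smul_add {x : M} {v w : TangentSpace 𝓘(ℝ, E) x} (hv : v ∈ L x) (h0 : v ≠ 0)
    (hw : w ∈ L x) : ∃ a b : ℝ, w = a • v + b • J x v :=
  exists_smul_add_of_finrank_two (g := g.form x) (J := (J x).toLinearMap) (g.symm x) (g.pos x)
    (inner_J_left h.nearlyKahler.1) (h.nearlyKahler.1 x) (h.subbundle.1 x) (h.stable x) hv h0 hw

theorem exists_ne_zero (x : M) : ∃ v ∈ L x, v ≠ 0 := by
  refine (L x).exists_mem_ne_zero_of_ne_bot fun hb ↦ ?_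
  have := h.subbundle.1 x
  rw [hb, finrank_bot] at this
  omega

theorem inner_J_self {x : M} (v : TangentSpace 𝓘(ℝ, E) x) : g.inner x v (J x v) = 0 := by
  have h1 := inner_J_left h.nearlyKahler.1 v v
  rw [g.symm] at h1
  linarith

theorem proj_eq {x : M} {v : TangentSpace 𝓘(ℝ, E) x} (hv : v ∈ L x) (h0 : v ≠ 0)
    (u : TangentSpace 𝓘(ℝ, E) x) :
    proj g L x u = (g.inner x u v / g.inner x v v) • v
      + (g.inner x u (J x v) / g.inner x v v) • J x v := by
  obtain ⟨a, b, hab⟩ := h.exists_smul_add hv h0 (proj_mem g L x u)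
  have hpos := (g.pos x v h0).ne'
  have h1 := inner_proj g L x u v
  have h2 := inner_proj g L x u (J x v)
  rw [proj_of_mem g L hv, hab] at h1
  rw [proj_of_mem g L (h.stable x v hv), hab] at h2
  rw [← h1, ← h2, hab]
  simp only [map_add, map_smul, add_apply, smul_apply, smul_eq_mul, h.inner_J_self,
    h.nearlyKahler.1 x, g.symm x (J x v) v, mul_zero, add_zero, zero_add]
  rw [mul_div_cancel_right₀ _ hpos, mul_div_cancel_right₀ _ hpos]

/-- A section of `L` nonzero at `x`, together with its image by `J`, is near `x` an orthogonal frame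
of `L` in which the projection has smooth coefficients. -/
theorem contMDiff_proj (X : VF E M) : IsSmoothField (fun x ↦ proj g L x (X x)) := by
  intro x
  obtain ⟨v, hv, h0⟩ := h.exists_ne_zero x
  obtain ⟨Y, hY, rfl⟩ := h.subbundle.2 x v hv
  let Y' : VF E M := ⟨Y, hY.1⟩
  have hpos : g.ip Y' Y' x ≠ 0 := (g.pos x _ h0).ne'
  have hev : ∀ᶠ y in nhds x, g.ip Y' Y' y ≠ 0 :=
    (g.ip Y' Y').contMDiff.continuous.continuousAt.eventually_ne hpos
  have hsm : CMDiffAt ∞ (T% (fun y ↦ (g.ip X Y' y / g.ip Y' Y' y) • Y' y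
      + (g.ip X (J.app Y') y / g.ip Y' Y' y) • J.app Y' y)) x := by
    have hc (f : SmoothFn E M) :
        ContMDiffAt 𝓘(ℝ, E) 𝓘(ℝ, ℝ) ∞ (fun y ↦ f y / g.ip Y' Y' y) x :=
      f.contMDiff.contMDiffAt.div₀ (g.ip Y' Y').contMDiff.contMDiffAt hpos
    exact ((hc _).smul_section Y'.contMDiff.contMDiffAt).add_section
      ((hc _).smul_section (J.app Y').contMDiff.contMDiffAt)
  refine hsm.congr_of_eventuallyEq ?_
  filter_upwards [hev] with y hy
  have hy0 : Y y ≠ 0 := by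
    intro h0
    apply hy
    change g.inner y (Y y) (Y y) = 0
    rw [h0]
    simp
  rw [h.proj_eq (hY.2 y) hy0]
  rfl

/-- The projection of a smooth vector field onto the distribution. -/
def pr (X : VF E M) : VF E M := ⟨fun x ↦ proj g L x (X x), h.contMDiff_proj X⟩

@[simp]
theorem pr_apply (X : VF E M) (x : M) : h.pr X x = proj g L x (X x) := rfl

theorem pr_isSectionOf (X : VF E M) : IsSectionOf L (fun x ↦ h.pr X x) :=
  ⟨h.contMDiff_proj X, fun x ↦ proj_mem g L x _⟩

variable [T2Space M]

theorem canon_pr_mem (X Y : VF E M) (x : M) : (canon g J).nab X (h.pr Y) x ∈ L x := by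
  rw [canon_apply]
  exact h.parallel _ (h.pr_isSectionOf Y) x _

/-- The connection is metric, so the complement of `L` is parallel along with `L`. -/
theorem canon_pr (X Y : VF E M) : (canon g J).nab X (h.pr Y) = h.pr ((canon g J).nab X Y) := by
  ext x
  have hZ : proj g L x ((canon g J).nab X (Y - h.pr Y) x) = 0 := by
    set w := proj g L x ((canon g J).nab X (Y - h.pr Y) x) with hw
    let W := h.pr (extVF w)
    have hW : W x = w := by
      change proj g L x (extVF w x) = w
      rw [extVF_self, proj_of_mem g L (proj_mem g L x _)]
    have h0 : g.ip (Y - h.pr Y) W = ContMDiffMap.const 0 := by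
      ext y
      exact inner_of_mem g L (proj_sub_proj g L y (Y y)) (proj_mem g L y _)
    have h1 := congrArg (fun f : SmoothFn E M ↦ f x) (congrArg (dir X) h0)
    rw [dir_const, canon_isMetric h.nearlyKahler] at h1
    change g.inner x ((canon g J).nab X (Y - h.pr Y) x) (W x)
      + g.inner x (Y x - proj g L x (Y x)) ((canon g J).nab X W x) = 0 at h1
    have h2 := inner_proj g L x ((canon g J).nab X (Y - h.pr Y) x) w
    rw [proj_of_mem g L (proj_mem g L x _ : w ∈ L x), ← hw] at h2
    rw [hW, inner_of_mem g L (proj_sub_proj g L x (Y x)) (h.canon_pr_mem X _ x), add_zero,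
      ← h2] at h1
    exact g.eq_zero_of_self h1
  rw [Conn.sub_right, ContMDiffSection.coe_sub, Pi.sub_apply, map_sub,
    proj_of_mem g L (h.canon_pr_mem X Y x), sub_eq_zero] at hZ
  exact hZ.symm

end HasParallelPlane

/-! ### Pointwise identities for the canonical curvature -/

section CanonicalCurvature

variable [T2Space M] {g : Metric E M} {J : AlmostComplex E M}

theorem exists_VF_eq {x : M} (v : TangentSpace 𝓘(ℝ, E) x) : ∃ X : VF E M, X x = v :=
  ⟨extVF v, extVF_self v⟩

theorem canon_nab_tor (h : IsNearlyKahler g J) (X Y Z : VF E M) :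
    (canon g J).nab X ((canon g J).tor Y Z)
      = (canon g J).tor ((canon g J).nab X Y) Z + (canon g J).tor Y ((canon g J).nab X Z) := by
  have h1 := canon_nabTor h X Y Z
  rw [Conn.nabTor, sub_sub] at h1
  exact sub_eq_zero.1 h1

theorem Conn.tor_sub_left (c : Conn E M) (X X' Y : VF E M) :
    c.tor (X - X') Y = c.tor X Y - c.tor X' Y := by
  rw [sub_eq_add_neg, tor_add_left, tor_neg_left, sub_eq_add_neg]

theorem Conn.tor_sub_right (c : Conn E M) (X Y Y' : VF E M) :
    c.tor X (Y - Y') = c.tor X Y - c.tor X Y' := by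
  rw [sub_eq_add_neg, tor_add_right, tor_neg_right, sub_eq_add_neg]

theorem canon_curv_tor (h : IsNearlyKahler g J) (X Y Z W : VF E M) :
    (canon g J).curv X Y ((canon g J).tor Z W)
      = (canon g J).tor ((canon g J).curv X Y Z) W
        + (canon g J).tor Z ((canon g J).curv X Y W) := by
  simp only [Conn.curv, canon_nab_tor h, Conn.add_right, Conn.tor_sub_left, Conn.tor_sub_right]
  abel

theorem canon_bianchi (h : IsNearlyKahler g J) (X Y Z : VF E M) :
    (canon g J).curv X Y Z + (canon g J).curv Y Z X + (canon g J).curv Z X Y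
      = (canon g J).tor ((canon g J).tor X Y) Z + (canon g J).tor ((canon g J).tor Y Z) X
        + (canon g J).tor ((canon g J).tor Z X) Y := by
  rw [Conn.bianchi]
  simp only [canon_nabTor h, zero_add]

theorem Rm_J {x : M} (u v w : TangentSpace 𝓘(ℝ, E) x) :
    (canon g J).Rm x u v (J x w) = J x ((canon g J).Rm x u v w) := by
  obtain ⟨X, rfl⟩ := exists_VF_eq u
  obtain ⟨Y, rfl⟩ := exists_VF_eq v
  obtain ⟨Z, rfl⟩ := exists_VF_eq w
  rw [← J.app_apply, Conn.Rm_apply, Conn.Rm_apply, canon_curv_app, J.app_apply]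

theorem Rm_torsion (h : IsNearlyKahler g J) {x : M} (u v w z : TangentSpace 𝓘(ℝ, E) x) :
    (canon g J).Rm x u v (torsion g J x w z) = torsion g J x ((canon g J).Rm x u v w) z
      + torsion g J x w ((canon g J).Rm x u v z) := by
  obtain ⟨X, rfl⟩ := exists_VF_eq u
  obtain ⟨Y, rfl⟩ := exists_VF_eq v
  obtain ⟨Z, rfl⟩ := exists_VF_eq w
  obtain ⟨W, rfl⟩ := exists_VF_eq z
  rw [← canon_tor h, Conn.Rm_apply, Conn.Rm_apply, Conn.Rm_apply, canon_curv_tor h,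
    ← canon_tor h, ← canon_tor h]
  rfl

theorem Rm_bianchi (h : IsNearlyKahler g J) {x : M} (u v w : TangentSpace 𝓘(ℝ, E) x) :
    (canon g J).Rm x u v w + (canon g J).Rm x v w u + (canon g J).Rm x w u v
      = torsion g J x (torsion g J x u v) w + torsion g J x (torsion g J x v w) u
        + torsion g J x (torsion g J x w u) v := by
  obtain ⟨X, rfl⟩ := exists_VF_eq u
  obtain ⟨Y, rfl⟩ := exists_VF_eq v
  obtain ⟨Z, rfl⟩ := exists_VF_eq w
  have h1 := congrArg (fun W : VF E M ↦ W x) (canon_bianchi h X Y Z)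
  simp only [ContMDiffSection.coe_add, Pi.add_apply, canon_tor h] at h1
  simpa only [Conn.Rm_apply] using h1

end CanonicalCurvature

/-! ### The pointwise model and the eigenvalue -/

namespace HasParallelPlane

variable [T2Space M] {g : Metric E M} {J : AlmostComplex E M} {L : Distribution E M}
  (h : HasParallelPlane g J L)
include h

theorem Rm_mem {x : M} (u v : TangentSpace 𝓘(ℝ, E) x) {w : TangentSpace 𝓘(ℝ, E) x}
    (hw : w ∈ L x) : (canon g J).Rm x u v w ∈ L x := by
  obtain ⟨X, rfl⟩ := exists_VF_eq u
  obtain ⟨Y, rfl⟩ := exists_VF_eq v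
  obtain ⟨Z, rfl⟩ := exists_VF_eq w
  have h1 : (canon g J).curv X Y (h.pr Z) = h.pr ((canon g J).curv X Y Z) := by
    have hs (A B : VF E M) : h.pr (A - B) = h.pr A - h.pr B := by
      ext y
      exact map_sub (proj g L y) (A y) (B y)
    simp only [Conn.curv, h.canon_pr, hs]
  rw [← proj_of_mem g L hw, ← h.pr_apply, Conn.Rm_apply, h1]
  exact proj_mem g L x _

/-- Normalised, `v` and `Jv` form an orthonormal basis of `L` and contribute equally to the trace,
which absorbs the factor `½`. Any single nonzero `v` therefore suffices, and injectivity of `F`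
becomes injectivity of `T_v`. -/
theorem inner_torsionEndo_mul {x : M} {v : TangentSpace 𝓘(ℝ, E) x} (hv : v ∈ L x) (h0 : v ≠ 0)
    (u w : TangentSpace 𝓘(ℝ, E) x) : g.inner x (torsionEndo g J L x u) w
      = g.inner x (torsion g J x v u) (torsion g J x v w) / g.inner x v v := by
  have hpos := (g.pos x v h0).ne'
  have hJ := h.nearlyKahler.1
  rw [inner_torsionEndo, traceOn]
  set B := nablaJ g J x u ∘ₗ nablaJ g J x w with hB
  have h1 : LinearMap.trace ℝ (L x) (orthProj g L x ∘ₗ B ∘ₗ (L x).subtype)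
      = LinearMap.trace ℝ _ (((L x).subtype ∘ₗ orthProj g L x) ∘ₗ B) := by
    rw [← LinearMap.comp_assoc, LinearMap.trace_comp_comm', LinearMap.comp_assoc]
  have h2 : ((L x).subtype ∘ₗ orthProj g L x) ∘ₗ B
      = (1 / g.inner x v v) • ((g.form x v ∘ₗ B).smulRight v
        + (g.form x (J x v) ∘ₗ B).smulRight (J x v)) := by
    ext z
    change proj g L x (B z) = (1 / g.inner x v v) • (g.inner x v (B z) • v
      + g.inner x (J x v) (B z) • J x v)
    rw [h.proj_eq hv h0, g.symm x _ v, g.symm x _ (J x v)]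
    module
  have h3 (a : TangentSpace 𝓘(ℝ, E) x) :
      g.inner x a (B a) = -g.inner x (torsion g J x a u) (torsion g J x a w) := by
    have h4 (u a : TangentSpace 𝓘(ℝ, E) x) : nablaJ g J x u a = -J x (torsion g J x a u) := by
      rw [nablaJ_eq_torsion, torsion_swap h.nearlyKahler a u, map_neg]
    rw [hB, LinearMap.comp_apply, g.symm, inner_nablaJ hJ, h4, h4, map_neg, map_neg, neg_apply,
      neg_neg, hJ, g.symm]
  have h5 : g.inner x (torsion g J x (J x v) u) (torsion g J x (J x v) w)
      = g.inner x (torsion g J x v u) (torsion g J x v w) := by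
    have h6 (u : TangentSpace 𝓘(ℝ, E) x) : torsion g J x (J x v) u = -J x (torsion g J x v u) := by
      rw [torsion_swap h.nearlyKahler u, torsion_J, torsion_swap h.nearlyKahler v u, map_neg,
        neg_neg]
    rw [h6, h6, map_neg, map_neg, neg_apply, neg_neg, hJ]
  rw [h1, h2, map_smul, map_add, LinearMap.trace_smulRight, LinearMap.trace_smulRight]
  simp only [LinearMap.comp_apply, Metric.form_apply, h3, h5, smul_eq_mul]
  field_simp
  ring

/-- The tensors induced on a tangent space. -/
def model (x : M) : HolonomyModel (TangentSpace 𝓘(ℝ, E) x) where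
  g := g.form x
  symm := g.symm x
  pos := g.pos x
  J := (J x).toLinearMap
  J_sq := J.sq x
  J_orth := h.nearlyKahler.1 x
  T := torsion g J x
  T_swap := torsion_swap h.nearlyKahler
  T_skew := inner_torsion h.nearlyKahler
  T_J := torsion_J g J
  R := (canon g J).Rm x
  R_swap := (canon g J).Rm_swap x
  R_skew := (canon_isMetric h.nearlyKahler).inner_Rm x
  R_J := Rm_J
  R_T := Rm_torsion h.nearlyKahler
  bianchi := Rm_bianchi h.nearlyKahler
  L := L x
  finrank_L := h.subbundle.1 x
  J_L := h.stable x
  R_L u v _ := h.Rm_mem u v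
  P := (proj g L x).toLinearMap
  P_mem := proj_mem g L x
  P_of_mem _ := proj_of_mem g L
  P_symm := inner_proj g L x
  inj v u hv h0 hu hT := by
    refine h.inj x u ((proj_eq_zero_iff g L).1 hu) (g.ext_inner fun w ↦ ?_)
    rw [h.inner_torsionEndo_mul hv h0, hT]
    simp

theorem proj_J {x : M} (v : TangentSpace 𝓘(ℝ, E) x) :
    proj g L x (J x v) = J x (proj g L x v) := (h.model x).P_J v

/-- If `L` were the whole tangent space, the torsion would vanish by `T_mem_mem`, against
strictness. -/
theorem exists_mem_orthCompl (x : M) : ∃ u : TangentSpace 𝓘(ℝ, E) x, u ≠ 0 ∧ proj g L x u = 0 := by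
  by_contra! hc
  have hL (u : TangentSpace 𝓘(ℝ, E) x) : u ∈ L x := by
    have h1 := proj_sub_proj g L x u
    have h2 : u - proj g L x u = 0 := by
      by_contra h3
      exact hc _ h3 h1
    rw [sub_eq_zero.1 h2]
    exact proj_mem g L x u
  obtain ⟨v, -, h0⟩ := h.exists_ne_zero x
  refine h.strict x v h0 ?_
  ext w
  have h1 : torsion g J x v w = 0 := (h.model x).T_mem_mem (hL v) (hL w)
  rw [nablaJ_eq_torsion, h1, map_zero, LinearMap.zero_apply]

theorem exists_torsion_torsion (x : M) : ∃ l : ℝ, ∀ v ∈ L x, ∀ y, proj g L x y = 0 →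
    torsion g J x v (torsion g J x v y) = -(l * g.inner x v v) • y :=
  (h.model x).exists_T_T

/-- The eigenvalue of the torsion form of `L` on the orthogonal complement of `L`. -/
def eigenvalue (x : M) : ℝ := (h.exists_torsion_torsion x).choose

theorem torsion_torsion {x : M} {v y : TangentSpace 𝓘(ℝ, E) x} (hv : v ∈ L x)
    (hy : proj g L x y = 0) :
    torsion g J x v (torsion g J x v y) = -(h.eigenvalue x * g.inner x v v) • y :=
  (h.exists_torsion_torsion x).choose_spec v hv y hy

theorem inner_torsion_torsion {x : M} {v y : TangentSpace 𝓘(ℝ, E) x} (hv : v ∈ L x)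
    (hy : proj g L x y = 0) (z : TangentSpace 𝓘(ℝ, E) x) :
    g.inner x (torsion g J x v y) (torsion g J x v z)
      = h.eigenvalue x * g.inner x v v * g.inner x y z := by
  rw [← neg_inj, ← inner_torsion h.nearlyKahler, h.torsion_torsion hv hy, map_smul, smul_apply,
    smul_eq_mul, neg_mul]

theorem torsionEndo_eq {x : M} {u : TangentSpace 𝓘(ℝ, E) x} (hu : u ∈ orthCompl g L x) :
    torsionEndo g J L x u = h.eigenvalue x • u := by
  obtain ⟨v, hv, h0⟩ := h.exists_ne_zero x
  refine g.ext_inner fun w ↦ ?_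
  have hpos := (g.pos x v h0).ne'
  rw [h.inner_torsionEndo_mul hv h0, h.inner_torsion_torsion hv ((proj_eq_zero_iff g L).2 hu),
    map_smul, smul_apply, smul_eq_mul]
  field_simp

theorem eigenvalue_pos (x : M) : 0 < h.eigenvalue x := by
  obtain ⟨v, hv, h0⟩ := h.exists_ne_zero x
  obtain ⟨y, hy0, hy⟩ := h.exists_mem_orthCompl x
  have h1 : torsion g J x v y ≠ 0 := fun h2 ↦ hy0 ((h.model x).inj v y hv h0 hy h2)
  have h2 := g.pos x _ h1
  rw [h.inner_torsion_torsion hv hy, mul_assoc] at h2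
  exact pos_of_mul_pos_left h2 (mul_pos (g.pos x v h0) (g.pos x y hy0)).le

end HasParallelPlane

/-! ### The eigenvalue of the torsion form is constant -/

theorem SmoothFn.isLocallyConstant {f : SmoothFn E M}
    (hf : ∀ x, mvfderiv 𝓘(ℝ, E) (fun y ↦ f y) x = 0) : IsLocallyConstant f := by
  rw [IsLocallyConstant.iff_eventually_eq]
  intro x
  let φ := extChartAt 𝓘(ℝ, E) x
  have hφ : IsOpen φ.target := isOpen_extChartAt_target x
  obtain ⟨r, hr, hball⟩ := Metric.isOpen_iff.1 hφ _ (mem_extChartAt_target x)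
  have hd (z : E) (hz : z ∈ φ.target) :
      MDifferentiableAt 𝓘(ℝ, E) 𝓘(ℝ, E) φ.symm z :=
    ((contMDiffOn_extChartAt_symm (n := ∞) x).mdifferentiableOn (by simp)).mdifferentiableAt
      (hφ.mem_nhds hz)
  have hf' (y : M) : mfderiv 𝓘(ℝ, E) 𝓘(ℝ, ℝ) f y = 0 := hf y
  have hF (z : E) (hz : z ∈ φ.target) : DifferentiableAt ℝ (f ∘ φ.symm) z :=
    mdifferentiableAt_iff_differentiableAt.1 ((f.mdiff _).comp z (hd z hz))
  have hF' (z : E) (hz : z ∈ φ.target) : fderiv ℝ (f ∘ φ.symm) z = 0 := by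
    rw [← mfderiv_eq_fderiv, mfderiv_comp z (f.mdiff _) (hd z hz), hf']
    exact ContinuousLinearMap.zero_comp _
  have hconst {z w : E} (hz : z ∈ Metric.ball (φ x) r) (hw : w ∈ Metric.ball (φ x) r) :
      f (φ.symm z) = f (φ.symm w) :=
    Metric.isOpen_ball.is_const_of_fderiv_eq_zero (convex_ball _ _).isPreconnected
      (fun z hz ↦ (hF z (hball hz)).differentiableWithinAt) (fun z hz ↦ hF' z (hball hz)) hz hw
  have hs : φ.source ∈ nhds x := extChartAt_source_mem_nhds x
  have hb : φ ⁻¹' Metric.ball (φ x) r ∈ nhds x :=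
    (continuousAt_extChartAt x).preimage_mem_nhds (Metric.ball_mem_nhds _ hr)
  filter_upwards [hs, hb] with y hy hyb
  have h1 := hconst hyb (Metric.mem_ball_self hr)
  rwa [φ.left_inv hy, φ.left_inv (mem_extChartAt_source x)] at h1

namespace HasParallelPlane

variable [T2Space M] {g : Metric E M} {J : AlmostComplex E M} {L : Distribution E M}
  (h : HasParallelPlane g J L)
include h

/-- Polarisation of `inner_torsion_torsion` in the argument from `L`. -/
theorem inner_torsion_add {x : M} {v v' y : TangentSpace 𝓘(ℝ, E) x} (hv : v ∈ L x)
    (hv' : v' ∈ L x) (hy : proj g L x y = 0) :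
    g.inner x (torsion g J x v y) (torsion g J x v' y)
      = h.eigenvalue x * g.inner x v v' * g.inner x y y := by
  have h1 := h.inner_torsion_torsion (add_mem hv hv') hy y
  have h2 := h.inner_torsion_torsion hv hy y
  have h3 := h.inner_torsion_torsion hv' hy y
  simp only [map_add, LinearMap.add_apply, add_apply] at h1
  rw [g.symm x v' v, g.symm x (torsion g J x v' y)] at h1
  linarith

theorem exists_sections (x : M) : ∃ V Y : VF E M, V x ≠ 0 ∧ Y x ≠ 0 ∧ h.pr V = V ∧ h.pr Y = 0 := by
  obtain ⟨v, hv, hv0⟩ := h.exists_ne_zero x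
  obtain ⟨y, hy0, hy⟩ := h.exists_mem_orthCompl x
  refine ⟨h.pr (extVF v), extVF y - h.pr (extVF y), ?_, ?_, ?_, ?_⟩
  · rwa [h.pr_apply, extVF_self, proj_of_mem g L hv]
  · rwa [ContMDiffSection.coe_sub, Pi.sub_apply, h.pr_apply, extVF_self, hy, sub_zero]
  · ext z
    exact proj_of_mem g L (proj_mem g L z _)
  · ext z
    exact proj_sub_proj g L z _

/-- Near `x` it is the quotient `|T(V, Y)|² / (|V|² |Y|²)` for fields `V` in `L` and `Y` orthogonal
to `L`. -/
theorem contMDiff_eigenvalue : ContMDiff 𝓘(ℝ, E) 𝓘(ℝ, ℝ) ∞ h.eigenvalue := by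
  intro x
  obtain ⟨V, Y, hV0, hY0, hV, hY⟩ := h.exists_sections x
  let T := (canon g J).tor V Y
  have hV (z : M) : V z ∈ L z := by
    rw [← hV]
    exact proj_mem g L z _
  have hY (z : M) : proj g L z (Y z) = 0 := congrArg (fun W : VF E M ↦ W z) hY
  have hx : (g.ip V V * g.ip Y Y) x ≠ 0 :=
    mul_ne_zero (g.pos x _ hV0).ne' (g.pos x _ hY0).ne'
  have hev := (g.ip V V * g.ip Y Y).contMDiff.continuous.continuousAt.eventually_ne hx
  refine ContMDiffAt.congr_of_eventuallyEq ((g.ip T T).contMDiff.contMDiffAt.div₀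
    (g.ip V V * g.ip Y Y).contMDiff.contMDiffAt hx) ?_
  filter_upwards [hev] with z hz
  have h1 : g.ip T T z = h.eigenvalue z * g.inner z (V z) (V z) * g.inner z (Y z) (Y z) := by
    rw [Metric.ip_apply, canon_tor h.nearlyKahler, h.inner_torsion_torsion (hV z) (hY z)]
  rw [Pi.div_apply, eq_div_iff hz, h1, mul_assoc]
  rfl

theorem eigenvalue_isLocallyConstant : IsLocallyConstant h.eigenvalue := by
  let f : SmoothFn E M := ⟨h.eigenvalue, h.contMDiff_eigenvalue⟩
  refine SmoothFn.isLocallyConstant (f := f) fun x ↦ ?_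
  ext u
  obtain ⟨X, rfl⟩ := exists_VF_eq u
  change dir X f x = 0
  obtain ⟨V, Y, hV0, hY0, hV, hY⟩ := h.exists_sections x
  let T := (canon g J).tor V Y
  have hm : ∀ X Y Z, dir X (g.ip Y Z)
    = g.ip ((canon g J).nab X Y) Z + g.ip Y ((canon g J).nab X Z) := canon_isMetric h.nearlyKahler
  have hVL (z : M) : V z ∈ L z := by
    rw [← hV]
    exact proj_mem g L z _
  have hVL' : (canon g J).nab X V x ∈ L x := by
    rw [← hV, h.canon_pr]
    exact proj_mem g L x _
  have hY (z : M) : proj g L z (Y z) = 0 := congrArg (fun W : VF E M ↦ W z) hY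
  -- Differentiate this along `X`. Since `T` and `L` are parallel, the terms with derivatives of `V`
  -- and `Y` cancel by `h5` and `h6`, leaving `|V|² |Y|² Xf = 0` at `x`.
  have h1 : g.ip T T = f * (g.ip V V * g.ip Y Y) := by
    ext z
    rw [Metric.ip_apply, canon_tor h.nearlyKahler,
      h.inner_torsion_torsion (hVL z) (hY z), mul_assoc]
    rfl
  have h2 := congrArg (fun F : SmoothFn E M ↦ F x) (congrArg (dir X) h1)
  have h3 : (canon g J).nab X T x = torsion g J x ((canon g J).nab X V x) (Y x)
      + torsion g J x (V x) ((canon g J).nab X Y x) := by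
    rw [canon_nab_tor h.nearlyKahler, ContMDiffSection.coe_add, Pi.add_apply,
      canon_tor h.nearlyKahler, canon_tor h.nearlyKahler]
  have h4 : T x = torsion g J x (V x) (Y x) := canon_tor h.nearlyKahler _ _ _
  have h5 := h.inner_torsion_add hVL' (hVL x) (hY x)
  have h6 := h.inner_torsion_torsion (hVL x) (hY x) ((canon g J).nab X Y x)
  rw [dir_mul, dir_mul, hm, hm, hm] at h2
  simp only [ContMDiffMap.coe_add, ContMDiffMap.coe_mul, Pi.add_apply, Pi.mul_apply,
    Metric.ip_apply, h3, h4, map_add, add_apply] at h2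
  have h7 : f x = h.eigenvalue x := rfl
  rw [h7, g.symm x (torsion g J x (V x) ((canon g J).nab X Y x)),
    g.symm x (torsion g J x (V x) (Y x)) (torsion g J x ((canon g J).nab X V x) (Y x)), h5, h6,
    g.symm x ((canon g J).nab X Y x), g.symm x (V x) ((canon g J).nab X V x)] at h2
  have h8 : g.inner x (V x) (V x) * g.inner x (Y x) (Y x) * dir X f x = 0 := by linarith
  exact (mul_eq_zero.1 h8).resolve_left
    (mul_ne_zero (g.pos x _ hV0).ne' (g.pos x _ hY0).ne')

end HasParallelPlane

/-! ### The modified metric and the reversed almost complex structure -/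

namespace HasParallelPlane

variable [T2Space M] {g : Metric E M} {J : AlmostComplex E M} {L : Distribution E M}
  (h : HasParallelPlane g J L)

/-- The metric which is `g` on the orthogonal complement of `L` and `2g` on `L`. -/
def metric : Metric E M where
  inner x := g.inner x + (g.inner x).comp (proj g L x)
  symm x v w := by
    change g.inner x v w + g.inner x (proj g L x v) w = g.inner x w v + g.inner x (proj g L x w) v
    rw [inner_proj, g.symm x v w, g.symm x v (proj g L x w)]
  pos x v hv := by
    change 0 < g.inner x v v + g.inner x (proj g L x v) v
    have h1 : g.inner x (proj g L x v) v = g.inner x (proj g L x v) (proj g L x v) := by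
      rw [← inner_proj, proj_of_mem g L (proj_mem g L x v)]
    have h2 : 0 ≤ g.inner x (proj g L x v) (proj g L x v) := by
      by_cases h0 : proj g L x v = 0
      · simp [h0]
      · exact (g.pos x _ h0).le
    linarith [g.pos x v hv]
  isVonNBounded x := by
    -- The new metric dominates `g`, so its unit ball lies in that of `g`.
    refine (g.isVonNBounded x).subset fun v hv ↦ ?_
    change g.inner x v v + g.inner x (proj g L x v) v < 1 at hv
    change g.inner x v v < 1
    have h1 : g.inner x (proj g L x v) v = g.inner x (proj g L x v) (proj g L x v) := by
      rw [← inner_proj, proj_of_mem g L (proj_mem g L x v)]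
    have h2 : 0 ≤ g.inner x (proj g L x v) (proj g L x v) := by
      by_cases h0 : proj g L x v = 0
      · simp [h0]
      · exact (g.pos x _ h0).le
    linarith
  contMDiff := by
    refine contMDiff_hom_of_apply (F₂ := E →L[ℝ] ℝ)
      (V₂ := fun x : M ↦ TangentSpace 𝓘(ℝ, E) x →L[ℝ] Bundle.Trivial M ℝ x) fun Z ↦ ?_
    refine contMDiff_hom_of_apply (F₂ := ℝ) (V₂ := Bundle.Trivial M ℝ) fun W ↦ ?_
    intro x
    rw [contMDiffAt_totalSpace]
    exact ⟨contMDiffAt_id, (g.ip Z W + g.ip (h.pr Z) W).contMDiff x⟩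

theorem metric_inner {x : M} (v w : TangentSpace 𝓘(ℝ, E) x) :
    h.metric.inner x v w = g.inner x v w + g.inner x (proj g L x v) w := rfl

/-- The almost complex structure which is `J` on the orthogonal complement of `L` and `-J` on
`L`. -/
def reversed : AlmostComplex E M where
  toFun x := J x - (2 : ℝ) • (J x ∘L proj g L x)
  smooth := contMDiff_hom_of_apply fun Z ↦ (J.app Z - (2 : ℝ) • J.app (h.pr Z)).contMDiff
  sq x v := by
    simp only [sub_apply, smul_apply, ContinuousLinearMap.comp_apply, map_sub, map_smul, h.proj_J,
      proj_proj, J.sq]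
    module

theorem reversed_apply {x : M} (v : TangentSpace 𝓘(ℝ, E) x) :
    h.reversed x v = J x v - (2 : ℝ) • J x (proj g L x v) := rfl

theorem isModifiedMetric : IsModifiedMetric g h.metric L := by
  refine fun x ↦ ⟨fun v hv w _ ↦ ?_, fun v hv w _ ↦ ?_, fun v hv w hw ↦ ?_⟩
  · rw [h.metric_inner, (proj_eq_zero_iff g L).2 hv]
    simp
  · rw [h.metric_inner, proj_of_mem g L hv]
    ring
  · have h1 := (proj_eq_zero_iff g L).2 hv
    rw [h.metric_inner, h1, inner_of_mem g L h1 hw]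
    simp

theorem isReversed : IsReversed g J h.reversed L := by
  refine fun x ↦ ⟨fun v hv ↦ ?_, fun v hv ↦ ?_⟩
  · rw [h.reversed_apply, (proj_eq_zero_iff g L).2 hv]
    simp
  · rw [h.reversed_apply, proj_of_mem g L hv]
    module

theorem isAlmostHermitian : IsAlmostHermitian h.metric h.reversed := by
  intro x v w
  have hJ := h.nearlyKahler.1
  have h1 := inner_proj g L x v (proj g L x w)
  rw [proj_of_mem g L (proj_mem g L x w)] at h1
  simp only [h.metric_inner, h.reversed_apply, map_sub, map_smul, sub_apply, smul_apply, h.proj_J,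
    proj_proj, hJ x, h1, inner_proj g L x v w, smul_eq_mul]
  ring

end HasParallelPlane

/-! ### The Levi-Civita connection of the modified metric -/

namespace HasParallelPlane

variable [T2Space M] {g : Metric E M} {J : AlmostComplex E M} {L : Distribution E M}
  (h : HasParallelPlane g J L)

/-- The difference between the Levi-Civita connection of the modified metric and the canonical
Hermitian connection. -/
def corr (X Y : VF E M) : VF E M :=
  (-(1 / 2) : ℝ) • (canon g J).tor (X - h.pr X) (Y + h.pr Y)

theorem corr_apply (X Y : VF E M) (x : M) : h.corr X Y x = (h.model x).C (X x) (Y x) := by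
  change (-(1 / 2) : ℝ) • (canon g J).tor (X - h.pr X) (Y + h.pr Y) x = _
  rw [canon_tor h.nearlyKahler]
  rfl

theorem corr_eq (X Y : VF E M) (x : M) : h.corr X Y x
    = (-(1 / 2) : ℝ) • torsion g J x (X x - proj g L x (X x)) (Y x + proj g L x (Y x)) :=
  h.corr_apply X Y x

theorem corr_add_left (X X' Y : VF E M) : h.corr (X + X') Y = h.corr X Y + h.corr X' Y := by
  ext x
  simp only [h.corr_eq, ContMDiffSection.coe_add, Pi.add_apply, map_add, map_sub,
    LinearMap.add_apply, LinearMap.sub_apply]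
  module

theorem corr_sub_left (X X' Y : VF E M) : h.corr (X - X') Y = h.corr X Y - h.corr X' Y := by
  have h1 := h.corr_add_left (X - X') X' Y
  rw [sub_add_cancel] at h1
  rw [h1, add_sub_cancel_right]

theorem corr_add_right (X Y Y' : VF E M) : h.corr X (Y + Y') = h.corr X Y + h.corr X Y' := by
  ext x
  simp only [h.corr_apply, ContMDiffSection.coe_add, Pi.add_apply, map_add]

theorem canon_corr (X Y Z : VF E M) : (canon g J).nab X (h.corr Y Z)
    = h.corr ((canon g J).nab X Y) Z + h.corr Y ((canon g J).nab X Z) := by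
  simp only [corr, Conn.smul_right, canon_nab_tor h.nearlyKahler, Conn.sub_right, Conn.add_right,
    h.canon_pr, smul_add]

/-- The Levi-Civita connection of the modified metric. -/
def conn : Conn E M where
  nab X Y := (canon g J).nab X Y + h.corr X Y
  add_left X X' Y := by
    rw [Conn.add_left, h.corr_add_left]
    abel
  fmul_left f X Y := by
    ext x
    simp only [Conn.fmul_left, ContMDiffSection.coe_add, Pi.add_apply, h.corr_eq, fmul_apply,
      map_sub, map_smul, LinearMap.sub_apply, LinearMap.smul_apply]
    module
  add_right X Y Y' := by
    rw [Conn.add_right, h.corr_add_right]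
    abel
  leibniz f X Y := by
    ext x
    simp only [Conn.leibniz, ContMDiffSection.coe_add, Pi.add_apply, h.corr_apply, fmul_apply,
      map_smul]
    module

theorem conn_nab (X Y : VF E M) : h.conn.nab X Y = (canon g J).nab X Y + h.corr X Y := rfl

theorem metric_ip (X Y : VF E M) : h.metric.ip X Y = g.ip X Y + g.ip (h.pr X) Y := rfl

theorem conn_isMetric : h.conn.IsMetric h.metric := by
  intro X Y Z
  have hm : ∀ X Y Z, dir X (g.ip Y Z)
    = g.ip ((canon g J).nab X Y) Z + g.ip Y ((canon g J).nab X Z) := canon_isMetric h.nearlyKahler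
  rw [h.metric_ip, dir_add, hm, hm, h.canon_pr]
  ext x
  have h1 := (h.model x).C_skew (X x) (Y x) (Z x)
  rw [← h.corr_apply, ← h.corr_apply] at h1
  change g.inner x (h.corr X Y x) (Z x + proj g L x (Z x))
    + g.inner x (Y x + proj g L x (Y x)) (h.corr X Z x) = 0 at h1
  rw [map_add, ← inner_proj] at h1
  simp only [conn_nab, ContMDiffMap.coe_add, Pi.add_apply, Metric.ip_apply, h.metric_inner,
    ContMDiffSection.coe_add, map_add, add_apply, pr_apply] at h1 ⊢
  linarith

theorem conn_tor (X Y : VF E M) : h.conn.tor X Y = 0 := by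
  ext x
  have h1 := (h.model x).T_add_C_sub_C (X x) (Y x)
  change torsion g J x (X x) (Y x) + _ - _ = _ at h1
  rw [← h.corr_apply, ← h.corr_apply, ← canon_tor h.nearlyKahler] at h1
  simp only [Conn.tor, conn_nab, ContMDiffSection.coe_add, ContMDiffSection.coe_sub, Pi.add_apply,
    Pi.sub_apply] at h1 ⊢
  change _ = (0 : TangentSpace 𝓘(ℝ, E) x)
  rw [← h1]
  abel

theorem lc_metric_nab (X Y : VF E M) : (lc h.metric).nab X Y = h.conn.nab X Y :=
  (Conn.eq_lc h.conn_isMetric h.conn_tor X Y).symm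

theorem reversed_app (X : VF E M) :
    h.reversed.app X = J.app X - (2 : ℝ) • J.app (h.pr X) := rfl

theorem lc_metric_reversed (X Y : VF E M) :
    (lc h.metric).nab X (h.reversed.app Y) = h.reversed.app ((lc h.metric).nab X Y) := by
  rw [h.lc_metric_nab, h.lc_metric_nab, h.conn_nab, h.conn_nab]
  have h1 : (canon g J).nab X (h.reversed.app Y) = h.reversed.app ((canon g J).nab X Y) := by
    simp only [reversed_app, Conn.sub_right, Conn.smul_right, canon_app, h.canon_pr]
  rw [h1]
  ext x
  have h2 : (h.model x).Jrev ((h.model x).C (X x) (Y x))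
      = (h.model x).C (X x) ((h.model x).Jrev (Y x)) :=
    congrArg (fun A ↦ A (Y x)) ((h.model x).Jrev_C (X x))
  rw [← h.corr_apply] at h2
  have h3 : h.corr X (h.reversed.app Y) x = (h.model x).C (X x) ((h.model x).Jrev (Y x)) :=
    h.corr_apply _ _ _
  have h4 : (h.model x).Jrev (h.corr X Y x) = h.reversed x (h.corr X Y x) := rfl
  rw [ContMDiffSection.coe_add, Pi.add_apply, h3, ← h2, h4, AlmostComplex.app_apply,
    AlmostComplex.app_apply, ContMDiffSection.coe_add, Pi.add_apply, map_add]

/-- `C` is built from `∇̄`-parallel tensors, so no derivative of it appears; the torsion term arises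
because the bracket differs from `∇̄_X Y - ∇̄_Y X` by the torsion. -/
theorem Rm_metric (x : M) (u v : TangentSpace 𝓘(ℝ, E) x) :
    (lc h.metric).Rm x u v = (canon g J).Rm x u v + (h.model x).C (torsion g J x u v)
      + ((h.model x).C u ∘ₗ (h.model x).C v - (h.model x).C v ∘ₗ (h.model x).C u) := by
  ext w
  obtain ⟨X, rfl⟩ := exists_VF_eq u
  obtain ⟨Y, rfl⟩ := exists_VF_eq v
  obtain ⟨Z, rfl⟩ := exists_VF_eq w
  have h1 : (lc h.metric).curv X Y Z = (canon g J).curv X Y Z + h.corr ((canon g J).tor X Y) Z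
      + (h.corr X (h.corr Y Z) - h.corr Y (h.corr X Z)) := by
    simp only [Conn.curv, h.lc_metric_nab, h.conn_nab, Conn.add_right, h.canon_corr,
      h.corr_add_right, Conn.tor, h.corr_sub_left]
    abel
  simp only [LinearMap.add_apply, LinearMap.sub_apply, LinearMap.comp_apply, Conn.Rm_apply, h1,
    ← h.corr_apply, ← canon_tor h.nearlyKahler, ContMDiffSection.coe_add, ContMDiffSection.coe_sub,
    Pi.add_apply, Pi.sub_apply]

/-! ### The Kähler–Einstein structure -/

theorem Rm_lc_bianchi (g : Metric E M) {x : M} (u v w : TangentSpace 𝓘(ℝ, E) x) :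
    (lc g).Rm x u v w + (lc g).Rm x v w u + (lc g).Rm x w u v = 0 := by
  obtain ⟨X, rfl⟩ := exists_VF_eq u
  obtain ⟨Y, rfl⟩ := exists_VF_eq v
  obtain ⟨Z, rfl⟩ := exists_VF_eq w
  have h0 (X : VF E M) : (lc g).nab X 0 = 0 := map_zero ((lc g).bil X)
  have h1 := (lc g).bianchi X Y Z
  simp only [Conn.nabTor, lc_tor, h0, sub_zero, add_zero] at h1
  have h2 := congrArg (fun W : VF E M ↦ W x) h1
  simp only [Conn.Rm_apply]
  exact h2

theorem ricci_metric {n : ℕ} (hn : Module.finrank ℝ E = 2 * n) (x : M)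
    (u v : TangentSpace 𝓘(ℝ, E) x) :
    ricci h.metric x u v = (n + 1) * h.eigenvalue x * h.metric.inner x u v := by
  have key (u v : TangentSpace 𝓘(ℝ, E) x) : ricci h.metric x v (h.reversed x u)
      = (n + 1) * h.eigenvalue x * h.metric.inner x v (h.reversed x u) := by
    have h1 := trace_J_comp_curvature (h.metric.form_nondegenerate x) (h.metric.symm x)
      (J := (h.reversed x).toLinearMap) (h.reversed.sq x) (h.isAlmostHermitian x)
      (S := (lc h.metric).Rm x) ((lc h.metric).Rm_swap x) ((lc_isMetric h.metric).inner_Rm x)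
      (fun u v w ↦ by
        obtain ⟨X, rfl⟩ := exists_VF_eq u
        obtain ⟨Y, rfl⟩ := exists_VF_eq v
        obtain ⟨Z, rfl⟩ := exists_VF_eq w
        change (lc h.metric).Rm x _ _ (h.reversed.app Z x) = h.reversed x _
        rw [Conn.Rm_apply, Conn.Rm_apply, ← h.reversed.app_apply]
        simp only [Conn.curv, h.lc_metric_reversed, AlmostComplex.app_sub])
      (Rm_lc_bianchi h.metric) u v
    have h2 : (h.reversed x).toLinearMap = (h.model x).Jrev := rfl
    have h3 := (h.model x).trace_Jrev_curvature u v
    have h4 := (h.model x).trace_Jrev_R (n := n) hn (h.eigenvalue_pos x).ne'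
      (fun v hv y hy ↦ h.torsion_torsion hv hy) (h.exists_mem_orthCompl x) u v
    rw [h.Rm_metric, h2] at h1
    rw [ricci_eq_trace]
    have h5 : h.metric.inner x v (h.reversed x u)
        = g.inner x (J x u) v - 3 * g.inner x (J x (proj g L x u)) v := by
      rw [h.metric.symm, h.metric_inner, h.reversed_apply]
      simp only [map_sub, map_smul, h.proj_J, proj_proj, sub_apply, smul_apply, smul_eq_mul]
      ring
    have h6 : (h.reversed x) u = (h.model x).Jrev u := rfl
    have h7 := (h1.symm.trans h3).trans h4
    rw [h5, h6]
    change _ = (n + 1) * (2 * h.eigenvalue x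
      * (g.inner x (J x u) v - 3 * g.inner x (J x (proj g L x u)) v)) at h7
    linarith
  -- Every vector is in the image of `J̄`: `v = J̄(-J̄v)`.
  have h1 := key (-h.reversed x v) u
  rwa [map_neg, h.reversed.sq, neg_neg] at h1

/-- `J̄` is parallel for the Levi-Civita connection of `ḡ`. Brackets written through this
torsion-free connection make the Nijenhuis tensor and the exterior derivative cancel term by term.
-/
theorem isKahler : IsKahler h.metric h.reversed := by
  have hl (X Y : VF E M) : lie X Y = (lc h.metric).nab X Y - (lc h.metric).nab Y X :=
    (sub_eq_zero.1 (lc_tor h.metric X Y)).symm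
  refine ⟨h.isAlmostHermitian, fun X Y hX hY x ↦ ?_, fun X Y Z hX hY hZ x ↦ ?_⟩
  · let X' : VF E M := ⟨X, hX⟩
    let Y' : VF E M := ⟨Y, hY⟩
    have h1 : lie X' Y' + h.reversed.app (lie (h.reversed.app X') Y')
        + h.reversed.app (lie X' (h.reversed.app Y'))
        - lie (h.reversed.app X') (h.reversed.app Y') = 0 := by
      simp only [hl, h.lc_metric_reversed, AlmostComplex.app_sub, AlmostComplex.app_app]
      abel
    exact congrArg (fun W : VF E M ↦ W x) h1
  · let X' : VF E M := ⟨X, hX⟩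
    let Y' : VF E M := ⟨Y, hY⟩
    let Z' : VF E M := ⟨Z, hZ⟩
    let β (X Y : VF E M) : SmoothFn E M := h.metric.ip (h.reversed.app X) Y
    have h1 : extDeriv₂ (kahlerForm h.metric h.reversed) X Y Z x
      = (dir X' (β Y' Z') - dir Y' (β X' Z') + dir Z' (β X' Y')
        - β (lie X' Y') Z' + β (lie X' Z') Y' - β (lie Y' Z') X') x := rfl
    have hs (X Y : VF E M) : β X Y = -β Y X := by
      ext x
      change h.metric.inner x _ _ = -h.metric.inner x _ _
      rw [h.metric.symm, h.reversed.app_apply, h.reversed.app_apply,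
        inner_J_left h.isAlmostHermitian, neg_neg]
    have hd (X Y Z : VF E M) : dir X (β Y Z)
        = β ((lc h.metric).nab X Y) Z - β ((lc h.metric).nab X Z) Y := by
      rw [sub_eq_add_neg, ← hs]
      simp only [β, lc_isMetric h.metric X, h.lc_metric_reversed]
    have hβ (X X' Y : VF E M) : β (X - X') Y = β X Y - β X' Y := by
      simp only [β, AlmostComplex.app_sub, Metric.ip_sub_left]
    rw [h1, hd, hd, hd, hl, hl, hl, hβ, hβ, hβ]
    have h2 : (0 : SmoothFn E M) x = 0 := rfl
    rw [← h2]
    congr 1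
    abel

end HasParallelPlane

end Manifold

end NearlyKahler

end

theorem lemma5p1 {n : ℕ} {M : Type*} [TopologicalSpace M]
    [ChartedSpace (EuclideanSpace ℝ (Fin (2 * n))) M]
    [IsManifold 𝓘(ℝ, EuclideanSpace ℝ (Fin (2 * n))) ∞ M]
    [T2Space M] [SecondCountableTopology M] [ConnectedSpace M]
    (g : NearlyKahler.Metric (EuclideanSpace ℝ (Fin (2 * n))) M)
    (J : NearlyKahler.AlmostComplex (EuclideanSpace ℝ (Fin (2 * n))) M)
    (hNK : NearlyKahler.IsNearlyKahler g J)
    (hstrict : NearlyKahler.IsStrict g J)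
    (L : NearlyKahler.Distribution (EuclideanSpace ℝ (Fin (2 * n))) M)
    (hrank : NearlyKahler.IsSubbundle L 2)
    (hJL : NearlyKahler.IsStable J L)
    (hparallel : NearlyKahler.IsParallel g J L)
    (hinj : ∀ x : M, ∀ u ∈ NearlyKahler.orthCompl g L x,
      NearlyKahler.torsionEndo g J L x u = 0 → u = 0) :
    ∃ k : ℝ, 0 < k ∧
      (∀ x : M, ∀ u ∈ NearlyKahler.orthCompl g L x,
        NearlyKahler.torsionEndo g J L x u = (k / 4) • u) ∧
      ∃ (g' : NearlyKahler.Metric (EuclideanSpace ℝ (Fin (2 * n))) M)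
        (J' : NearlyKahler.AlmostComplex (EuclideanSpace ℝ (Fin (2 * n))) M),
        NearlyKahler.IsModifiedMetric g g' L ∧
        NearlyKahler.IsReversed g J J' L ∧
        NearlyKahler.IsEinstein g' ((n + 1) / 4 * k) ∧
        NearlyKahler.IsKahler g' J' := by
  have h : NearlyKahler.HasParallelPlane g J L := ⟨hNK, hstrict, hrank, hJL, hparallel, hinj⟩
  obtain ⟨x₀⟩ := (inferInstance : Nonempty M)
  have hc (x : M) : h.eigenvalue x = h.eigenvalue x₀ :=
    h.eigenvalue_isLocallyConstant.apply_eq_of_preconnectedSpace x x₀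
  -- `F` is `l` on the complement and the Ricci constant is `(n + 1)l`, so `k = 4l` fits both
  -- normalisations.
  refine ⟨4 * h.eigenvalue x₀, mul_pos four_pos (h.eigenvalue_pos x₀), fun x u hu ↦ ?_,
    h.metric, h.reversed, h.isModifiedMetric, h.isReversed, fun x u v ↦ ?_, h.isKahler⟩
  · rw [h.torsionEndo_eq hu, hc, mul_div_cancel_left₀ _ four_ne_zero]
  · rw [h.ricci_metric finrank_euclideanSpace_fin, hc]
    ring
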